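/- Let $1\le m<n$ be integers, let $\Lambda:\mathbb{R}^n\to GL(n,\mathbb{R})$ be an arbitrary map, and let $\mu$ be a finite Borel measure on $\mathbb{R}^n$. Write $B(x,r)$ for the closed Euclidean ball. Suppose that for $\mu$-a.e. $a\in\mathbb{R}^n$ the lower $m$-density is positive, $$\theta^m_*(\mu,a)=\liminf_{r\downarrow 0}\frac{\mu(B(a,r))}{r^m}>0,$$ and that for $\mu$-a.e. $a$ the principal value $$T^m_\Lambda\mu(a)=\lim_{\epsilon\downarrow 0}\int_{|\Lambda(a)^{-1}(y-a)|\ge\epsilon}\frac{\Lambda(a)^{-1}(y-a)}{|\Lambda(a)^{-1}(y-a)|^{m+1}}\,d\mu(y)$$ exists in $\mathbb{R}^n$. For $a\in\mathbb{R}^n$ let $\mathrm{Tan}_\Lambda(\mu,a)$, the set of $\Lambda$-tangents to $\mu$ at $a$, be the set of all non-zero Radon measures $\nu$ on $\mathbb{R}^n$ for which there are $c_i>0$ and $r_i\downarrow 0$ such that $c_i\,T^\Lambda_{a,r_i}[\mu]\to\nu$ in the weak-$*$ sense (against continuous functions with compact support), where $T^\Lambda_{a,r}(y)=\Lambda(a)^{-1}\big(\tfrac{y-a}{r}\big)$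 and $T[\mu](E)=\mu(T^{-1}(E))$. Then for $\mu$-a.e. $a$, every $\nu\in\mathrm{Tan}_\Lambda(\mu,a)$ satisfies $$\int_{r\le|y-x|\le R}\frac{y-x}{|y-x|^{m+1}}\,d\nu(y)=0\qquad\text{for all }x\in\operatorname{spt}\nu\text{ and all }0<r<R<\infty .$$ In particular, for $\mu$-a.e. $a$, $\mathrm{Tan}_\Lambda(\mu,a)\subset\mathcal{S}_n$, where $\mathcal{S}_n$ is the set of all non-zero locally finite Borel measures $\nu$ on $\mathbb{R}^n$ with $0\in\operatorname{spt}\nu$ such that $$\int_{B(x,r)}\langle z-x,y\rangle\,d\nu(z)=0\qquad\text{for all }x\in\operatorname{spt}\nu,\ y\in\mathbb{R}^n,\ r>0 .$$ -/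

import Mathlib

open MeasureTheory Filter Topology
open scoped ENNReal

/-- `ℝⁿ` with the Euclidean norm. -/
abbrev Euc (n : ℕ) : Type := EuclideanSpace ℝ (Fin n)

/-- The invertible matrix `M⁻¹` acting on `ℝⁿ`. -/
noncomputable def invAct {n : ℕ} (M : Matrix.GeneralLinearGroup (Fin n) ℝ) (v : Euc n) : Euc n :=
  Matrix.toEuclideanCLM (𝕜 := ℝ) (n := Fin n) ((M⁻¹ : Matrix.GeneralLinearGroup (Fin n) ℝ).val) v

/-- The lower `m`-density `liminf_{r ↓ 0} μ(B(a,r)) / r^m`, with closed balls `B(a,r)`. -/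
noncomputable def lowerDensity {n : ℕ} (m : ℕ) (μ : Measure (Euc n)) (a : Euc n) : ℝ≥0∞ :=
  liminf (fun r : ℝ => μ (Metric.closedBall a r) / ENNReal.ofReal (r ^ m)) (𝓝[>] (0 : ℝ))

/-- The kernel `v / |v|^(m+1)`. -/
noncomputable def rieszKernel {n : ℕ} (m : ℕ) (v : Euc n) : Euc n :=
  (‖v‖ ^ (m + 1))⁻¹ • v

/-- The truncated integral
`∫_{|Λ(x)⁻¹(y-x)| ≥ ε} Λ(x)⁻¹(y-x) / |Λ(x)⁻¹(y-x)|^(m+1) dμ(y)`. -/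
noncomputable def truncatedIntegral {n : ℕ} (m : ℕ)
    (Λ : Euc n → Matrix.GeneralLinearGroup (Fin n) ℝ) (μ : Measure (Euc n))
    (x : Euc n) (ε : ℝ) : Euc n :=
  ∫ y in {y : Euc n | ε ≤ ‖invAct (Λ x) (y - x)‖}, rieszKernel m (invAct (Λ x) (y - x)) ∂μ

/-- The principal value `T^m_Λ μ(x)` exists (as an element of `ℝⁿ`). -/
def PrincipalValueExists {n : ℕ} (m : ℕ)
    (Λ : Euc n → Matrix.GeneralLinearGroup (Fin n) ℝ) (μ : Measure (Euc n)) (x : Euc n) : Prop :=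
  ∃ v : Euc n, Tendsto (truncatedIntegral m Λ μ x) (𝓝[>] (0 : ℝ)) (𝓝 v)

/-- The rescaling `T^Λ_{a,r}(y) = Λ(a)⁻¹ ((y - a) / r)`. -/
noncomputable def rescale {n : ℕ} (Λ : Euc n → Matrix.GeneralLinearGroup (Fin n) ℝ)
    (a : Euc n) (r : ℝ) (y : Euc n) : Euc n :=
  invAct (Λ a) (r⁻¹ • (y - a))

/-- Weak-* convergence of measures on `ℝⁿ`: convergence against every continuous function with
compact support. -/
def WeakStarTendsto {n : ℕ} (μs : ℕ → Measure (Euc n)) (ν : Measure (Euc n)) : Prop :=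
  ∀ f : Euc n → ℝ, Continuous f → HasCompactSupport f →
    Tendsto (fun i => ∫ y, f y ∂(μs i)) atTop (𝓝 (∫ y, f y ∂ν))

/-- The `Λ`-tangents to `μ` at `a`: the non-zero Radon measures `ν` that are weak-* limits of
`c_i T^Λ_{a,r_i}[μ]` with `c_i > 0` and `r_i ↓ 0`. On `ℝⁿ` the Radon measures are the locally
finite Borel measures. -/
def lambdaTangents {n : ℕ} (Λ : Euc n → Matrix.GeneralLinearGroup (Fin n) ℝ)
    (μ : Measure (Euc n)) (a : Euc n) : Set (Measure (Euc n)) :=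
  {ν | IsLocallyFiniteMeasure ν ∧ ν ≠ 0 ∧
    ∃ c r : ℕ → ℝ, (∀ i, 0 < c i) ∧ (∀ i, 0 < r i) ∧ Tendsto r atTop (𝓝 0) ∧
      WeakStarTendsto
        (fun i => ENNReal.ofReal (c i) • Measure.map (rescale Λ a (r i)) μ) ν}

/-- `x` is a point of symmetry of `ν`: `∫_{B(x,r)} ⟨z - x, y⟩ dν(z) = 0` for all `y` and `r > 0`. -/
def IsPointOfSymmetry {n : ℕ} (ν : Measure (Euc n)) (x : Euc n) : Prop :=
  ∀ y : Euc n, ∀ r : ℝ, 0 < r → ∫ z in Metric.closedBall x r, inner ℝ (z - x) y ∂ν = 0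

/-- Symmetric measures: non-zero locally finite measures such that every point of the support is a
point of symmetry. -/
structure IsSymmetricMeasure {n : ℕ} (ν : Measure (Euc n)) : Prop where
  locallyFinite : IsLocallyFiniteMeasure ν
  ne_zero : ν ≠ 0
  pointOfSymmetry : ∀ x ∈ ν.support, IsPointOfSymmetry ν x

/-- The cone `𝒮ₙ` of symmetric measures on `ℝⁿ` whose support contains `0`. -/
def symmetricMeasures (n : ℕ) : Set (Measure (Euc n)) :=
  {ν | IsSymmetricMeasure ν ∧ (0 : Euc n) ∈ ν.support}

/-!
Let `p = (1 - |A (z - b)|²)₊` be the bump around `b` at a small scale, rescaled to `1`. Existence of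
the principal values makes radial integrals around `b`, such as `∫ p² (z - b)` and `∫ p³ (z - b)`,
small compared with the scale to the power `m`, hence by the positive lower density small compared
with `∫ p⁴`. For an arbitrary `Λ` this can be made uniform only on a nested sequence of sets of
centres `b`, each of full outer density at the points of the next. If blow-ups of `μ` converge to
`ν`, every point of `spt ν` is a limit of centres, and so inherits the symmetry.

That `0 ∈ spt ν` requires `μ` to be doubling at the blow-up point. If `b` nearly maximizes `∫ p⁴`
and the mass is not concentrated around `b`, then by a second order expansion its first absolute
moments are small in the directions of the nearby centres; when these span a subspace near which all
centres lie, the mass is concentrated around `b` after all. This yields doubling at the scales where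
the centres are near a subspace of the least dimension for which they can be arbitrarily flat.
Such flatness passes on to smaller scales: otherwise the centres span a new direction, in which the
inertia map of `μ` would be both small, because they are centres, and bounded below, by doubling.
-/

section Subspaces

variable {E : Type*} [NormedAddCommGroup E] [InnerProductSpace ℝ E]

theorem seminorm_le_of_mem_sup_span {N : Seminorm ℝ E} {X : Submodule ℝ E} {y : E} {M B τ : ℝ}
    (hM : 0 ≤ M) (hτ : 0 < τ) (hX : ∀ u ∈ X, N u ≤ M * ‖u‖) (hyX : y ∈ Xᗮ)
    (hτy : τ ≤ ‖y‖) (hy : N y ≤ B) {u : E} (hu : u ∈ X ⊔ Submodule.span ℝ {y}) :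
    N u ≤ (M + B / τ) * ‖u‖ := by
  obtain ⟨v, hv, w, hw, rfl⟩ := Submodule.mem_sup.1 hu
  obtain ⟨t, rfl⟩ := Submodule.mem_span_singleton.1 hw
  have hpyth := norm_add_sq_eq_norm_sq_add_norm_sq_of_inner_eq_zero v (t • y)
    (Submodule.inner_right_of_mem_orthogonal hv (Submodule.smul_mem _ t hyX))
  have hv_le : ‖v‖ ≤ ‖v + t • y‖ := by
    nlinarith [norm_nonneg v, norm_nonneg (v + t • y), norm_nonneg (t • y)]
  have hty_le : |t| * ‖y‖ ≤ ‖v + t • y‖ := by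
    rw [← Real.norm_eq_abs, ← norm_smul]
    nlinarith [norm_nonneg v, norm_nonneg (v + t • y), norm_nonneg (t • y)]
  have ht : |t| ≤ ‖v + t • y‖ / τ := by
    rw [le_div_iff₀ hτ]
    exact (mul_le_mul_of_nonneg_left hτy (abs_nonneg t)).trans hty_le
  calc N (v + t • y) ≤ N v + N (t • y) := map_add_le_add N _ _
    _ = N v + |t| * N y := by rw [map_smul_eq_mul, Real.norm_eq_abs]
    _ ≤ M * ‖v + t • y‖ + ‖v + t • y‖ / τ * B :=
        add_le_add ((hX v hv).trans (by gcongr))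
          (mul_le_mul ht hy (apply_nonneg N y) (by positivity))
    _ = (M + B / τ) * ‖v + t • y‖ := by ring

variable [FiniteDimensional ℝ E]

/-- The distance to the subspace `W`, as a seminorm. -/
noncomputable def distSeminorm (W : Submodule ℝ E) : Seminorm ℝ E :=
  (normSeminorm ℝ E).comp (Wᗮ.starProjection : E →L[ℝ] E).toLinearMap

theorem distSeminorm_apply (W : Submodule ℝ E) (z : E) :
    distSeminorm W z = ‖Wᗮ.starProjection z‖ := rfl

@[fun_prop]
theorem continuous_distSeminorm (W : Submodule ℝ E) : Continuous (distSeminorm W) :=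
  continuous_norm.comp Wᗮ.starProjection.continuous

theorem starProjection_orthogonal_eq_sub (W : Submodule ℝ E) (z : E) :
    Wᗮ.starProjection z = z - W.starProjection z := by
  rw [Submodule.starProjection_orthogonal', sub_apply, one_apply_eq_self]

theorem distSeminorm_eq_norm_sub (W : Submodule ℝ E) (z : E) :
    distSeminorm W z = ‖z - W.starProjection z‖ := by
  rw [distSeminorm_apply, starProjection_orthogonal_eq_sub]

theorem distSeminorm_le_norm (W : Submodule ℝ E) (z : E) : distSeminorm W z ≤ ‖z‖ :=
  Submodule.norm_starProjection_apply_le _ z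

theorem distSeminorm_eq_zero_iff {W : Submodule ℝ E} {z : E} : distSeminorm W z = 0 ↔ z ∈ W := by
  rw [distSeminorm_eq_norm_sub, norm_eq_zero, sub_eq_zero, eq_comm,
    Submodule.starProjection_eq_self_iff]

theorem norm_le_norm_starProjection_add_distSeminorm (W : Submodule ℝ E) (z : E) :
    ‖z‖ ≤ ‖W.starProjection z‖ + distSeminorm W z := by
  rw [distSeminorm_eq_norm_sub]
  simpa using norm_add_le (W.starProjection z) (z - W.starProjection z)

theorem abs_inner_le_distSeminorm {W : Submodule ℝ E} {e : E} (he : e ∈ Wᗮ) (z : E) :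
    |inner ℝ z e| ≤ distSeminorm W z * ‖e‖ := by
  rw [distSeminorm_apply, ← Submodule.starProjection_eq_self_iff.2 he,
    ← Submodule.inner_starProjection_left_eq_right, Submodule.starProjection_eq_self_iff.2 he]
  exact abs_real_inner_le_norm _ _

/-- Every point of `S` is at distance at most `τ` from the subspace `L`. -/
def NearSubspace (L : Submodule ℝ E) (τ : ℝ) (S : Set E) : Prop :=
  ∀ x ∈ S, distSeminorm L x ≤ τ

theorem NearSubspace.mono {L : Submodule ℝ E} {τ τ' : ℝ} {S S' : Set E}
    (h : NearSubspace L τ S) (hτ : τ ≤ τ') (hS : S' ⊆ S) : NearSubspace L τ' S' :=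
  fun x hx => (h x (hS hx)).trans hτ

theorem norm_starProjection_le_sum_abs_inner (W : Submodule ℝ E) {ι : Type*} [Fintype ι]
    (o : OrthonormalBasis ι ℝ W) (z : E) :
    ‖W.starProjection z‖ ≤ ∑ i, |inner ℝ z (o i : E)| := by
  have hz : W.starProjection z = ∑ i, inner ℝ (o i : E) z • (o i : E) := by
    simp [Submodule.starProjection_apply, o.orthogonalProjectionOnto_apply_eq_sum z]
  rw [hz]
  refine (norm_sum_le _ _).trans (Finset.sum_le_sum fun i _ => ?_)
  have hi : ‖(o i : E)‖ = 1 := o.orthonormal.1 i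
  rw [norm_smul, hi, mul_one, Real.norm_eq_abs, real_inner_comm]

theorem exists_unit_mem_orthogonal {X W : Submodule ℝ E}
    (h : Module.finrank ℝ W < Module.finrank ℝ X) : ∃ e ∈ X, e ∈ Wᗮ ∧ ‖e‖ = 1 := by
  have hmeet : X ⊓ Wᗮ ≠ ⊥ := by
    intro hbot
    have hsup := Submodule.finrank_sup_add_finrank_inf_eq X Wᗮ
    have horth := Submodule.finrank_add_finrank_orthogonal W
    have hle := Submodule.finrank_le (X ⊔ Wᗮ)
    rw [hbot, finrank_bot] at hsup
    omega
  obtain ⟨v, hv, hv0⟩ := Submodule.exists_mem_ne_zero_of_ne_bot hmeet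
  exact ⟨‖v‖⁻¹ • v, X.smul_mem _ hv.1, Wᗮ.smul_mem _ hv.2, norm_smul_inv_norm hv0⟩

theorem exists_subspace_seminorm_le {τ : ℝ} (hτ : 0 < τ) (k : ℕ) :
    ∃ K : ℝ, 0 < K ∧ ∀ S : Set E, S ⊆ Metric.closedBall 0 1 →
      (∀ L : Submodule ℝ E, Module.finrank ℝ L < k → ¬ NearSubspace L τ S) →
      ∃ X : Submodule ℝ E, Module.finrank ℝ X = k ∧
        ∀ (N : Seminorm ℝ E) (B : ℝ), 0 ≤ B → (∀ x ∈ S, N x ≤ B) →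
          ∀ u ∈ X, N u ≤ K * B * ‖u‖ := by
  induction k with
  | zero =>
    refine ⟨1, one_pos, fun S _ _ => ⟨⊥, finrank_bot ℝ E, fun N B _ _ u hu => ?_⟩⟩
    rw [(Submodule.mem_bot ℝ).1 hu, map_zero, norm_zero, mul_zero]
  | succ k ih =>
    obtain ⟨K, hK, hspan⟩ := ih
    refine ⟨K + (1 + K) / τ, by positivity, fun S hS hflat => ?_⟩
    obtain ⟨X, hX, hXN⟩ := hspan S hS fun L hL => hflat L (by omega)
    obtain ⟨x, hxS, hxτ⟩ : ∃ x ∈ S, τ < distSeminorm X x := by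
      simpa only [NearSubspace, not_forall, exists_prop, not_le] using hflat X (by omega)
    set y := x - X.starProjection x
    have hyX : y ∈ Xᗮ := Submodule.sub_starProjection_mem_orthogonal x
    have hτy : τ < ‖y‖ := by rwa [distSeminorm_eq_norm_sub] at hxτ
    have hy : y ∉ X := fun hy => by
      have := X.inner_right_of_mem_orthogonal hy hyX
      rw [inner_self_eq_zero.1 this, norm_zero] at hτy
      linarith
    refine ⟨X ⊔ Submodule.span ℝ {y}, by rw [Submodule.finrank_sup_span_singleton hy, hX],
      fun N B hB hNS u hu => ?_⟩
    have hNy : N y ≤ (1 + K) * B :=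
      calc N y ≤ N x + N (X.starProjection x) := map_sub_le_add N _ _
        _ ≤ B + K * B * 1 := by
          refine add_le_add (hNS x hxS)
            ((hXN N B hB hNS _ (Submodule.starProjection_apply_mem X x)).trans ?_)
          gcongr
          exact (Submodule.norm_starProjection_apply_le X x).trans (by simpa using hS hxS)
        _ = (1 + K) * B := by ring
    have := seminorm_le_of_mem_sup_span (by positivity) hτ (hXN N B hB hNS) hyX
      hτy.le hNy hu
    exact this.trans_eq (by ring)

/-- Applied to `distSeminorm W`, the spanning theorem shows that the spanned subspace is `W`. -/
theorem exists_seminorm_le_of_nearSubspace {τ : ℝ} (hτ : 0 < τ) (k : ℕ) :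
    ∃ K : ℝ, 0 < K ∧ ∀ (κ : ℝ) (S : Set E) (W : Submodule ℝ E), 0 < κ →
      S ⊆ Metric.closedBall 0 κ → Module.finrank ℝ W ≤ k → NearSubspace W (κ * (τ / 2)) S →
      (∀ L : Submodule ℝ E, Module.finrank ℝ L < k → ¬ NearSubspace L (τ * κ) S) →
      ∀ (N : Seminorm ℝ E) (B : ℝ), 0 ≤ B → (∀ x ∈ S, N (W.starProjection x) ≤ B) →
        ∀ u ∈ W, N u ≤ K * (κ⁻¹ * B) * ‖u‖ := by
  obtain ⟨K, hK, hspan⟩ := exists_subspace_seminorm_le (E := E) (half_pos hτ) k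
  refine ⟨K, hK, fun κ S W hκ hS hW hnear hfar N B hB hNB => ?_⟩
  have hball : (fun x => κ⁻¹ • W.starProjection x) '' S ⊆ Metric.closedBall 0 1 := by
    rintro _ ⟨x, hx, rfl⟩
    rw [mem_closedBall_zero_iff, norm_smul, norm_inv, Real.norm_of_nonneg hκ.le,
      inv_mul_le_iff₀ hκ, mul_one]
    exact (Submodule.norm_starProjection_apply_le W x).trans (mem_closedBall_zero_iff.1 (hS hx))
  have hfar_proj : ∀ L : Submodule ℝ E, Module.finrank ℝ L < k →
      ¬ NearSubspace L (τ / 2) ((fun x => κ⁻¹ • W.starProjection x) '' S) := by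
    refine fun L hL hL_near => hfar L hL fun x hx => ?_
    have hproj := hL_near _ ⟨x, hx, rfl⟩
    rw [map_smul_eq_mul, norm_inv, Real.norm_of_nonneg hκ.le, inv_mul_le_iff₀ hκ] at hproj
    calc distSeminorm L x
        = distSeminorm L (W.starProjection x + (x - W.starProjection x)) := by
          rw [add_sub_cancel]
      _ ≤ distSeminorm L (W.starProjection x) + distSeminorm L (x - W.starProjection x) :=
          map_add_le_add _ _ _
      _ ≤ κ * (τ / 2) + κ * (τ / 2) := add_le_add hproj
          ((distSeminorm_le_norm _ _).trans (by simpa [distSeminorm_eq_norm_sub] using hnear x hx))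
      _ = τ * κ := by ring
  obtain ⟨X, hX, hXN⟩ := hspan _ hball hfar_proj
  have hXW : X = W := by
    refine Submodule.eq_of_le_of_finrank_le (fun u hu => ?_) (by omega)
    have hzero := hXN (distSeminorm W) 0 le_rfl (by
      rintro _ ⟨x, -, rfl⟩
      exact (distSeminorm_eq_zero_iff.2
        (W.smul_mem _ (Submodule.starProjection_apply_mem W x))).le) u hu
    rw [mul_zero, zero_mul] at hzero
    exact distSeminorm_eq_zero_iff.1 (hzero.antisymm (apply_nonneg _ _))
  subst hXW
  refine hXN N (κ⁻¹ * B) (by positivity) ?_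
  rintro _ ⟨x, hx, rfl⟩
  rw [map_smul_eq_mul, norm_inv, Real.norm_of_nonneg hκ.le]
  exact mul_le_mul_of_nonneg_left (hNB x hx) (by positivity)

end Subspaces

section LayerCake

variable {α : Type*} [MeasurableSpace α]

theorem setIntegral_le_mul_integral_of_superlevel {μ : Measure α} {f : α → ℝ} {V : Set α} {ε : ℝ}
    (hf : Integrable f μ) (hf_nonneg : ∀ z, 0 ≤ f z) (hε : 0 ≤ ε)
    (h : ∀ t, 0 < t → μ.real (V ∩ {z | t ≤ f z}) ≤ ε * μ.real {z | t ≤ f z}) :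
    ∫ z in V, f z ∂μ ≤ ε * ∫ z, f z ∂μ := by
  have hlintegral : ∫⁻ z in V, ENNReal.ofReal (f z) ∂μ ≤
      ENNReal.ofReal ε * ∫⁻ z, ENNReal.ofReal (f z) ∂μ := by
    rw [lintegral_eq_lintegral_meas_le _ (Eventually.of_forall hf_nonneg) hf.aemeasurable.restrict,
      lintegral_eq_lintegral_meas_le _ (Eventually.of_forall hf_nonneg) hf.aemeasurable,
      ← lintegral_const_mul' _ _ ENNReal.ofReal_ne_top]
    refine setLIntegral_mono' measurableSet_Ioi fun t (ht : 0 < t) => ?_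
    have hfin : μ {z | t ≤ f z} ≠ ⊤ := (hf.measure_ge_lt_top ht).ne
    have hmeas : NullMeasurableSet {z | t ≤ f z} (μ.restrict V) :=
      nullMeasurableSet_le aemeasurable_const hf.aemeasurable.restrict
    rw [Measure.restrict_apply₀ hmeas, Set.inter_comm,
      ← ofReal_measureReal (measure_ne_top_of_subset Set.inter_subset_right hfin),
      ← ofReal_measureReal hfin, ← ENNReal.ofReal_mul hε]
    exact ENNReal.ofReal_le_ofReal (h t ht)
  rw [integral_eq_lintegral_of_nonneg_ae (Eventually.of_forall hf_nonneg) hf.aestronglyMeasurable,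
    integral_eq_lintegral_of_nonneg_ae (Eventually.of_forall hf_nonneg)
      hf.aestronglyMeasurable.restrict,
    ← ENNReal.toReal_ofReal hε, ← ENNReal.toReal_mul]
  exact ENNReal.toReal_mono (ENNReal.mul_ne_top ENNReal.ofReal_ne_top hf.lintegral_lt_top.ne)
    hlintegral

end LayerCake

section Bump

variable {E : Type*} [NormedAddCommGroup E] [NormedSpace ℝ E]

/-- The bump `max 0 (1 - |A (z - b)|²)` supported in the unit ellipsoid of `A` around `b`. -/
noncomputable def ellBump (A : E →L[ℝ] E) (b z : E) : ℝ := max 0 (1 - ‖A (z - b)‖ ^ 2)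

/-- The closed ellipsoid of size `s` and shape `A` around `b`. -/
def ellipsoid (A : E →L[ℝ] E) (b : E) (s : ℝ) : Set E := {z | ‖A (z - b)‖ ≤ s}

theorem isClosed_ellipsoid (A : E →L[ℝ] E) (b : E) (s : ℝ) : IsClosed (ellipsoid A b s) :=
  isClosed_le (by fun_prop) continuous_const

theorem continuous_ellBump (A : E →L[ℝ] E) (b : E) : Continuous (ellBump A b) := by
  unfold ellBump; fun_prop

theorem ellBump_nonneg (A : E →L[ℝ] E) (b z : E) : 0 ≤ ellBump A b z := le_max_left _ _

theorem ellBump_le_one (A : E →L[ℝ] E) (b z : E) : ellBump A b z ≤ 1 :=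
  max_le zero_le_one (sub_le_self _ (sq_nonneg _))

theorem norm_apply_lt_one_of_ellBump_ne_zero {A : E →L[ℝ] E} {b z : E} (h : ellBump A b z ≠ 0) :
    ‖A (z - b)‖ < 1 := by
  contrapose! h
  exact max_eq_left (sub_nonpos.2 (one_le_pow₀ h))

theorem ellBump_eq_of_ne_zero {A : E →L[ℝ] E} {b z : E} (h : ellBump A b z ≠ 0) :
    ellBump A b z = 1 - ‖A (z - b)‖ ^ 2 :=
  max_eq_right (sub_nonneg.2 (pow_le_one₀ (norm_nonneg _)
    (norm_apply_lt_one_of_ellBump_ne_zero h).le))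

theorem setOf_le_ellBump_pow {A : E →L[ℝ] E} {b : E} {N : ℕ} (hN : N ≠ 0) {t : ℝ} (ht : 0 < t)
    (ht1 : t ≤ 1) :
    {z | t ≤ ellBump A b z ^ N} = ellipsoid A b √(1 - t ^ (N : ℝ)⁻¹) := by
  have hroot_pos : 0 < t ^ (N : ℝ)⁻¹ := Real.rpow_pos_of_pos ht _
  have hroot_le : t ^ (N : ℝ)⁻¹ ≤ 1 := Real.rpow_le_one ht.le ht1 (by positivity)
  ext z
  nth_rw 1 [Set.mem_ofPred_eq, ← Real.rpow_inv_natCast_pow ht.le hN]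
  rw [pow_le_pow_iff_left₀ hroot_pos.le (ellBump_nonneg A b z) hN, ellBump, le_max_iff, ellipsoid,
    Set.mem_ofPred_eq, Real.le_sqrt (norm_nonneg _) (sub_nonneg.2 hroot_le),
    or_iff_right hroot_pos.not_ge, le_sub_comm]

theorem norm_le_two_mul_norm_apply {A : E →L[ℝ] E} (hA : ‖A - 1‖ ≤ 1 / 2) (v : E) :
    ‖v‖ ≤ 2 * ‖A v‖ := by
  have hdiff : ‖(A - 1) v‖ ≤ 1 / 2 * ‖v‖ := (A - 1).le_of_opNorm_le hA v
  have htri : ‖v‖ ≤ ‖A v‖ + ‖(A - 1) v‖ := by simpa using norm_sub_le (A v) ((A - 1) v)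
  linarith

theorem abs_norm_apply_sub_norm_le {A : E →L[ℝ] E} {ε : ℝ} (hA : ‖A - 1‖ ≤ ε) (v : E) :
    |‖A v‖ - ‖v‖| ≤ ε * ‖v‖ :=
  (abs_norm_sub_norm_le _ _).trans ((A - 1).le_of_opNorm_le hA v)

theorem abs_norm_apply_sq_sub_le {A : E →L[ℝ] E} {ε : ℝ} (hA : ‖A - 1‖ ≤ ε) (hε : ε ≤ 1)
    (v : E) : |‖A v‖ ^ 2 - ‖v‖ ^ 2| ≤ 3 * ε * ‖v‖ ^ 2 := by
  have hε_nonneg : 0 ≤ ε := (norm_nonneg _).trans hA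
  have hdiff := abs_norm_apply_sub_norm_le hA v
  have hsum : ‖A v‖ + ‖v‖ ≤ 3 * ‖v‖ := by nlinarith [(abs_le.1 hdiff).2, norm_nonneg v]
  calc |‖A v‖ ^ 2 - ‖v‖ ^ 2| = |‖A v‖ - ‖v‖| * (‖A v‖ + ‖v‖) := by
        rw [sq_sub_sq, mul_comm, abs_mul, abs_of_nonneg (by positivity : 0 ≤ ‖A v‖ + ‖v‖)]
    _ ≤ (ε * ‖v‖) * (3 * ‖v‖) := by gcongr
    _ = 3 * ε * ‖v‖ ^ 2 := by ring

theorem norm_sub_lt_two_of_ellBump_ne_zero {A : E →L[ℝ] E} (hA : ‖A - 1‖ ≤ 1 / 2) {b z : E}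
    (h : ellBump A b z ≠ 0) : ‖z - b‖ < 2 := by
  linarith [norm_le_two_mul_norm_apply hA (z - b), norm_apply_lt_one_of_ellBump_ne_zero h]

variable [FiniteDimensional ℝ E]

theorem hasCompactSupport_ellBump {A : E →L[ℝ] E} (hA : ‖A - 1‖ ≤ 1 / 2) (b : E) :
    HasCompactSupport (ellBump A b) := by
  have := FiniteDimensional.proper_real E
  refine HasCompactSupport.intro (isCompact_closedBall b 2) fun z hz => ?_
  contrapose! hz
  exact mem_closedBall_iff_norm.2 (norm_sub_lt_two_of_ellBump_ne_zero hA hz).le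

variable [MeasurableSpace E] [BorelSpace E]

theorem integrable_ellBump_pow_smul {G : Type*} [NormedAddCommGroup G] [NormedSpace ℝ G]
    {A : E →L[ℝ] E} (hA : ‖A - 1‖ ≤ 1 / 2) (b : E) (μ : Measure E) [IsFiniteMeasureOnCompacts μ]
    {N : ℕ} (hN : N ≠ 0) {g : E → G} (hg : Continuous g) :
    Integrable (fun z => ellBump A b z ^ N • g z) μ := by
  have hcont := continuous_ellBump A b
  have hsupp : HasCompactSupport (fun z => ellBump A b z ^ N) :=
    (hasCompactSupport_ellBump hA b).comp_left (g := fun t => t ^ N) (zero_pow hN)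
  exact Continuous.integrable_of_hasCompactSupport (by fun_prop) hsupp.smul_right

theorem integrable_ellBump_pow_mul {A : E →L[ℝ] E} (hA : ‖A - 1‖ ≤ 1 / 2) (b : E) (μ : Measure E)
    [IsFiniteMeasureOnCompacts μ] {N : ℕ} (hN : N ≠ 0) {g : E → ℝ} (hg : Continuous g) :
    Integrable (fun z => ellBump A b z ^ N * g z) μ :=
  integrable_ellBump_pow_smul hA b μ hN hg

theorem integrable_ellBump_pow {A : E →L[ℝ] E} (hA : ‖A - 1‖ ≤ 1 / 2) (b : E) (μ : Measure E)
    [IsFiniteMeasureOnCompacts μ] {N : ℕ} (hN : N ≠ 0) :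
    Integrable (fun z => ellBump A b z ^ N) μ := by
  simpa only [mul_one] using integrable_ellBump_pow_mul hA b μ hN (g := fun _ => 1) continuous_const

theorem measureReal_closedBall_le_integral_ellBump_pow {A : E →L[ℝ] E} (hA : ‖A - 1‖ ≤ 1 / 2)
    (b : E) (μ : Measure E) [IsFiniteMeasureOnCompacts μ] {N : ℕ} (hN : N ≠ 0) :
    (7 / 16) ^ N * μ.real (Metric.closedBall b (1 / 2)) ≤ ∫ z, ellBump A b z ^ N ∂μ := by
  have hint_ball : Integrable
      ((Metric.closedBall b (1 / 2)).indicator fun _ => (7 / 16 : ℝ) ^ N) μ :=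
    (integrable_indicator_iff measurableSet_closedBall).2
      (integrableOn_const (isCompact_closedBall b _).measure_lt_top.ne)
  calc (7 / 16) ^ N * μ.real (Metric.closedBall b (1 / 2))
      = ∫ z, (Metric.closedBall b (1 / 2)).indicator (fun _ => (7 / 16 : ℝ) ^ N) z ∂μ := by
        rw [integral_indicator measurableSet_closedBall, setIntegral_const, smul_eq_mul, mul_comm]
    _ ≤ ∫ z, ellBump A b z ^ N ∂μ := integral_mono hint_ball (integrable_ellBump_pow hA b μ hN)
        (Set.indicator_le' (fun z hz => ?_) fun z _ => pow_nonneg (ellBump_nonneg _ _ _) _)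
  have hbump : 7 / 16 ≤ ellBump A b z := by
    have hnorm := (abs_le.1 (abs_norm_apply_sub_norm_le hA (z - b))).2
    have hz : ‖z - b‖ ≤ 1 / 2 := mem_closedBall_iff_norm.1 hz
    refine le_max_of_le_right ?_
    nlinarith [norm_nonneg (A (z - b))]
  gcongr

theorem setIntegral_ellBump_pow_le {A : E →L[ℝ] E} (hA : ‖A - 1‖ ≤ 1 / 2) (b : E) (μ : Measure E)
    [IsFiniteMeasureOnCompacts μ] {ε : ℝ} (hε : 0 ≤ ε) {N : ℕ} (hN : N ≠ 0) {V : Set E}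
    (h : ∀ s, 0 ≤ s → s ≤ 1 → μ.real (V ∩ ellipsoid A b s) ≤ ε * μ.real (ellipsoid A b s)) :
    ∫ z in V, ellBump A b z ^ N ∂μ ≤ ε * ∫ z, ellBump A b z ^ N ∂μ := by
  refine setIntegral_le_mul_integral_of_superlevel (integrable_ellBump_pow hA b μ hN)
    (fun z => pow_nonneg (ellBump_nonneg A b z) N) hε fun t ht => ?_
  rcases le_or_gt t 1 with ht1 | ht1
  · rw [setOf_le_ellBump_pow hN ht ht1]
    refine h _ (Real.sqrt_nonneg _) (Real.sqrt_le_one.2 ?_)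
    linarith [Real.rpow_nonneg ht.le (N : ℝ)⁻¹]
  · have hempty : {z | t ≤ ellBump A b z ^ N} = ∅ := Set.eq_empty_of_forall_notMem fun z hz =>
      (pow_le_one₀ (ellBump_nonneg A b z) (ellBump_le_one A b z)).not_gt (ht1.trans_le hz)
    simp [hempty]

/-- At unit scale, `F` is a set of approximate centres of symmetry of `μ` with respect to the
ellipsoids of shape `A b`, `b ∈ F`, and `F` has almost full density at the points of `F'`. No
measurability of `F` is assumed, so the density condition bounds the measurable sets that miss
`F`. -/
structure AlmostSymmetric (ε : ℝ) (μ : Measure E) (F F' : Set E) (A : E → E →L[ℝ] E) : Prop where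
  subset : F' ⊆ F
  zero_mem : 0 ∈ F'
  shape_zero : A 0 = 1
  shape_near : ∀ b ∈ F, ‖b‖ ≤ 1 → ‖A b - 1‖ ≤ ε
  center : ∀ b ∈ F, ‖b‖ ≤ 1 → ∀ N, N = 2 ∨ N = 3 →
    ‖∫ z, ellBump (A b) b z ^ N • (z - b) ∂μ‖ ≤ ε * ∫ z, ellBump (A b) b z ^ 4 ∂μ
  pos : ∀ b ∈ F, ‖b‖ ≤ 1 → 0 < ∫ z, ellBump (A b) b z ^ 4 ∂μ
  dense : ∀ b ∈ F', ‖b‖ ≤ 1 → ∀ s, 0 ≤ s → s ≤ 1 → ∀ V, MeasurableSet V → Disjoint V F →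
    μ.real (V ∩ ellipsoid (A b) b s) ≤ ε * μ.real (ellipsoid (A b) b s)

end Bump

section BumpGain

variable {E : Type*} [NormedAddCommGroup E] [InnerProductSpace ℝ E]

theorem max_zero_pow_four_ge (a b : ℝ) :
    max 0 a ^ 4 + 4 * max 0 a ^ 3 * (b - a) + 6 * max 0 a ^ 2 * max 0 (b - a) ^ 2 ≤
      max 0 b ^ 4 := by
  rcases le_total a 0 with ha | ha
  · simp only [max_eq_left ha, ne_eq, OfNat.ofNat_ne_zero, not_false_eq_true, zero_pow, mul_zero,
      zero_mul, add_zero]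
    positivity
  rw [max_eq_right ha]
  rcases le_total (b - a) 0 with hba | hba
  · rw [max_eq_left hba]
    rcases le_total b 0 with hb | hb
    · rw [max_eq_left hb]
      nlinarith [pow_nonneg ha 3]
    · rw [max_eq_right hb]
      nlinarith [mul_nonneg (sq_nonneg (b - a)) (by positivity : 0 ≤ b ^ 2 + 2 * a * b + 3 * a ^ 2)]
  · rw [max_eq_right hba, max_eq_right (by linarith)]
    nlinarith [mul_nonneg ha (pow_nonneg hba 3), pow_nonneg hba 4]

/-- The lower bound for `‖A (z - b)‖² - ‖B (z - x)‖²` at points with `‖z - b‖ ≤ 2`, when `A` and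
`B` are `ε`-close to the identity; it is the exact difference when `ε = 0`. -/
noncomputable def bumpGain (ε : ℝ) (b x z : E) : ℝ :=
  2 * inner ℝ (z - b) (x - b) - (‖x - b‖ ^ 2 + 40 * ε)

theorem bumpGain_le {ε : ℝ} {A B : E →L[ℝ] E} (hA : ‖A - 1‖ ≤ ε) (hB : ‖B - 1‖ ≤ ε)
    (hε : ε ≤ 1) {b x z : E} (hbx : ‖x - b‖ ≤ 1) (hbz : ‖z - b‖ ≤ 2) :
    bumpGain ε b x z ≤ ‖A (z - b)‖ ^ 2 - ‖B (z - x)‖ ^ 2 := by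
  have hε_nonneg : 0 ≤ ε := (norm_nonneg _).trans hA
  have hsub : z - x = (z - b) - (x - b) := (sub_sub_sub_cancel_right z x b).symm
  have hzx : ‖z - x‖ ≤ 3 := by rw [hsub]; linarith [norm_sub_le (z - b) (x - b)]
  have hexpand : ‖z - x‖ ^ 2 = ‖z - b‖ ^ 2 - 2 * inner ℝ (z - b) (x - b) + ‖x - b‖ ^ 2 := by
    rw [← norm_sub_sq_real, ← hsub]
  have herrA : 3 * ε * ‖z - b‖ ^ 2 ≤ 3 * ε * 2 ^ 2 := by gcongr
  have herrB : 3 * ε * ‖z - x‖ ^ 2 ≤ 3 * ε * 3 ^ 2 := by gcongr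
  rw [bumpGain]
  linarith [(abs_le.1 (abs_norm_apply_sq_sub_le hA hε (z - b))).1,
    (abs_le.1 (abs_norm_apply_sq_sub_le hB hε (z - x))).2]

theorem ellBump_pow_four_ge {ε : ℝ} {A B : E →L[ℝ] E} (hA : ‖A - 1‖ ≤ ε) (hB : ‖B - 1‖ ≤ ε)
    (hε : ε ≤ 1 / 2) {b x : E} (hbx : ‖x - b‖ ≤ 1) (z : E) :
    ellBump A b z ^ 4 + 4 * (ellBump A b z ^ 3 * bumpGain ε b x z) +
      6 * (ellBump A b z ^ 2 * max 0 (bumpGain ε b x z) ^ 2) ≤ ellBump B x z ^ 4 := by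
  by_cases hz : ellBump A b z = 0
  · simpa [hz] using pow_nonneg (ellBump_nonneg B x z) 4
  have hgain := bumpGain_le hA hB (by linarith) hbx
    (norm_sub_lt_two_of_ellBump_ne_zero (hA.trans hε) hz).le
  have hconvex := max_zero_pow_four_ge (1 - ‖A (z - b)‖ ^ 2) (1 - ‖B (z - x)‖ ^ 2)
  rw [sub_sub_sub_cancel_left] at hconvex
  have hbump := ellBump_nonneg A b z
  have hfirst := mul_le_mul_of_nonneg_left hgain (pow_nonneg hbump 3)
  have hsecond : ellBump A b z ^ 2 * max 0 (bumpGain ε b x z) ^ 2 ≤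
      ellBump A b z ^ 2 * max 0 (‖A (z - b)‖ ^ 2 - ‖B (z - x)‖ ^ 2) ^ 2 := by gcongr
  simp only [ellBump] at hfirst hsecond ⊢
  linarith

theorem continuous_bumpGain (ε : ℝ) (b x : E) : Continuous (bumpGain ε b x) := by
  unfold bumpGain; fun_prop

theorem abs_le_add_sq_max_zero {a c δ : ℝ} (hδ : 0 < δ) (hc : 0 ≤ c) :
    |a| ≤ δ + c + (4 * δ)⁻¹ * max 0 (2 * a - c) ^ 2 - a := by
  have hle : 2 * a - c ≤ max 0 (2 * a - c) := le_max_right _ _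
  have hnonneg : 0 ≤ max 0 (2 * a - c) := le_max_left _ _
  generalize max 0 (2 * a - c) = Y at hle hnonneg
  have hamgm : Y ≤ δ + (4 * δ)⁻¹ * Y ^ 2 := by
    have hsq : δ + (4 * δ)⁻¹ * Y ^ 2 - Y = (4 * δ)⁻¹ * (2 * δ - Y) ^ 2 := by field_simp; ring
    have : 0 ≤ (4 * δ)⁻¹ * (2 * δ - Y) ^ 2 := by positivity
    linarith
  rcases abs_cases a with ⟨habs, _⟩ | ⟨habs, _⟩ <;> linarith

end BumpGain

section Moments

variable {E : Type*} [NormedAddCommGroup E] [InnerProductSpace ℝ E] [MeasurableSpace E]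
  {μ : Measure E}

theorem integral_ellBump_pow_nonneg (A : E →L[ℝ] E) (b : E) (N : ℕ) :
    0 ≤ ∫ z, ellBump A b z ^ N ∂μ :=
  integral_nonneg fun z => pow_nonneg (ellBump_nonneg A b z) N

theorem AlmostSymmetric.mono {ε ε' : ℝ} {F F' : Set E} {A : E → E →L[ℝ] E}
    (h : AlmostSymmetric ε μ F F' A) (hε : ε ≤ ε') : AlmostSymmetric ε' μ F F' A where
  subset := h.subset
  zero_mem := h.zero_mem
  shape_zero := h.shape_zero
  shape_near b hb hb1 := (h.shape_near b hb hb1).trans hε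
  center b hb hb1 N hN := (h.center b hb hb1 N hN).trans
    (mul_le_mul_of_nonneg_right hε (h.pos b hb hb1).le)
  pos := h.pos
  dense b hb hb1 s hs0 hs1 V hV hVF := (h.dense b hb hb1 s hs0 hs1 V hV hVF).trans
    (mul_le_mul_of_nonneg_right hε measureReal_nonneg)

variable [FiniteDimensional ℝ E] [BorelSpace E] [IsFiniteMeasureOnCompacts μ]

theorem integral_ellBump_pow_antitone {A : E →L[ℝ] E} (hA : ‖A - 1‖ ≤ 1 / 2) (b : E) {M N : ℕ}
    (hM : M ≠ 0) (hMN : M ≤ N) :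
    ∫ z, ellBump A b z ^ N ∂μ ≤ ∫ z, ellBump A b z ^ M ∂μ :=
  integral_mono (integrable_ellBump_pow hA b μ (by omega)) (integrable_ellBump_pow hA b μ hM)
    fun z => pow_le_pow_of_le_one (ellBump_nonneg A b z) (ellBump_le_one A b z) hMN

theorem integral_ellBump_cube_mul_bumpGain {A : E →L[ℝ] E} (hA : ‖A - 1‖ ≤ 1 / 2) (ε : ℝ)
    (b x : E) :
    ∫ z, ellBump A b z ^ 3 * bumpGain ε b x z ∂μ =
      2 * (∫ z, ellBump A b z ^ 3 * inner ℝ (z - b) (x - b) ∂μ) -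
        (‖x - b‖ ^ 2 + 40 * ε) * ∫ z, ellBump A b z ^ 3 ∂μ := by
  have hint_inner := integrable_ellBump_pow_mul hA b μ (by norm_num : 3 ≠ 0)
    (g := fun z => inner ℝ (z - b) (x - b)) (by fun_prop)
  rw [← integral_const_mul, ← integral_const_mul, ← integral_sub (hint_inner.const_mul 2)
    ((integrable_ellBump_pow hA b μ (by norm_num)).const_mul _)]
  congr 1; ext z; rw [bumpGain]; ring

theorem integral_ellBump_sq_mul_abs_inner_le {A : E →L[ℝ] E} (hA : ‖A - 1‖ ≤ 1 / 2) {ε δ : ℝ}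
    (hε : 0 ≤ ε) (hδ : 0 < δ) (b x : E) :
    ∫ z, ellBump A b z ^ 2 * |inner ℝ (z - b) (x - b)| ∂μ ≤
      (δ + (‖x - b‖ ^ 2 + 40 * ε)) * (∫ z, ellBump A b z ^ 2 ∂μ) +
        (4 * δ)⁻¹ * (∫ z, ellBump A b z ^ 2 * max 0 (bumpGain ε b x z) ^ 2 ∂μ) -
        ∫ z, ellBump A b z ^ 2 * inner ℝ (z - b) (x - b) ∂μ := by
  set c := ‖x - b‖ ^ 2 + 40 * ε with hc
  have hgain := continuous_bumpGain ε b x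
  have hint_inner := integrable_ellBump_pow_mul hA b μ (by norm_num : 2 ≠ 0)
    (g := fun z => inner ℝ (z - b) (x - b)) (by fun_prop)
  have hint_sq := (integrable_ellBump_pow hA b μ (by norm_num : 2 ≠ 0)).const_mul (δ + c)
  have hint_gain := (integrable_ellBump_pow_mul hA b μ (by norm_num : 2 ≠ 0)
    (g := fun z => max 0 (bumpGain ε b x z) ^ 2) (by fun_prop)).const_mul (4 * δ)⁻¹
  have hint_add : Integrable (fun z => (δ + c) * ellBump A b z ^ 2 +
    (4 * δ)⁻¹ * (ellBump A b z ^ 2 * max 0 (bumpGain ε b x z) ^ 2)) μ := hint_sq.add hint_gain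
  rw [← integral_const_mul, ← integral_const_mul, ← integral_add hint_sq hint_gain,
    ← integral_sub hint_add hint_inner]
  refine integral_mono (integrable_ellBump_pow_mul hA b μ (by norm_num : 2 ≠ 0)
    (g := fun z => |inner ℝ (z - b) (x - b)|) (by fun_prop)) (hint_add.sub hint_inner)
    fun z => ?_
  have hpoint := mul_le_mul_of_nonneg_left
    (abs_le_add_sq_max_zero (a := inner ℝ (z - b) (x - b)) (c := c) hδ (by positivity))
    (sq_nonneg (ellBump A b z))
  simp only [bumpGain, ← hc]
  linarith

theorem integral_ellBump_pow_four_ge {ε : ℝ} {A B : E →L[ℝ] E} (hA : ‖A - 1‖ ≤ ε)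
    (hB : ‖B - 1‖ ≤ ε) (hε : ε ≤ 1 / 2) {b x : E} (hbx : ‖x - b‖ ≤ 1) :
    (∫ z, ellBump A b z ^ 4 ∂μ) + 4 * (∫ z, ellBump A b z ^ 3 * bumpGain ε b x z ∂μ) +
      6 * (∫ z, ellBump A b z ^ 2 * max 0 (bumpGain ε b x z) ^ 2 ∂μ) ≤
      ∫ z, ellBump B x z ^ 4 ∂μ := by
  have hA' := hA.trans hε
  have hgain := continuous_bumpGain ε b x
  have hint4 := integrable_ellBump_pow hA' b μ (by norm_num : 4 ≠ 0)
  have hint3 := (integrable_ellBump_pow_mul hA' b μ (by norm_num : 3 ≠ 0) hgain).const_mul 4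
  have hint2 := (integrable_ellBump_pow_mul hA' b μ (by norm_num : 2 ≠ 0)
    (g := fun z => max 0 (bumpGain ε b x z) ^ 2) (by fun_prop)).const_mul 6
  have hint43 : Integrable (fun z => ellBump A b z ^ 4 +
    4 * (ellBump A b z ^ 3 * bumpGain ε b x z)) μ := hint4.add hint3
  rw [← integral_const_mul, ← integral_const_mul, ← integral_add hint4 hint3,
    ← integral_add hint43 hint2]
  exact integral_mono (hint43.add hint2) (integrable_ellBump_pow (hB.trans hε) x μ (by norm_num))
    fun z => ellBump_pow_four_ge hA hB hε hbx z

namespace AlmostSymmetric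

variable {ε : ℝ} {F F' : Set E} {A : E → E →L[ℝ] E}

theorem abs_integral_mul_inner_le (h : AlmostSymmetric ε μ F F' A) (hε : ε ≤ 1 / 2) {b : E}
    (hb : b ∈ F) (hb1 : ‖b‖ ≤ 1) {N : ℕ} (hN : N = 2 ∨ N = 3) (v : E) :
    |∫ z, ellBump (A b) b z ^ N * inner ℝ (z - b) v ∂μ| ≤
      ε * (∫ z, ellBump (A b) b z ^ 4 ∂μ) * ‖v‖ := by
  have hint := integrable_ellBump_pow_smul ((h.shape_near b hb hb1).trans hε) b μ
    (by omega : N ≠ 0) (g := fun z => z - b) (by fun_prop)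
  calc |∫ z, ellBump (A b) b z ^ N * inner ℝ (z - b) v ∂μ|
      = |inner ℝ v (∫ z, ellBump (A b) b z ^ N • (z - b) ∂μ)| := by
        rw [← integral_inner hint]
        simp only [inner_smul_right, real_inner_comm]
    _ ≤ ‖v‖ * ‖∫ z, ellBump (A b) b z ^ N • (z - b) ∂μ‖ := abs_real_inner_le_norm _ _
    _ ≤ ‖v‖ * (ε * ∫ z, ellBump (A b) b z ^ 4 ∂μ) := by gcongr; exact h.center b hb hb1 N hN
    _ = ε * (∫ z, ellBump (A b) b z ^ 4 ∂μ) * ‖v‖ := mul_comm _ _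

/-- The second-order expansion of the mass around a near-maximizer `b`: the first-order terms are
small because `b` is almost a centre of symmetry. -/
theorem integral_sq_mul_sq_bumpGain_le (h : AlmostSymmetric ε μ F F' A) (hε : ε ≤ 1 / 2) {b x : E}
    (hb : b ∈ F) (hb1 : ‖b‖ ≤ 1 / 2) (hx : x ∈ F) (hx1 : ‖x‖ ≤ 1 / 2)
    (hmax : ∫ z, ellBump (A x) x z ^ 4 ∂μ ≤ (1 + 2 * ε) * ∫ z, ellBump (A b) b z ^ 4 ∂μ) :
    ∫ z, ellBump (A b) b z ^ 2 * max 0 (bumpGain ε b x z) ^ 2 ∂μ ≤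
      (‖x - b‖ ^ 2 + 30 * ε) * ∫ z, ellBump (A b) b z ^ 3 ∂μ := by
  have hA := h.shape_near b hb (by linarith)
  have hε_nonneg : 0 ≤ ε := (norm_nonneg _).trans hA
  have hbx : ‖x - b‖ ≤ 1 := by linarith [norm_sub_le x b]
  have hexpand := integral_ellBump_pow_four_ge (μ := μ) hA (h.shape_near x hx (by linarith)) hε hbx
  rw [integral_ellBump_cube_mul_bumpGain (hA.trans hε)] at hexpand
  have hcenter := (abs_le.1 (h.abs_integral_mul_inner_le hε hb (by linarith) (Or.inr rfl)
    (x - b))).1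
  have hmass := integral_ellBump_pow_antitone (μ := μ) (hA.trans hε) b (M := 3) (N := 4)
    (by norm_num) (by norm_num)
  have hmass4 := integral_ellBump_pow_nonneg (μ := μ) (A b) b 4
  have hfirst : ε * (∫ z, ellBump (A b) b z ^ 4 ∂μ) * ‖x - b‖ ≤
      ε * (∫ z, ellBump (A b) b z ^ 3 ∂μ) * 1 :=
    mul_le_mul (mul_le_mul_of_nonneg_left hmass hε_nonneg) hbx (norm_nonneg _)
      (mul_nonneg hε_nonneg (hmass4.trans hmass))
  have hquad : 0 ≤ ‖x - b‖ ^ 2 * ∫ z, ellBump (A b) b z ^ 3 ∂μ :=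
    mul_nonneg (sq_nonneg _) (hmass4.trans hmass)
  linarith [mul_le_mul_of_nonneg_left hmass hε_nonneg,
    mul_nonneg hε_nonneg (hmass4.trans hmass)]

theorem integral_sq_mul_abs_inner_le {κ σ : ℝ} (h : AlmostSymmetric ε μ F F' A) (hκ0 : 0 < κ)
    (hσ : 0 < σ) (hκ : κ ≤ 1 / 2) (hεκ : ε ≤ κ ^ 2) {b x : E}
    (hb : b ∈ F) (hb1 : ‖b‖ ≤ κ) (hx : x ∈ F) (hx1 : ‖x‖ ≤ κ)
    (hmax : ∫ z, ellBump (A x) x z ^ 4 ∂μ ≤ (1 + 2 * ε) * ∫ z, ellBump (A b) b z ^ 4 ∂μ)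
    (hsmall : ∫ z, ellBump (A b) b z ^ 3 ∂μ ≤ σ ^ 2 * ∫ z, ellBump (A b) b z ^ 2 ∂μ) :
    ∫ z, ellBump (A b) b z ^ 2 * |inner ℝ (z - b) (x - b)| ∂μ ≤
      (6 * κ * σ + 4 * κ ^ 2 + 42 * ε) * ∫ z, ellBump (A b) b z ^ 2 ∂μ := by
  have hε : ε ≤ 1 / 2 := by nlinarith
  have hA := h.shape_near b hb (by linarith)
  have hε_nonneg : 0 ≤ ε := (norm_nonneg _).trans hA
  replace hA := hA.trans hε
  have hsecond := h.integral_sq_mul_sq_bumpGain_le hε hb (hb1.trans hκ) hx (hx1.trans hκ) hmax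
  have hcenter := (abs_le.1 (h.abs_integral_mul_inner_le hε hb (by linarith) (Or.inl rfl)
    (x - b))).1
  have hbx : ‖x - b‖ ≤ 2 * κ := by linarith [norm_sub_le x b]
  have hbx_sq : ‖x - b‖ ^ 2 ≤ 4 * κ ^ 2 := by nlinarith [norm_nonneg (x - b)]
  have hamgm := integral_ellBump_sq_mul_abs_inner_le (μ := μ) hA hε_nonneg
    (by positivity : 0 < 3 * κ * σ) b x
  have hmass := integral_ellBump_pow_antitone (μ := μ) hA b (M := 2) (N := 4)
    (by norm_num) (by norm_num)
  have hmass2 := (integral_ellBump_pow_nonneg (μ := μ) (A b) b 4).trans hmass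
  set I := ∫ z, ellBump (A b) b z ^ 2 ∂μ
  have hgain_le : (4 * (3 * κ * σ))⁻¹ *
      (∫ z, ellBump (A b) b z ^ 2 * max 0 (bumpGain ε b x z) ^ 2 ∂μ) ≤ 3 * κ * σ * I := by
    rw [inv_mul_le_iff₀ (by positivity)]
    calc _ ≤ (‖x - b‖ ^ 2 + 30 * ε) * ∫ z, ellBump (A b) b z ^ 3 ∂μ := hsecond
      _ ≤ 36 * κ ^ 2 * (σ ^ 2 * I) := mul_le_mul (by linarith) hsmall
          (integral_ellBump_pow_nonneg _ _ _) (by positivity)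
      _ = _ := by ring
  have hcenter_le : ε * (∫ z, ellBump (A b) b z ^ 4 ∂μ) * ‖x - b‖ ≤ ε * I * 1 :=
    mul_le_mul (mul_le_mul_of_nonneg_left hmass hε_nonneg) (by linarith) (norm_nonneg _)
      (mul_nonneg hε_nonneg hmass2)
  linarith [mul_le_mul_of_nonneg_right hbx_sq hmass2, mul_nonneg hε_nonneg hmass2]

end AlmostSymmetric

end Moments

section Concentration

variable {E : Type*} [NormedAddCommGroup E] [InnerProductSpace ℝ E] [FiniteDimensional ℝ E]

theorem ellBump_sq_sub_cube_le {A : E →L[ℝ] E} (hA : ‖A - 1‖ ≤ 1 / 2) (b : E) (W : Submodule ℝ E)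
    (z : E) :
    ellBump A b z ^ 2 - ellBump A b z ^ 3 ≤
      2 * (ellBump A b z ^ 2 * ‖W.starProjection (z - b)‖ +
        ellBump A b z ^ 2 * distSeminorm W (z - b)) := by
  by_cases hz : ellBump A b z = 0
  · simp [hz]
  have hnorm := (abs_le.1 (abs_norm_apply_sub_norm_le hA (z - b))).2
  have hdefect : 1 - ellBump A b z ≤ 2 * (‖W.starProjection (z - b)‖ + distSeminorm W (z - b)) := by
    rw [ellBump_eq_of_ne_zero hz]
    nlinarith [norm_apply_lt_one_of_ellBump_ne_zero hz, norm_nonneg (A (z - b)),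
      norm_nonneg (z - b), norm_le_norm_starProjection_add_distSeminorm W (z - b)]
  linarith [mul_le_mul_of_nonneg_left hdefect (sq_nonneg (ellBump A b z))]

variable [MeasurableSpace E] [BorelSpace E]

/-- The first absolute moment, in the direction `v`, of the measure with density `ellBump A b ^ 2`
with respect to `μ`. -/
noncomputable def momentSeminorm {A : E →L[ℝ] E} (hA : ‖A - 1‖ ≤ 1 / 2) (b : E) (μ : Measure E)
    [IsFiniteMeasureOnCompacts μ] : Seminorm ℝ E :=
  Seminorm.of (fun v => ∫ z, ellBump A b z ^ 2 * |inner ℝ (z - b) v| ∂μ)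
    (fun v w => by
      have hint : ∀ u, Integrable (fun z => ellBump A b z ^ 2 * |inner ℝ (z - b) u|) μ := fun u =>
        integrable_ellBump_pow_mul hA b μ two_ne_zero (by fun_prop)
      rw [← integral_add (hint v) (hint w)]
      refine integral_mono (hint (v + w)) ((hint v).add (hint w)) fun z => ?_
      simp only [inner_add_right, ← mul_add]
      gcongr
      exact abs_add_le _ _)
    (fun a v => by
      simp only [inner_smul_right, abs_mul, mul_left_comm _ |a|]
      rw [integral_const_mul, Real.norm_eq_abs])

variable {μ : Measure E} [IsFiniteMeasureOnCompacts μ]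

theorem momentSeminorm_apply {A : E →L[ℝ] E} (hA : ‖A - 1‖ ≤ 1 / 2) (b v : E) :
    momentSeminorm hA b μ v = ∫ z, ellBump A b z ^ 2 * |inner ℝ (z - b) v| ∂μ := rfl

theorem momentSeminorm_le {A : E →L[ℝ] E} (hA : ‖A - 1‖ ≤ 1 / 2) (b v : E) :
    momentSeminorm hA b μ v ≤ 2 * ‖v‖ * ∫ z, ellBump A b z ^ 2 ∂μ := by
  rw [momentSeminorm_apply, ← integral_const_mul]
  refine integral_mono (integrable_ellBump_pow_mul hA b μ two_ne_zero (by fun_prop))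
    ((integrable_ellBump_pow hA b μ two_ne_zero).const_mul _) fun z => ?_
  by_cases hz : ellBump A b z = 0
  · simp [hz]
  simp only [mul_comm (2 * ‖v‖)]
  gcongr
  exact (abs_real_inner_le_norm _ _).trans (by
    gcongr; exact (norm_sub_lt_two_of_ellBump_ne_zero hA hz).le)

theorem integral_ellBump_sq_mul_norm_starProjection_le {A : E →L[ℝ] E} (hA : ‖A - 1‖ ≤ 1 / 2)
    (b : E) (W : Submodule ℝ E) {B : ℝ} (hB : ∀ u ∈ W, momentSeminorm hA b μ u ≤ B * ‖u‖) :
    ∫ z, ellBump A b z ^ 2 * ‖W.starProjection (z - b)‖ ∂μ ≤ Module.finrank ℝ W * B := by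
  let o := stdOrthonormalBasis ℝ W
  have hint : ∀ i, Integrable (fun z => ellBump A b z ^ 2 * |inner ℝ (z - b) (o i : E)|) μ :=
    fun i => integrable_ellBump_pow_mul hA b μ two_ne_zero (by fun_prop)
  calc ∫ z, ellBump A b z ^ 2 * ‖W.starProjection (z - b)‖ ∂μ
      ≤ ∫ z, ∑ i, ellBump A b z ^ 2 * |inner ℝ (z - b) (o i : E)| ∂μ := by
        refine integral_mono (integrable_ellBump_pow_mul hA b μ two_ne_zero (by fun_prop))
          (integrable_finsetSum _ fun i _ => hint i) fun z => ?_
        simp only [← Finset.mul_sum]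
        gcongr
        exact norm_starProjection_le_sum_abs_inner W o (z - b)
    _ = ∑ i, momentSeminorm hA b μ (o i : E) := integral_finsetSum _ fun i _ => hint i
    _ ≤ ∑ _i : Fin (Module.finrank ℝ W), B := Finset.sum_le_sum fun i _ => by
        have hunit : ‖(o i : E)‖ = 1 := o.orthonormal.1 i
        simpa only [hunit, mul_one] using hB (o i : E) (o i).2
    _ = Module.finrank ℝ W * B := by simp

namespace AlmostSymmetric

variable {ε θ : ℝ} {F F' : Set E} {A : E → E →L[ℝ] E} {b : E} {W : Submodule ℝ E}

theorem integral_sq_mul_distSeminorm_le (h : AlmostSymmetric ε μ F F' A) (hε : ε ≤ 1 / 4)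
    (hb : b ∈ F') (hb1 : ‖b‖ ≤ 1 / 2) (hθ : 0 ≤ θ)
    (hflat : NearSubspace W θ (F ∩ Metric.closedBall 0 2)) :
    ∫ z, ellBump (A b) b z ^ 2 * distSeminorm W (z - b) ∂μ ≤
      (2 * θ + 2 * ε) * ∫ z, ellBump (A b) b z ^ 2 ∂μ := by
  have hA := h.shape_near b (h.subset hb) (by linarith)
  have hA2 : ‖A b - 1‖ ≤ 1 / 2 := by linarith
  set V : Set E := Metric.closedBall 0 2 ∩ {z | θ < distSeminorm W z}
  have hV_meas : MeasurableSet V := measurableSet_closedBall.inter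
    (measurableSet_lt measurable_const (continuous_distSeminorm W).measurable)
  have hV_disj : Disjoint V F := Set.disjoint_left.2 fun z hz hzF =>
    hz.2.not_ge (hflat z ⟨hzF, hz.1⟩)
  have hV_mass := setIntegral_ellBump_pow_le hA2 b μ ((norm_nonneg _).trans hA) two_ne_zero
    fun s hs0 hs1 => h.dense b hb (by linarith) s hs0 hs1 V hV_meas hV_disj
  have hpoint : ∀ z, ellBump (A b) b z ^ 2 * distSeminorm W (z - b) ≤
      2 * θ * ellBump (A b) b z ^ 2 + 2 * V.indicator (fun z => ellBump (A b) b z ^ 2) z := by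
    intro z
    have hweight := sq_nonneg (ellBump (A b) b z)
    by_cases hz : ellBump (A b) b z = 0
    · simp [hz, Set.indicator]
    have hzb : ‖z - b‖ ≤ 3 / 2 := by
      nlinarith [(abs_le.1 (abs_norm_apply_sub_norm_le hA (z - b))).1, norm_nonneg (z - b),
        norm_apply_lt_one_of_ellBump_ne_zero hz]
    by_cases hzV : z ∈ V
    · rw [Set.indicator_of_mem hzV]
      nlinarith [distSeminorm_le_norm W (z - b), mul_nonneg hθ hweight]
    · have hz2 : ‖z‖ ≤ 2 := by linarith [norm_le_norm_add_norm_sub' z b]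
      have hzW : distSeminorm W z ≤ θ := not_lt.1 fun hlt =>
        hzV ⟨mem_closedBall_zero_iff.2 hz2, hlt⟩
      have hbW := hflat b ⟨h.subset hb, mem_closedBall_zero_iff.2 (by linarith)⟩
      rw [Set.indicator_of_notMem hzV, mul_zero, add_zero, mul_comm]
      exact mul_le_mul_of_nonneg_right ((map_sub_le_add _ _ _).trans (by linarith)) hweight
  have hint := integrable_ellBump_pow hA2 b μ two_ne_zero
  have hmono := integral_mono (integrable_ellBump_pow_mul hA2 b μ two_ne_zero (by fun_prop))
    ((hint.const_mul (2 * θ)).add ((hint.indicator hV_meas).const_mul 2)) hpoint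
  rw [integral_add' (hint.const_mul _) ((hint.indicator hV_meas).const_mul 2), integral_const_mul,
    integral_const_mul, integral_indicator hV_meas] at hmono
  linarith

/-- Where the bump `p` is positive, `p² - p³ = p² |A (z - b)|²`, so the left side is the second
moment around `b` of the mass with density `p²`. -/
theorem integral_sq_sub_cube_le {B : ℝ} (h : AlmostSymmetric ε μ F F' A) (hε : ε ≤ 1 / 4)
    (hb : b ∈ F') (hb1 : ‖b‖ ≤ 1 / 2) (hθ : 0 ≤ θ)
    (hflat : NearSubspace W θ (F ∩ Metric.closedBall 0 2)) (hA : ‖A b - 1‖ ≤ 1 / 2)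
    (hB : ∀ u ∈ W, momentSeminorm hA b μ u ≤ B * ‖u‖) :
    (∫ z, ellBump (A b) b z ^ 2 ∂μ) - ∫ z, ellBump (A b) b z ^ 3 ∂μ ≤
      2 * (Module.finrank ℝ W * B + (2 * θ + 2 * ε) * ∫ z, ellBump (A b) b z ^ 2 ∂μ) := by
  have hint2 := integrable_ellBump_pow hA b μ two_ne_zero
  have hint3 := integrable_ellBump_pow hA b μ (N := 3) (by norm_num)
  have hint_proj := integrable_ellBump_pow_mul hA b μ two_ne_zero
    (g := fun z => ‖W.starProjection (z - b)‖) (by fun_prop)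
  have hint_dist := integrable_ellBump_pow_mul hA b μ two_ne_zero
    (g := fun z => distSeminorm W (z - b)) (by fun_prop)
  have hmono := integral_mono (hint2.sub hint3) ((hint_proj.add hint_dist).const_mul 2)
    (ellBump_sq_sub_cube_le hA b W)
  rw [integral_sub' hint2 hint3, integral_const_mul, integral_add' hint_proj hint_dist] at hmono
  linarith [integral_ellBump_sq_mul_norm_starProjection_le hA b W hB,
    h.integral_sq_mul_distSeminorm_le hε hb hb1 hθ hflat]

theorem momentSeminorm_starProjection_le {κ σ : ℝ} (h : AlmostSymmetric ε μ F F' A) (hκ0 : 0 < κ)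
    (hσ : 0 < σ) (hκ : κ ≤ 1 / 2) (hεκ : ε ≤ κ ^ 2)
    (hflat : NearSubspace W θ (F ∩ Metric.closedBall 0 2)) (hA : ‖A b - 1‖ ≤ 1 / 2)
    (hb : b ∈ F' ∩ Metric.closedBall 0 κ)
    (hmax : ∀ x ∈ F' ∩ Metric.closedBall 0 κ, ∫ z, ellBump (A x) x z ^ 4 ∂μ ≤
      (1 + 2 * ε) * ∫ z, ellBump (A b) b z ^ 4 ∂μ)
    (hsmall : ∫ z, ellBump (A b) b z ^ 3 ∂μ ≤ σ ^ 2 * ∫ z, ellBump (A b) b z ^ 2 ∂μ)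
    {x : E} (hx : x ∈ F' ∩ Metric.closedBall 0 κ) :
    momentSeminorm hA b μ (W.starProjection x) ≤
      (2 * (6 * κ * σ + 4 * κ ^ 2 + 42 * ε) + 2 * θ) * ∫ z, ellBump (A b) b z ^ 2 ∂μ := by
  have hnorm : ∀ y ∈ F' ∩ Metric.closedBall 0 κ, ‖y‖ ≤ κ := fun y hy =>
    mem_closedBall_zero_iff.1 hy.2
  have hmoment_sub : ∀ y ∈ F' ∩ Metric.closedBall 0 κ, momentSeminorm hA b μ (y - b) ≤
      (6 * κ * σ + 4 * κ ^ 2 + 42 * ε) * ∫ z, ellBump (A b) b z ^ 2 ∂μ := fun y hy =>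
    h.integral_sq_mul_abs_inner_le hκ0 hσ hκ hεκ (h.subset hb.1) (hnorm b hb) (h.subset hy.1)
      (hnorm y hy) (hmax y hy) hsmall
  have hmoment_zero := hmoment_sub 0 ⟨h.zero_mem, by simp [hκ0.le]⟩
  have hdist : distSeminorm W x ≤ θ :=
    hflat x ⟨h.subset hx.1, mem_closedBall_zero_iff.2 (by linarith [hnorm x hx])⟩
  have hmoment_dist : momentSeminorm hA b μ (x - W.starProjection x) ≤
      2 * θ * ∫ z, ellBump (A b) b z ^ 2 ∂μ := by
    refine (momentSeminorm_le hA b _).trans (mul_le_mul_of_nonneg_right ?_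
      (integral_ellBump_pow_nonneg _ _ _))
    rw [← distSeminorm_eq_norm_sub]
    linarith
  have hdecomp : W.starProjection x = (x - b) - (0 - b) - (x - W.starProjection x) := by abel
  calc momentSeminorm hA b μ (W.starProjection x)
      ≤ momentSeminorm hA b μ (x - b) + momentSeminorm hA b μ (0 - b) +
          momentSeminorm hA b μ (x - W.starProjection x) := by
        conv_lhs => rw [hdecomp]
        exact (map_sub_le_add _ _ _).trans (add_le_add_left (map_sub_le_add _ _ _) _)
    _ ≤ _ := by linarith [hmoment_sub x hx]

theorem sq_mul_integral_sq_le_integral_cube {κ σ K : ℝ} (h : AlmostSymmetric ε μ F F' A)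
    (hκ0 : 0 < κ) (hσ : 0 < σ) (hσ1 : σ ≤ 1 / 100) (hκσ : κ ≤ σ / 10000) (hεκ : ε ≤ κ ^ 2 / 1000)
    (hθ0 : 0 ≤ θ) (hθσ : θ ≤ κ * σ / 1000) (hK0 : 0 ≤ K)
    (hK : Module.finrank ℝ W * K * σ ≤ 1 / 100)
    (hflat : NearSubspace W θ (F ∩ Metric.closedBall 0 2))
    (hspan : ∀ (N : Seminorm ℝ E) (B : ℝ), 0 ≤ B →
      (∀ x ∈ F' ∩ Metric.closedBall 0 κ, N (W.starProjection x) ≤ B) →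
        ∀ u ∈ W, N u ≤ K * (κ⁻¹ * B) * ‖u‖)
    (hb : b ∈ F' ∩ Metric.closedBall 0 κ)
    (hmax : ∀ x ∈ F' ∩ Metric.closedBall 0 κ, ∫ z, ellBump (A x) x z ^ 4 ∂μ ≤
      (1 + 2 * ε) * ∫ z, ellBump (A b) b z ^ 4 ∂μ) :
    σ ^ 2 * ∫ z, ellBump (A b) b z ^ 2 ∂μ ≤ ∫ z, ellBump (A b) b z ^ 3 ∂μ := by
  have hbκ := mem_closedBall_zero_iff.1 hb.2
  have hεκσ : ε ≤ κ * σ / 1000 := by nlinarith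
  have hε4 : ε ≤ 1 / 4 := by nlinarith
  have hA_ε := h.shape_near b (h.subset hb.1) (by linarith)
  have hA : ‖A b - 1‖ ≤ 1 / 2 := by linarith
  have hε0 : 0 ≤ ε := (norm_nonneg _).trans hA_ε
  have hmass : 0 < ∫ z, ellBump (A b) b z ^ 2 ∂μ :=
    (h.pos b (h.subset hb.1) (by linarith)).trans_le
      (integral_ellBump_pow_antitone hA b (by norm_num) (by norm_num))
  by_contra! hsmall
  have hmoment := hspan (momentSeminorm hA b μ) _ (by positivity) fun x hx =>
    h.momentSeminorm_starProjection_le hκ0 hσ (by linarith) (by nlinarith) hflat hA hb hmax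
      hsmall.le hx
  have hconc := h.integral_sq_sub_cube_le hε4 hb.1 (by linarith) hθ0 hflat hA hmoment
  set I := ∫ z, ellBump (A b) b z ^ 2 ∂μ
  set c := 2 * (6 * κ * σ + 4 * κ ^ 2 + 42 * ε) + 2 * θ with hc
  have hcκ : κ⁻¹ * c ≤ 15 * σ := by
    rw [inv_mul_le_iff₀ hκ0, hc]
    nlinarith [mul_le_mul_of_nonneg_left hκσ hκ0.le, mul_pos hκ0 hσ]
  have hfirst : Module.finrank ℝ W * (K * (κ⁻¹ * (c * I))) ≤ 15 / 100 * I :=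
    calc Module.finrank ℝ W * (K * (κ⁻¹ * (c * I)))
        = (Module.finrank ℝ W * K) * (κ⁻¹ * c) * I := by ring
      _ ≤ (Module.finrank ℝ W * K) * (15 * σ) * I := by gcongr
      _ = 15 * (Module.finrank ℝ W * K * σ) * I := by ring
      _ ≤ 15 * (1 / 100) * I := by gcongr
      _ = 15 / 100 * I := by ring
  have hσI : σ ^ 2 * I ≤ 1 / 100 * I := by gcongr; nlinarith
  have hθI : (2 * θ + 2 * ε) * I ≤ 1 / 100 * I := by gcongr; nlinarith
  linarith

end AlmostSymmetric

theorem exists_forall_le_mul_of_bddAbove {α : Type*} {f : α → ℝ} {S : Set α}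
    (hf : BddAbove (f '' S)) {a : α} (ha : a ∈ S) (hfa : 0 < f a) {c : ℝ} (hc : 1 < c) :
    ∃ b ∈ S, ∀ x ∈ S, f x ≤ c * f b := by
  have hsup : 0 < sSup (f '' S) := hfa.trans_le (le_csSup hf ⟨a, ha, rfl⟩)
  obtain ⟨_, ⟨b, hb, rfl⟩, hlt⟩ := exists_lt_of_lt_csSup (s := f '' S) ⟨_, a, ha, rfl⟩
    (div_lt_self hsup hc)
  rw [div_lt_iff₀' (by linarith)] at hlt
  exact ⟨b, hb, fun x hx => (le_csSup hf ⟨x, hx, rfl⟩).trans hlt.le⟩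

theorem AlmostSymmetric.exists_near_maximizer {μ : Measure E} [IsFiniteMeasure μ] {ε κ : ℝ}
    {F F' : Set E} {A : E → E →L[ℝ] E} (h : AlmostSymmetric ε μ F F' A) (hε0 : 0 < ε)
    (hε : ε ≤ 1 / 2) (hκ0 : 0 ≤ κ) (hκ : κ ≤ 1) :
    ∃ b ∈ F' ∩ Metric.closedBall 0 κ, ∀ x ∈ F' ∩ Metric.closedBall 0 κ,
      ∫ z, ellBump (A x) x z ^ 4 ∂μ ≤ (1 + 2 * ε) * ∫ z, ellBump (A b) b z ^ 4 ∂μ := by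
  refine exists_forall_le_mul_of_bddAbove (S := F' ∩ Metric.closedBall 0 κ) (a := 0)
    (f := fun x => ∫ z, ellBump (A x) x z ^ 4 ∂μ) ?_
    ⟨h.zero_mem, Metric.mem_closedBall_self hκ0⟩ (h.pos 0 (h.subset h.zero_mem) (by simp))
    (by linarith)
  refine ⟨μ.real Set.univ, ?_⟩
  rintro _ ⟨x, hx, rfl⟩
  have hA := h.shape_near x (h.subset hx.1) ((mem_closedBall_zero_iff.1 hx.2).trans hκ)
  simpa using integral_mono (integrable_ellBump_pow (hA.trans hε) x μ (N := 4) (by norm_num))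
    (integrable_const (1 : ℝ)) fun z => pow_le_one₀ (ellBump_nonneg (A x) x z)
      (ellBump_le_one (A x) x z)

/-- `b` is a near-maximizer of the mass around the points of `F'`. If the mass around `b` were not
concentrated, its moments in the directions spanned by `F'` would be small. -/
theorem exists_concentrated_center {τ : ℝ} (hτ : 0 < τ) (k : ℕ) :
    ∃ σ κ θ ε : ℝ, 0 < σ ∧ σ ≤ 1 / 2 ∧ 0 < κ ∧ κ ≤ σ ^ 2 / 100 ∧ 0 < θ ∧ 0 < ε ∧ ε ≤ κ ∧
      ∀ (μ : Measure E) [IsFiniteMeasure μ] (F F' : Set E) (A : E → E →L[ℝ] E),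
      AlmostSymmetric ε μ F F' A → ∀ W : Submodule ℝ E, Module.finrank ℝ W ≤ k →
        NearSubspace W θ (F ∩ Metric.closedBall 0 2) →
        (∀ L : Submodule ℝ E, Module.finrank ℝ L < k →
          ¬ NearSubspace L (τ * κ) (F' ∩ Metric.closedBall 0 κ)) →
        ∃ b ∈ F', ‖b‖ ≤ κ ∧
          σ ^ 2 * ∫ z, ellBump (A b) b z ^ 2 ∂μ ≤ ∫ z, ellBump (A b) b z ^ 3 ∂μ ∧
          ∫ z, ellBump (A 0) 0 z ^ 4 ∂μ ≤ 2 * ∫ z, ellBump (A b) b z ^ 4 ∂μ := by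
  obtain ⟨K, hK, hspan⟩ := exists_seminorm_le_of_nearSubspace (E := E) hτ k
  obtain ⟨σ, hσ, hKσ, hσ1⟩ : ∃ σ : ℝ, 0 < σ ∧ k * K * σ ≤ 1 / 100 ∧ σ ≤ 1 / 100 := by
    refine ⟨1 / (100 * (k + 1) * (K + 1)), by positivity, ?_, ?_⟩
    · rw [mul_one_div, div_le_div_iff₀ (by positivity) (by norm_num)]
      nlinarith [Nat.cast_nonneg (α := ℝ) k]
    · rw [div_le_div_iff₀ (by positivity) (by norm_num)]
      nlinarith [mul_nonneg (Nat.cast_nonneg (α := ℝ) k) hK.le, Nat.cast_nonneg (α := ℝ) k]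
  obtain ⟨κ, hκ, hκσ2, hκσ⟩ : ∃ κ : ℝ, 0 < κ ∧ κ ≤ σ ^ 2 / 100 ∧ κ ≤ σ / 10000 :=
    ⟨σ ^ 2 / 100, by positivity, le_rfl, by nlinarith⟩
  obtain ⟨θ, hθ, hθτ, hθσ⟩ : ∃ θ : ℝ, 0 < θ ∧ θ ≤ κ * (τ / 2) ∧ θ ≤ κ * σ / 1000 :=
    ⟨min (κ * (τ / 2)) (κ * σ / 1000), lt_min (by positivity) (by positivity), min_le_left _ _,
      min_le_right _ _⟩
  have hε : κ ^ 2 / 1000 ≤ κ := by nlinarith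
  refine ⟨σ, κ, θ, κ ^ 2 / 1000, hσ, by linarith, hκ, hκσ2, hθ, by positivity, hε,
    fun μ _ F F' A h W hW hflat hfar => ?_⟩
  obtain ⟨b, hb, hmax⟩ := h.exists_near_maximizer (by positivity) (by linarith) hκ.le
    (by linarith)
  have hbκ := mem_closedBall_zero_iff.1 hb.2
  have hKσ_W : Module.finrank ℝ W * K * σ ≤ 1 / 100 := le_trans (by gcongr) hKσ
  have hflat_κ : NearSubspace W (κ * (τ / 2)) (F' ∩ Metric.closedBall 0 κ) :=
    hflat.mono hθτ (Set.inter_subset_inter h.subset (Metric.closedBall_subset_closedBall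
      (by linarith)))
  refine ⟨b, hb.1, hbκ, h.sq_mul_integral_sq_le_integral_cube hκ hσ hσ1 hκσ le_rfl hθ.le hθσ hK.le
    hKσ_W hflat (hspan κ _ W hκ Set.inter_subset_right hW hflat_κ hfar) hb hmax, ?_⟩
  have hpos := h.pos b (h.subset hb.1) (by linarith)
  exact (hmax 0 ⟨h.zero_mem, Metric.mem_closedBall_self hκ.le⟩).trans
    (mul_le_mul_of_nonneg_right (by linarith) hpos.le)

end Concentration

section Growth

variable {E : Type*} [NormedAddCommGroup E] [InnerProductSpace ℝ E]

theorem ellBump_cube_le {σ κ ε : ℝ} (hσ : 0 < σ) (hσ1 : σ ≤ 1 / 2) (hκ : κ ≤ σ ^ 2 / 100)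
    (hε : ε ≤ κ) {A : E →L[ℝ] E} (hA : ‖A - 1‖ ≤ ε) {b : E} (hb : ‖b‖ ≤ κ) (z : E) :
    ellBump A b z ^ 3 ≤
      (Metric.closedBall 0 (1 - 2 * (σ ^ 2 / 10))).indicator (fun _ => (1 : ℝ)) z +
        σ ^ 2 / 2 * ellBump A b z ^ 2 := by
  have hbump0 := ellBump_nonneg A b z
  have hσ2 : 0 < σ ^ 2 := by positivity
  rcases le_or_gt (σ ^ 2 / 2) (ellBump A b z) with hlarge | hsmall
  · have hne : ellBump A b z ≠ 0 := by linarith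
    have hAz : ‖A (z - b)‖ ≤ 1 - σ ^ 2 / 4 := by
      refine abs_le_of_sq_le_sq' ?_ (by nlinarith) |>.2
      nlinarith [ellBump_eq_of_ne_zero hne, sq_nonneg (σ ^ 2)]
    have hnear := (abs_le.1 (abs_norm_apply_sub_norm_le hA (z - b))).1
    have hzb := norm_sub_lt_two_of_ellBump_ne_zero (hA.trans (by nlinarith)) hne
    have hz : z ∈ Metric.closedBall (0 : E) (1 - 2 * (σ ^ 2 / 10)) := by
      rw [mem_closedBall_zero_iff]
      nlinarith [norm_le_norm_add_norm_sub' z b, norm_nonneg (z - b)]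
    rw [Set.indicator_of_mem hz]
    exact le_add_of_le_of_nonneg (pow_le_one₀ hbump0 (ellBump_le_one A b z)) (by positivity)
  · refine le_add_of_nonneg_of_le (Set.indicator_nonneg (fun _ _ => zero_le_one) z) ?_
    rw [pow_succ']
    gcongr

variable [FiniteDimensional ℝ E] [MeasurableSpace E] [BorelSpace E]

theorem pow_four_mul_measureReal_closedBall_le (μ : Measure E) [IsFiniteMeasure μ] {s : ℝ}
    (hs : 0 ≤ s) :
    s ^ 4 * μ.real (Metric.closedBall 0 (1 - s)) ≤ ∫ z, ellBump 1 0 z ^ 4 ∂μ := by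
  have hpoint : ∀ z : E, (Metric.closedBall (0 : E) (1 - s)).indicator (fun _ => s ^ 4) z ≤
      ellBump 1 0 z ^ 4 := by
    refine Set.indicator_le' (fun z hz => ?_) fun z _ => pow_nonneg (ellBump_nonneg 1 0 z) 4
    rw [mem_closedBall_zero_iff] at hz
    have hbump : s ≤ ellBump 1 0 z := le_max_of_le_right (by
      simp only [sub_zero, one_apply_eq_self]
      nlinarith [norm_nonneg z])
    gcongr
  have hmono := integral_mono ((integrable_const (s ^ 4)).indicator measurableSet_closedBall)
    (integrable_ellBump_pow (by simp) 0 μ (N := 4) (by norm_num)) hpoint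
  rwa [integral_indicator measurableSet_closedBall, setIntegral_const, smul_eq_mul, mul_comm]
    at hmono

theorem exists_measure_ball_le_of_nearSubspace {τ : ℝ} (hτ : 0 < τ) (k : ℕ) :
    ∃ κ θ ε s C : ℝ, 0 < κ ∧ κ ≤ 1 ∧ 0 < θ ∧ 0 < ε ∧ 0 < s ∧ s ≤ 1 / 4 ∧ 0 < C ∧
      ∀ (μ : Measure E) [IsFiniteMeasure μ] (F F' : Set E) (A : E → E →L[ℝ] E),
      AlmostSymmetric ε μ F F' A → ∀ W : Submodule ℝ E, Module.finrank ℝ W ≤ k →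
        NearSubspace W θ (F ∩ Metric.closedBall 0 2) →
        (∀ L : Submodule ℝ E, Module.finrank ℝ L < k →
          ¬ NearSubspace L (τ * κ) (F' ∩ Metric.closedBall 0 κ)) →
        μ.real (Metric.closedBall 0 (1 - s)) ≤ C * μ.real (Metric.closedBall 0 (1 - 2 * s)) := by
  obtain ⟨σ, κ, θ, ε, hσ, hσ1, hκ, hκσ, hθ, hε, hεκ, hcenter⟩ :=
    exists_concentrated_center (E := E) hτ k
  have hκ1 : κ ≤ 1 / 400 := by nlinarith
  refine ⟨κ, θ, ε, σ ^ 2 / 10, 4 / (σ ^ 2 * (σ ^ 2 / 10) ^ 4), hκ, by linarith, hθ, hε,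
    by positivity, by nlinarith, by positivity, fun μ _ F F' A h W hW hflat hfar => ?_⟩
  obtain ⟨b, hb, hbκ, hconc, hmax⟩ := hcenter μ F F' A h W hW hflat hfar
  have hA := h.shape_near b (h.subset hb) (by linarith)
  have hA2 : ‖A b - 1‖ ≤ 1 / 2 := by linarith
  have hint2 := integrable_ellBump_pow hA2 b μ two_ne_zero
  have hint3 := integrable_ellBump_pow hA2 b μ (N := 3) (by norm_num)
  have hanti := integral_ellBump_pow_antitone (μ := μ) hA2 b (M := 2) (N := 4) (by norm_num)
    (by norm_num)
  have houter := pow_four_mul_measureReal_closedBall_le μ (s := σ ^ 2 / 10) (by positivity)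
  rw [← h.shape_zero] at houter
  have hint_ball : Integrable
      ((Metric.closedBall (0 : E) (1 - 2 * (σ ^ 2 / 10))).indicator fun _ => (1 : ℝ)) μ :=
    (integrable_const 1).indicator measurableSet_closedBall
  have hinner := integral_mono hint3 (hint_ball.add (hint2.const_mul _))
    (ellBump_cube_le hσ hσ1 hκσ hεκ hA hbκ)
  rw [integral_add' hint_ball (hint2.const_mul _), integral_const_mul,
    integral_indicator measurableSet_closedBall, setIntegral_const, smul_eq_mul, mul_one] at hinner
  rw [div_mul_eq_mul_div, le_div_iff₀ (by positivity)]
  nlinarith [mul_le_mul_of_nonneg_left (houter.trans (hmax.trans (mul_le_mul_of_nonneg_left hanti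
    zero_le_two))) (sq_nonneg σ)]

end Growth

section Taylor

theorem abs_max_zero_cube_sub_le (a b : ℝ) :
    |max 0 b ^ 3 - max 0 a ^ 3 - 3 * max 0 a ^ 2 * (b - a)| ≤
      3 * (|a| + |b|) * (b - a) ^ 2 := by
  rcases le_total a 0 with ha | ha <;> rcases le_total b 0 with hb | hb
  · simp only [max_eq_left ha, max_eq_left hb, ne_eq, OfNat.ofNat_ne_zero, not_false_eq_true,
      zero_pow, sub_self, mul_zero, zero_mul, abs_zero]
    positivity
  · simp only [max_eq_left ha, max_eq_right hb, ne_eq, OfNat.ofNat_ne_zero, not_false_eq_true,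
      zero_pow, sub_zero, mul_zero, zero_mul, abs_of_nonpos ha, abs_of_nonneg hb,
      abs_of_nonneg (pow_nonneg hb 3)]
    have hsq : b ^ 2 ≤ (b - a) ^ 2 := by nlinarith
    nlinarith [mul_le_mul_of_nonneg_left hsq hb, mul_nonneg (neg_nonneg.2 ha) (sq_nonneg (b - a)),
      mul_nonneg hb (sq_nonneg (b - a))]
  · have hsq : a ^ 2 ≤ (b - a) ^ 2 := by nlinarith
    have heq : (0 : ℝ) ^ 3 - a ^ 3 - 3 * a ^ 2 * (b - a) = a ^ 2 * (2 * a - 3 * b) := by ring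
    rw [max_eq_right ha, max_eq_left hb, abs_of_nonneg ha, abs_of_nonpos hb, heq,
      abs_of_nonneg (mul_nonneg (sq_nonneg a) (by linarith))]
    calc a ^ 2 * (2 * a - 3 * b) ≤ (b - a) ^ 2 * (3 * (a + -b)) :=
          mul_le_mul hsq (by linarith) (by linarith) (sq_nonneg _)
      _ = 3 * (a + -b) * (b - a) ^ 2 := mul_comm _ _
  · have heq : b ^ 3 - a ^ 3 - 3 * a ^ 2 * (b - a) = (b - a) ^ 2 * (b + 2 * a) := by ring
    rw [max_eq_right ha, max_eq_right hb, abs_of_nonneg ha, abs_of_nonneg hb, heq,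
      abs_of_nonneg (mul_nonneg (sq_nonneg _) (by linarith))]
    nlinarith [mul_nonneg ha (sq_nonneg (b - a)), mul_nonneg hb (sq_nonneg (b - a))]

variable {E : Type*} [NormedAddCommGroup E] [InnerProductSpace ℝ E]

theorem ellBump_eq_zero_of_two_lt_norm {A : E →L[ℝ] E} (hA : ‖A - 1‖ ≤ 1 / 4) {x : E}
    (hx : ‖x‖ ≤ 1 / 2) {z : E} (hz : 2 < ‖z‖) : ellBump A x z = 0 := by
  by_contra hne
  have hAz := norm_apply_lt_one_of_ellBump_ne_zero hne
  linarith [(abs_le.1 (abs_norm_apply_sub_norm_le hA (z - x))).1, norm_sub_norm_le z x]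

theorem abs_norm_sq_sub_norm_apply_sub_sq_le {ε : ℝ} {A : E →L[ℝ] E} (hA : ‖A - 1‖ ≤ ε)
    (hε : ε ≤ 1) {x z : E} (hzx : ‖z - x‖ ≤ 5 / 2) :
    |‖z‖ ^ 2 - ‖A (z - x)‖ ^ 2 - 2 * inner ℝ z x| ≤ ‖x‖ ^ 2 + 20 * ε := by
  have hε0 : 0 ≤ ε := (norm_nonneg _).trans hA
  have hexpand : ‖z‖ ^ 2 - ‖A (z - x)‖ ^ 2 - 2 * inner ℝ z x =
      -(‖x‖ ^ 2 + (‖A (z - x)‖ ^ 2 - ‖z - x‖ ^ 2)) := by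
    linarith [norm_sub_sq_real z x]
  have herror : 3 * ε * ‖z - x‖ ^ 2 ≤ 20 * ε :=
    calc 3 * ε * ‖z - x‖ ^ 2 ≤ 3 * ε * (5 / 2) ^ 2 := by gcongr
      _ ≤ 20 * ε := by linarith
  rw [hexpand, abs_neg]
  exact (abs_add_le _ _).trans (add_le_add (abs_of_nonneg (sq_nonneg _)).le
    ((abs_norm_apply_sq_sub_le hA hε _).trans herror))

theorem abs_ellBump_cube_sub_le {ε : ℝ} {A : E →L[ℝ] E} (hA : ‖A - 1‖ ≤ ε) (hε : ε ≤ 1 / 4)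
    {x z : E} (hx : ‖x‖ ≤ 1 / 2) (hz : ‖z‖ ≤ 2) :
    |ellBump A x z ^ 3 - ellBump 1 0 z ^ 3 -
        3 * ellBump 1 0 z ^ 2 * (‖z‖ ^ 2 - ‖A (z - x)‖ ^ 2)| ≤ 2100 * ‖x‖ ^ 2 + 8400 * ε := by
  have hε0 : 0 ≤ ε := (norm_nonneg _).trans hA
  have hzx : ‖z - x‖ ≤ 5 / 2 := (norm_sub_le z x).trans (by linarith)
  have hAzx : ‖A (z - x)‖ ≤ 13 / 4 := by
    nlinarith [(abs_le.1 (abs_norm_apply_sub_norm_le hA (z - x))).2, norm_nonneg (z - x)]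
  have hinner : |2 * inner ℝ z x| ≤ 4 * ‖x‖ := by
    rw [abs_mul, abs_two]
    linarith [(abs_real_inner_le_norm z x).trans (mul_le_mul_of_nonneg_right hz (norm_nonneg x))]
  have hgain : |‖z‖ ^ 2 - ‖A (z - x)‖ ^ 2| ≤ 5 * ‖x‖ + 20 * ε := by
    have htri := abs_sub_abs_le_abs_sub (‖z‖ ^ 2 - ‖A (z - x)‖ ^ 2) (2 * inner ℝ z x)
    nlinarith [abs_norm_sq_sub_norm_apply_sub_sq_le hA (by linarith) hzx, norm_nonneg x]
  have hgain_sq : (‖z‖ ^ 2 - ‖A (z - x)‖ ^ 2) ^ 2 ≤ 50 * ‖x‖ ^ 2 + 200 * ε := by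
    rw [← sq_abs]
    refine (pow_le_pow_left₀ (abs_nonneg _) hgain 2).trans ?_
    nlinarith [sq_nonneg (5 * ‖x‖ - 20 * ε)]
  have hz_abs : |1 - ‖z‖ ^ 2| ≤ 3 := by
    rw [abs_le]; constructor <;> nlinarith [norm_nonneg z]
  have hAzx_abs : |1 - ‖A (z - x)‖ ^ 2| ≤ 11 := by
    rw [abs_le]; constructor <;> nlinarith [norm_nonneg (A (z - x))]
  have hcube := abs_max_zero_cube_sub_le (1 - ‖z‖ ^ 2) (1 - ‖A (z - x)‖ ^ 2)
  rw [sub_sub_sub_cancel_left] at hcube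
  simp only [ellBump, sub_zero, one_apply_eq_self]
  calc _ ≤ 3 * (|1 - ‖z‖ ^ 2| + |1 - ‖A (z - x)‖ ^ 2|) * (‖z‖ ^ 2 - ‖A (z - x)‖ ^ 2) ^ 2 := hcube
    _ ≤ 3 * (3 + 11) * (50 * ‖x‖ ^ 2 + 200 * ε) := by gcongr
    _ = 2100 * ‖x‖ ^ 2 + 8400 * ε := by ring

theorem norm_taylor_ellBump_le {ε : ℝ} {A : E →L[ℝ] E} (hA : ‖A - 1‖ ≤ ε) (hε : ε ≤ 1 / 4)
    {x : E} (hx : ‖x‖ ≤ 1 / 2) (z : E) :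
    ‖ellBump A x z ^ 3 • (z - x) - ellBump 1 0 z ^ 3 • z + ellBump 1 0 z ^ 3 • x -
      (6 * ellBump 1 0 z ^ 2 * inner ℝ z x) • z‖ ≤
      (Metric.closedBall 0 2).indicator (fun _ => 50000 * (‖x‖ ^ 2 + ε)) z := by
  have hε0 : 0 ≤ ε := (norm_nonneg _).trans hA
  by_cases hz : z ∈ Metric.closedBall (0 : E) 2
  swap
  · have hz2 : 2 < ‖z‖ := not_le.1 fun h => hz (mem_closedBall_zero_iff.2 h)
    simp [Set.indicator_of_notMem hz, ellBump_eq_zero_of_two_lt_norm (hA.trans hε) hx hz2,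
      ellBump_eq_zero_of_two_lt_norm (A := 1) (x := 0) (by simp) (by simp) hz2]
  rw [Set.indicator_of_mem hz]
  rw [mem_closedBall_zero_iff] at hz
  have hzx : ‖z - x‖ ≤ 5 / 2 := (norm_sub_le z x).trans (by linarith)
  have hinner : |inner ℝ z x| ≤ 2 * ‖x‖ := (abs_real_inner_le_norm z x).trans (by gcongr)
  have hfirst := abs_norm_sq_sub_norm_apply_sub_sq_le hA (by linarith) hzx
  have hcube := abs_ellBump_cube_sub_le hA hε hx hz
  have hsq0 : 0 ≤ ellBump 1 0 z ^ 2 := sq_nonneg _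
  have hsq : ellBump 1 0 z ^ 2 ≤ 1 := pow_le_one₀ (ellBump_nonneg 1 0 z) (ellBump_le_one 1 0 z)
  generalize ellBump A x z = q at hcube ⊢
  generalize ellBump 1 0 z = p at hcube hsq0 hsq ⊢
  generalize ‖z‖ ^ 2 - ‖A (z - x)‖ ^ 2 = g at hfirst hcube
  have hsplit : q ^ 3 • (z - x) - p ^ 3 • z + p ^ 3 • x - (6 * p ^ 2 * inner ℝ z x) • z =
      (q ^ 3 - p ^ 3 - 3 * p ^ 2 * g) • (z - x) +
        (3 * p ^ 2 * (g - 2 * inner ℝ z x)) • (z - x) - (6 * p ^ 2 * inner ℝ z x) • x := by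
    module
  have hcube_term : ‖(q ^ 3 - p ^ 3 - 3 * p ^ 2 * g) • (z - x)‖ ≤
      (2100 * ‖x‖ ^ 2 + 8400 * ε) * (5 / 2) := by
    rw [norm_smul, Real.norm_eq_abs]; gcongr
  have hfirst_term : ‖(3 * p ^ 2 * (g - 2 * inner ℝ z x)) • (z - x)‖ ≤
      3 * 1 * (‖x‖ ^ 2 + 20 * ε) * (5 / 2) := by
    rw [norm_smul, Real.norm_eq_abs, abs_mul, abs_of_nonneg (by positivity : 0 ≤ 3 * p ^ 2)]
    gcongr
  have hinner_term : ‖(6 * p ^ 2 * inner ℝ z x) • x‖ ≤ 6 * 1 * (2 * ‖x‖) * ‖x‖ := by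
    rw [norm_smul, Real.norm_eq_abs, abs_mul, abs_of_nonneg (by positivity : 0 ≤ 6 * p ^ 2)]
    gcongr
  rw [hsplit]
  refine (norm_sub_le _ _).trans ((add_le_add_left (norm_add_le _ _) _).trans ?_)
  nlinarith [sq_nonneg ‖x‖]

end Taylor

section Rescaling

variable {E : Type*} [NormedAddCommGroup E] [InnerProductSpace ℝ E]

theorem smul_mem_closedBall_zero_iff {r : ℝ} (hr : 0 < r) {t : ℝ} {x : E} :
    r • x ∈ Metric.closedBall (0 : E) (t * r) ↔ x ∈ Metric.closedBall (0 : E) t := by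
  rw [mem_closedBall_zero_iff, mem_closedBall_zero_iff, norm_smul_of_nonneg hr.le, mul_comm,
    mul_le_mul_iff_left₀ hr]

theorem norm_apply_inv_smul_sub (A : E →L[ℝ] E) {r : ℝ} (hr : 0 < r) (b z : E) :
    ‖A (r⁻¹ • z - b)‖ = r⁻¹ * ‖A (z - r • b)‖ := by
  rw [← norm_smul_of_nonneg (inv_nonneg.2 hr.le), ← map_smul, smul_sub, inv_smul_smul₀ hr.ne']

theorem preimage_inv_smul_ellipsoid (A : E →L[ℝ] E) {r : ℝ} (hr : 0 < r) (b : E) (s : ℝ) :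
    (r⁻¹ • ·) ⁻¹' ellipsoid A b s = ellipsoid A (r • b) (s * r) := by
  ext z
  simp only [Set.mem_preimage, ellipsoid, Set.mem_ofPred_eq, norm_apply_inv_smul_sub A hr]
  rw [inv_mul_le_iff₀ hr, mul_comm]

theorem preimage_inv_smul_closedBall {r : ℝ} (hr : 0 < r) (b : E) (s : ℝ) :
    (r⁻¹ • ·) ⁻¹' Metric.closedBall b s = Metric.closedBall (r • b) (s * r) := by
  have hball : ∀ c t, Metric.closedBall c t = ellipsoid (1 : E →L[ℝ] E) c t := fun _ _ =>
    Set.ext fun _ => mem_closedBall_iff_norm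
  rw [hball, hball, preimage_inv_smul_ellipsoid 1 hr]

theorem measureReal_map_inv_smul_closedBall [MeasurableSpace E] [BorelSpace E] {r : ℝ}
    (hr : 0 < r) (μ : Measure E) (b : E) (t : ℝ) : (μ.map (r⁻¹ • ·)).real (Metric.closedBall b t) =
      μ.real (Metric.closedBall (r • b) (t * r)) := by
  rw [map_measureReal_apply (by fun_prop) measurableSet_closedBall, preimage_inv_smul_closedBall hr]

variable [FiniteDimensional ℝ E]

theorem nearSubspace_preimage_smul_iff {r : ℝ} (hr : 0 < r) (L : Submodule ℝ E) (τ ρ : ℝ)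
    (F : Set E) :
    NearSubspace L τ ({b | r • b ∈ F} ∩ Metric.closedBall 0 ρ) ↔
      NearSubspace L (τ * r) (F ∩ Metric.closedBall 0 (ρ * r)) := by
  have hdist : ∀ x, distSeminorm L (r • x) ≤ τ * r ↔ distSeminorm L x ≤ τ := fun x => by
    rw [map_smul_eq_mul, Real.norm_of_nonneg hr.le, mul_comm, mul_le_mul_iff_left₀ hr]
  constructor
  · rintro h x ⟨hxF, hx⟩
    obtain ⟨y, rfl⟩ : ∃ y, r • y = x := ⟨r⁻¹ • x, smul_inv_smul₀ hr.ne' x⟩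
    exact (hdist y).2 (h y ⟨hxF, (smul_mem_closedBall_zero_iff hr).1 hx⟩)
  · rintro h x ⟨hxF, hx⟩
    exact (hdist x).1 (h (r • x) ⟨hxF, (smul_mem_closedBall_zero_iff hr).2 hx⟩)

/-- Every point of `F` in the ball of radius `r` is at distance at most `θ r` from some subspace of
dimension at most `k`. -/
def FlatAt (k : ℕ) (θ : ℝ) (F : Set E) (r : ℝ) : Prop :=
  ∃ W : Submodule ℝ E, Module.finrank ℝ W ≤ k ∧ NearSubspace W (θ * r) (F ∩ Metric.closedBall 0 r)

theorem FlatAt.of_le {k : ℕ} {θ θ' : ℝ} {F : Set E} {r r' : ℝ} (h : FlatAt k θ F r)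
    (hr : r' ≤ r) (hθ : θ * r ≤ θ' * r') : FlatAt k θ' F r' :=
  let ⟨W, hW, hnear⟩ := h
  ⟨W, hW, hnear.mono hθ (Set.inter_subset_inter_right _ (Metric.closedBall_subset_closedBall hr))⟩

theorem forall_flatAt_of_flatAt_mul {k : ℕ} {θ q R : ℝ} {F : Set E} (hθ : 0 < θ) (hq : 0 < q)
    (hq1 : q < 1) (hR : 0 < R) (hbase : FlatAt k (q * θ) F R)
    (hstep : ∀ r, 0 < r → r ≤ R → FlatAt k θ F r → FlatAt k θ F (q * r)) {t : ℝ} (ht : 0 < t)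
    (htR : t ≤ R) : FlatAt k θ F t := by
  have hiter : ∀ N : ℕ, ∀ t, q ^ (N + 1) * R ≤ t → t ≤ R → FlatAt k θ F t := by
    intro N
    induction N with
    | zero =>
      intro t hqt htR
      rw [zero_add, pow_one] at hqt
      exact hbase.of_le htR (by nlinarith)
    | succ N ih =>
      intro t hqt htR
      rcases le_or_gt (q ^ (N + 1) * R) t with hle | hlt
      · exact ih t hle htR
      · obtain ⟨s, rfl⟩ : ∃ s, q * s = t := ⟨t / q, by field_simp⟩
        have hs : q ^ (N + 1) * R ≤ s :=
          le_of_mul_le_mul_left (by rwa [← mul_assoc, ← pow_succ']) hq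
        have hsR : s ≤ R := by
          have hlt_q : q * s < q * R := hlt.trans_le (by
            gcongr
            exact pow_le_of_le_one hq.le hq1.le N.succ_ne_zero)
          exact (lt_of_mul_lt_mul_left hlt_q hq.le).le
        exact hstep s (hs.trans_lt' (by positivity)) hsR (ih s hs hsR)
  obtain ⟨N, hN⟩ := exists_pow_lt_of_lt_one (show 0 < t / R by positivity) hq1
  rw [lt_div_iff₀ hR] at hN
  refine hiter N t (le_trans ?_ hN.le) htR
  exact mul_le_mul_of_nonneg_right (pow_le_pow_of_le_one hq.le hq1.le N.le_succ) hR.le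

end Rescaling

section Flat

variable {E : Type*} [NormedAddCommGroup E] [InnerProductSpace ℝ E] [FiniteDimensional ℝ E]

theorem ellBump_sq_mul_inner_sq_le (θ : ℝ) {W : Submodule ℝ E} {e : E} (he : ‖e‖ = 1)
    (heW : e ∈ Wᗮ) (z : E) :
    ellBump 1 0 z ^ 2 * inner ℝ z e ^ 2 ≤
      (Metric.closedBall 0 1).indicator (fun _ => θ ^ 2) z +
        ({z | θ < distSeminorm W z} ∩ Metric.closedBall 0 1).indicator (fun _ => (1 : ℝ)) z := by
  by_cases hz : z ∈ Metric.closedBall (0 : E) 1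
  swap
  · have hzero : ellBump (1 : E →L[ℝ] E) 0 z = 0 := by
      contrapose! hz
      simpa using (norm_apply_lt_one_of_ellBump_ne_zero hz).le
    simp [hzero, hz]
  have hinner := abs_inner_le_distSeminorm heW z
  rw [he, mul_one] at hinner
  have hbump : ellBump 1 0 z ^ 2 * inner ℝ z e ^ 2 ≤ inner ℝ z e ^ 2 :=
    mul_le_of_le_one_left (sq_nonneg _)
      (pow_le_one₀ (ellBump_nonneg 1 0 z) (ellBump_le_one 1 0 z))
  rw [Set.indicator_of_mem hz]
  rcases lt_or_ge θ (distSeminorm W z) with hfar | hnear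
  · have hinner_one := (sq_le_one_iff_abs_le_one (inner ℝ z e)).2
      (hinner.trans ((distSeminorm_le_norm W z).trans (mem_closedBall_zero_iff.1 hz)))
    have hmem : z ∈ {z | θ < distSeminorm W z} ∩ Metric.closedBall 0 1 := ⟨hfar, hz⟩
    rw [Set.indicator_of_mem hmem]
    linarith [sq_nonneg θ]
  · rw [Set.indicator_of_notMem fun hmem => hmem.1.not_ge hnear, add_zero]
    have hinner_θ := abs_le.1 (hinner.trans hnear)
    exact hbump.trans (sq_le_sq' hinner_θ.1 hinner_θ.2)

variable [MeasurableSpace E] [BorelSpace E]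

theorem integrable_inertia (μ : Measure E) [IsFiniteMeasureOnCompacts μ] (x : E) :
    Integrable (fun z => ellBump 1 0 z ^ 3 • x - (6 * ellBump 1 0 z ^ 2 * inner ℝ z x) • z) μ := by
  have hint2 := integrable_ellBump_pow_smul (A := 1) (by simp) 0 μ two_ne_zero
    (g := fun z => (6 * inner ℝ z x) • z) (by fun_prop)
  refine (integrable_ellBump_pow_smul (by simp) 0 μ (N := 3) (by norm_num)
    (g := fun _ => x) (by fun_prop)).sub (hint2.congr (Eventually.of_forall fun z => ?_))
  module

/-- The linear map `x ↦ (∫ p³) x - 6 ∫ p² ⟨z, x⟩ z` for the round bump `p` at the origin: up to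
sign, the derivative at `x = 0` of `∫ p(z - x)³ (z - x) dμ(z)`. -/
noncomputable def inertia (μ : Measure E) [IsFiniteMeasureOnCompacts μ] : E →ₗ[ℝ] E where
  toFun x := ∫ z, (ellBump 1 0 z ^ 3 • x - (6 * ellBump 1 0 z ^ 2 * inner ℝ z x) • z) ∂μ
  map_add' x y := by
    rw [← integral_add (integrable_inertia μ x) (integrable_inertia μ y)]
    refine integral_congr_ae (Eventually.of_forall fun z => ?_)
    simp only [inner_add_right]
    module
  map_smul' c x := by
    rw [← integral_smul]
    refine integral_congr_ae (Eventually.of_forall fun z => ?_)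
    simp only [inner_smul_right, RingHom.id_apply]
    module

theorem inertia_apply (μ : Measure E) [IsFiniteMeasureOnCompacts μ] (x : E) : inertia μ x =
    ∫ z, (ellBump 1 0 z ^ 3 • x - (6 * ellBump 1 0 z ^ 2 * inner ℝ z x) • z) ∂μ := rfl

theorem inner_inertia_self (μ : Measure E) [IsFiniteMeasureOnCompacts μ] {e : E} (he : ‖e‖ = 1) :
    inner ℝ e (inertia μ e) = ∫ z, ellBump (1 : E →L[ℝ] E) 0 z ^ 3 ∂μ -
      6 * ∫ z, ellBump (1 : E →L[ℝ] E) 0 z ^ 2 * inner ℝ z e ^ 2 ∂μ := by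
  rw [inertia_apply, ← integral_inner (integrable_inertia μ e), ← integral_const_mul,
    ← integral_sub (integrable_ellBump_pow (by simp) 0 μ (by norm_num))
      ((integrable_ellBump_pow_mul (by simp) 0 μ two_ne_zero (by fun_prop)).const_mul 6)]
  refine integral_congr_ae (Eventually.of_forall fun z => ?_)
  simp only [inner_sub_right, inner_smul_right, real_inner_self_eq_norm_sq, he,
    real_inner_comm z e]
  ring

theorem AlmostSymmetric.measureReal_far_le {ε θ : ℝ} {μ : Measure E} {F F' : Set E}
    {A : E → E →L[ℝ] E} (h : AlmostSymmetric ε μ F F' A) {W : Submodule ℝ E}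
    (hW : NearSubspace W θ (F ∩ Metric.closedBall 0 2)) :
    μ.real ({z | θ < distSeminorm W z} ∩ Metric.closedBall 0 1) ≤
      ε * μ.real (Metric.closedBall 0 1) := by
  have hell : ellipsoid (A 0) 0 1 = Metric.closedBall 0 1 := by
    ext z
    simp [ellipsoid, h.shape_zero]
  have hmass := h.dense 0 h.zero_mem (by simp) 1 zero_le_one le_rfl
    ({z | θ < distSeminorm W z} ∩ Metric.closedBall 0 1)
    ((measurableSet_lt measurable_const (continuous_distSeminorm W).measurable).inter
      measurableSet_closedBall)
    (Set.disjoint_left.2 fun z hz hzF => hz.1.not_ge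
      (hW z ⟨hzF, Metric.closedBall_subset_closedBall one_le_two hz.2⟩))
  rwa [hell, Set.inter_eq_left.2 Set.inter_subset_right] at hmass

variable {μ : Measure E} [IsFiniteMeasure μ]

theorem integral_ellBump_pow_four_le {A : E →L[ℝ] E} (hA : ‖A - 1‖ ≤ 1 / 4) {x : E}
    (hx : ‖x‖ ≤ 1 / 2) : ∫ z, ellBump A x z ^ 4 ∂μ ≤ μ.real (Metric.closedBall 0 2) := by
  have hpoint : ∀ z, ellBump A x z ^ 4 ≤
      (Metric.closedBall (0 : E) 2).indicator (fun _ => (1 : ℝ)) z := by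
    refine Set.le_indicator (fun z _ => pow_le_one₀ (ellBump_nonneg A x z) (ellBump_le_one A x z))
      fun z hz => ?_
    rw [mem_closedBall_zero_iff, not_le] at hz
    simp [ellBump_eq_zero_of_two_lt_norm hA hx hz]
  have hmono := integral_mono
    (integrable_ellBump_pow (hA.trans (by norm_num)) x μ (N := 4) (by norm_num))
    ((integrable_const (1 : ℝ)).indicator measurableSet_closedBall) hpoint
  rwa [integral_indicator measurableSet_closedBall, setIntegral_const, smul_eq_mul, mul_one]
    at hmono

theorem norm_integral_taylor_le {ε : ℝ} {A : E →L[ℝ] E} (hA : ‖A - 1‖ ≤ ε) (hε : ε ≤ 1 / 4)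
    {x : E} (hx : ‖x‖ ≤ 1 / 2) :
    ‖(∫ z, ellBump A x z ^ 3 • (z - x) ∂μ) - (∫ z, ellBump 1 0 z ^ 3 • z ∂μ) + inertia μ x‖ ≤
      50000 * (‖x‖ ^ 2 + ε) * μ.real (Metric.closedBall 0 2) := by
  have hint_x := integrable_ellBump_pow_smul (hA.trans (by linarith)) x μ (N := 3) (by norm_num)
    (g := fun z => z - x) (by fun_prop)
  have hint_0 := integrable_ellBump_pow_smul (by simp) (0 : E) μ (N := 3) (by norm_num)
    (A := 1) (g := fun z : E => z) (by fun_prop)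
  rw [inertia_apply, ← integral_sub' hint_x hint_0,
    ← integral_add' (hint_x.sub hint_0) (integrable_inertia μ x)]
  have hint_ball : Integrable
      ((Metric.closedBall (0 : E) 2).indicator fun _ => 50000 * (‖x‖ ^ 2 + ε)) μ :=
    (integrable_const _).indicator measurableSet_closedBall
  refine (norm_integral_le_of_norm_le hint_ball (Eventually.of_forall fun z => ?_)).trans_eq ?_
  · rw [Pi.add_apply, Pi.sub_apply, ← add_sub_assoc]
    exact norm_taylor_ellBump_le hA hε hx z
  · rw [integral_indicator measurableSet_closedBall, setIntegral_const, smul_eq_mul, mul_comm]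

namespace AlmostSymmetric

variable {ε θ : ℝ} {F F' : Set E} {A : E → E →L[ℝ] E}

theorem norm_inertia_le (h : AlmostSymmetric ε μ F F' A) (hε : ε ≤ 1 / 4) {x : E} (hx : x ∈ F)
    (hx1 : ‖x‖ ≤ 1 / 2) :
    ‖inertia μ x‖ ≤ (50000 * (‖x‖ ^ 2 + ε) + 2 * ε) * μ.real (Metric.closedBall 0 2) := by
  have hA := h.shape_near x hx (by linarith)
  have hε0 : 0 ≤ ε := (norm_nonneg _).trans hA
  have hcenter_x := (h.center x hx (by linarith) 3 (Or.inr rfl)).trans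
    (mul_le_mul_of_nonneg_left (integral_ellBump_pow_four_le (hA.trans hε) hx1) hε0)
  have hcenter_0 := (h.center 0 (h.subset h.zero_mem) (by simp) 3 (Or.inr rfl)).trans
    (mul_le_mul_of_nonneg_left
      (integral_ellBump_pow_four_le (by simp [h.shape_zero]) (by simp)) hε0)
  have htaylor := norm_integral_taylor_le (μ := μ) hA hε hx1
  simp only [h.shape_zero, sub_zero] at hcenter_0
  set X := ∫ z, ellBump (A x) x z ^ 3 • (z - x) ∂μ
  set O := ∫ z, ellBump 1 0 z ^ 3 • z ∂μ
  calc ‖inertia μ x‖ = ‖(X - O + inertia μ x) - X + O‖ := by congr 1; abel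
    _ ≤ ‖X - O + inertia μ x‖ + ‖X‖ + ‖O‖ :=
        (norm_add_le _ _).trans (add_le_add_left (norm_sub_le _ _) _)
    _ ≤ _ := by linarith

theorem norm_inertia_le_of_smul_mem {κ : ℝ} (h : AlmostSymmetric ε μ F F' A) (hκ : 0 < κ)
    (hκ2 : κ ≤ 1 / 2) (hε : ε ≤ 1 / 4) (hεκ : ε ≤ κ ^ 2) {y : E} (hy : κ • y ∈ F)
    (hy1 : ‖y‖ ≤ 1) :
    ‖inertia μ y‖ ≤ 120000 * κ * μ.real (Metric.closedBall 0 2) := by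
  have hnorm : ‖κ • y‖ ≤ κ := by
    rw [norm_smul_of_nonneg hκ.le]
    exact mul_le_of_le_one_right hκ.le hy1
  have hsq : ‖κ • y‖ ^ 2 ≤ κ ^ 2 := by gcongr
  have hinertia := h.norm_inertia_le hε hy (hnorm.trans hκ2)
  rw [map_smul, norm_smul_of_nonneg hκ.le] at hinertia
  refine le_of_mul_le_mul_left (hinertia.trans ?_) hκ
  calc _ ≤ 120000 * κ ^ 2 * μ.real (Metric.closedBall 0 2) := by
        gcongr
        linarith [sq_nonneg κ]
    _ = κ * (120000 * κ * μ.real (Metric.closedBall 0 2)) := by ring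

theorem measureReal_closedBall_pos (h : AlmostSymmetric ε μ F F' A) :
    0 < μ.real (Metric.closedBall 0 2) :=
  (h.pos 0 (h.subset h.zero_mem) (by simp)).trans_le
    (integral_ellBump_pow_four_le (by simp [h.shape_zero]) (by simp))

theorem integral_sq_mul_inner_sq_le (h : AlmostSymmetric ε μ F F' A) {W : Submodule ℝ E}
    (hW : NearSubspace W θ (F ∩ Metric.closedBall 0 2)) {e : E} (he : ‖e‖ = 1) (heW : e ∈ Wᗮ) :
    ∫ z, ellBump (1 : E →L[ℝ] E) 0 z ^ 2 * inner ℝ z e ^ 2 ∂μ ≤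
      (θ ^ 2 + ε) * μ.real (Metric.closedBall 0 2) := by
  have hε0 : 0 ≤ ε := (norm_nonneg _).trans (h.shape_near 0 (h.subset h.zero_mem) (by simp))
  set V : Set E := {z | θ < distSeminorm W z} ∩ Metric.closedBall 0 1
  have hV_meas : MeasurableSet V :=
    (measurableSet_lt measurable_const (continuous_distSeminorm W).measurable).inter
      measurableSet_closedBall
  have hint_ball : Integrable ((Metric.closedBall (0 : E) 1).indicator fun _ => θ ^ 2) μ :=
    (integrable_const _).indicator measurableSet_closedBall
  have hint_V : Integrable (V.indicator fun _ => (1 : ℝ)) μ :=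
    (integrable_const _).indicator hV_meas
  have hmono := integral_mono
    (integrable_ellBump_pow_mul (by simp) 0 μ two_ne_zero (by fun_prop)) (hint_ball.add hint_V)
    (ellBump_sq_mul_inner_sq_le θ he heW)
  rw [integral_add' hint_ball hint_V, integral_indicator measurableSet_closedBall,
    integral_indicator hV_meas, setIntegral_const, setIntegral_const, smul_eq_mul, smul_eq_mul,
    mul_one] at hmono
  have hball : μ.real (Metric.closedBall 0 1) ≤ μ.real (Metric.closedBall 0 2) :=
    measureReal_mono (Metric.closedBall_subset_closedBall one_le_two)
  nlinarith [mul_le_mul_of_nonneg_left hball hε0, mul_le_mul_of_nonneg_left hball (sq_nonneg θ),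
    h.measureReal_far_le hW]

end AlmostSymmetric

/-- If the centres lie near a subspace `W` of dimension at most `k` but near no subspace of
dimension at most `k` at the smaller scale, then they span a unit vector orthogonal to `W`, on
which the inertia map is both small and bounded below. -/
theorem exists_nearSubspace_of_doubling {C θ θ' : ℝ} (hC : 0 < C) (hθ : 24 * C * θ ^ 2 ≤ 1)
    (hθ' : 0 < θ') (k : ℕ) :
    ∃ κ ε : ℝ, 0 < κ ∧ κ ≤ 1 / 2 ∧ 0 < ε ∧
      ∀ (μ : Measure E) [IsFiniteMeasure μ] (F F' : Set E) (A : E → E →L[ℝ] E),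
      AlmostSymmetric ε μ F F' A → ∀ W : Submodule ℝ E, Module.finrank ℝ W ≤ k →
        NearSubspace W θ (F ∩ Metric.closedBall 0 2) →
        μ.real (Metric.closedBall 0 2) ≤ C * ∫ z, ellBump (A 0) 0 z ^ 3 ∂μ →
        ∃ W' : Submodule ℝ E, Module.finrank ℝ W' ≤ k ∧
          NearSubspace W' (θ' * κ) (F ∩ Metric.closedBall 0 κ) := by
  obtain ⟨K, hK, hspan⟩ := exists_subspace_seminorm_le (E := E) hθ' (k + 1)
  obtain ⟨κ, hκ, hκ2, hκK⟩ : ∃ κ : ℝ, 0 < κ ∧ κ ≤ 1 / 2 ∧ C * (K * (120000 * κ)) ≤ 1 / 4 := by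
    refine ⟨min (1 / 2) (1 / (480000 * C * K)), by positivity, min_le_left _ _, ?_⟩
    have hle := min_le_right (1 / 2) (1 / (480000 * C * K))
    rw [le_div_iff₀ (by positivity)] at hle
    linarith
  obtain ⟨ε, hε0, hεκ, hε4, hεC⟩ : ∃ ε : ℝ, 0 < ε ∧ ε ≤ κ ^ 2 ∧ ε ≤ 1 / 4 ∧ C * ε ≤ 1 / 25 := by
    refine ⟨min (κ ^ 2) (min (1 / 4) (1 / (25 * C))), by positivity, min_le_left _ _,
      (min_le_right _ _).trans (min_le_left _ _), ?_⟩
    have hle := (min_le_right (κ ^ 2) _).trans (min_le_right (1 / 4) (1 / (25 * C)))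
    rw [le_div_iff₀ (by positivity)] at hle
    linarith
  refine ⟨κ, ε, hκ, hκ2, hε0, fun μ _ F F' A h W hW hflat hdoub => ?_⟩
  have hmass := h.measureReal_closedBall_pos
  by_contra! hfar
  obtain ⟨X, hX, hseminorm⟩ := hspan ({y | κ • y ∈ F} ∩ Metric.closedBall 0 1)
    Set.inter_subset_right fun L hL hnear => hfar L (by lia) (by
      simpa only [one_mul] using (nearSubspace_preimage_smul_iff hκ L θ' 1 F).1 hnear)
  obtain ⟨e, heX, heW, he⟩ := exists_unit_mem_orthogonal (X := X) (W := W) (by lia)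
  have hupper := hseminorm ((normSeminorm ℝ E).comp (inertia μ)) _ (by positivity)
    (fun y hy => h.norm_inertia_le_of_smul_mem hκ hκ2 hε4 hεκ hy.1
      (mem_closedBall_zero_iff.1 hy.2)) e heX
  rw [Seminorm.comp_apply, coe_normSeminorm, he, mul_one] at hupper
  have hcauchy : inner ℝ e (inertia μ e) ≤ ‖inertia μ e‖ := by
    simpa [he] using real_inner_le_norm e (inertia μ e)
  rw [inner_inertia_self μ he] at hcauchy
  have hlower := h.integral_sq_mul_inner_sq_le hflat he heW
  rw [h.shape_zero] at hdoub
  set G := μ.real (Metric.closedBall 0 2)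
  have hcontra : G ≤ 3 / 4 * G :=
    calc G ≤ C * (K * (120000 * κ * G) + 6 * ((θ ^ 2 + ε) * G)) :=
          hdoub.trans (by gcongr; linarith)
      _ = (C * (K * (120000 * κ)) + 6 * C * θ ^ 2 + 6 * (C * ε)) * G := by ring
      _ ≤ 3 / 4 * G := by gcongr; linarith
  linarith

end Flat

section Iteration

variable {E : Type*} [NormedAddCommGroup E] [InnerProductSpace ℝ E] [MeasurableSpace E]

/-- The condition `AlmostSymmetric` after blowing up by the factor `r⁻¹` at the origin. -/
def AlmostSymmetricAt (ε : ℝ) (μ : Measure E) (F F' : Set E) (A : E → E →L[ℝ] E) (r : ℝ) : Prop :=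
  AlmostSymmetric ε (μ.map (r⁻¹ • ·)) {b | r • b ∈ F} {b | r • b ∈ F'} fun b => A (r • b)

theorem AlmostSymmetricAt.mono {ε ε' : ℝ} {μ : Measure E} {F F' : Set E} {A : E → E →L[ℝ] E}
    {r : ℝ} (h : AlmostSymmetricAt ε μ F F' A r) (hε : ε ≤ ε') :
    AlmostSymmetricAt ε' μ F F' A r :=
  AlmostSymmetric.mono h hε

theorem le_pow_mul_of_forall_le_mul {g : ℝ → ℝ} (hg : Monotone g) (hg0 : ∀ t, 0 ≤ g t)
    {C β a : ℝ} (hC : 1 ≤ C) (hβ : β ≤ 1) (ha : 0 ≤ a) :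
    ∀ (n : ℕ) {b : ℝ}, (∀ t, a ≤ t → t ≤ b → g t ≤ C * g (β * t)) → β ^ n * b ≤ a →
      g b ≤ C ^ n * g a
  | 0, b, _, hb => by simpa using hg (by simpa using hb)
  | n + 1, b, hstep, hb => by
    rcases le_total b a with hba | hab
    · exact (hg hba).trans (le_mul_of_one_le_left (hg0 a) (one_le_pow₀ hC))
    · have hβb : β * b ≤ b := mul_le_of_le_one_left (ha.trans hab) hβ
      have hrec : g (β * b) ≤ C ^ n * g a :=
        le_pow_mul_of_forall_le_mul hg hg0 hC hβ ha n
          (fun t hat htb => hstep t hat (htb.trans hβb)) (by rwa [← mul_assoc, ← pow_succ])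
      calc g b ≤ C * g (β * b) := hstep b hab le_rfl
        _ ≤ C * (C ^ n * g a) := by gcongr
        _ = C ^ (n + 1) * g a := by ring

variable [FiniteDimensional ℝ E] [BorelSpace E]

theorem exists_measure_ball_le_mul_of_flatAt {τ : ℝ} (hτ : 0 < τ) (k : ℕ) :
    ∃ θ ε β C : ℝ, 0 < θ ∧ 0 < ε ∧ 0 < β ∧ β < 1 ∧ 1 ≤ C ∧
      ∀ (μ : Measure E) [IsFiniteMeasure μ] (F F' : Set E) (A : E → E →L[ℝ] E) (R : ℝ),
        (∀ r, 0 < r → r < R → AlmostSymmetricAt ε μ F F' A r) →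
        (∀ r, 0 < r → r < R → ∀ L : Submodule ℝ E, Module.finrank ℝ L < k →
          ¬ NearSubspace L (τ * r) (F' ∩ Metric.closedBall 0 r)) →
        ∀ t, 0 < t → 3 * t ≤ R → FlatAt k θ F (3 * t) →
          μ.real (Metric.closedBall 0 t) ≤ C * μ.real (Metric.closedBall 0 (β * t)) := by
  obtain ⟨κ, θ, ε, s, C, hκ, hκ1, hθ, hε, hs, hs4, -, hunit⟩ :=
    exists_measure_ball_le_of_nearSubspace (E := E) hτ k
  have hs1 : 0 < 1 - s := by linarith
  refine ⟨θ / 3, ε, (1 - 2 * s) / (1 - s), max C 1, by positivity, hε,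
    div_pos (by linarith) hs1, (div_lt_one hs1).2 (by linarith), le_max_right _ _,
    fun μ _ F F' A R hsymm hrobust t ht htR ⟨W, hW, hflat⟩ => ?_⟩
  obtain ⟨r, rfl⟩ : ∃ r, (1 - s) * r = t := ⟨t / (1 - s), by field_simp⟩
  have hr : 0 < r := pos_of_mul_pos_right ht hs1.le
  have hrR : r < R := by nlinarith
  have hθr : θ / 3 * (3 * ((1 - s) * r)) ≤ θ * r := by
    nlinarith [mul_nonneg hθ.le (mul_nonneg hs.le hr.le)]
  have hunit_r := hunit (μ.map (r⁻¹ • ·)) _ _ _ (hsymm r hr hrR) W hW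
    ((nearSubspace_preimage_smul_iff hr _ _ _ _).2 (hflat.mono hθr
      (Set.inter_subset_inter_right _ (Metric.closedBall_subset_closedBall (by nlinarith)))))
    fun L hL hnear => by
      rw [nearSubspace_preimage_smul_iff hr, mul_assoc] at hnear
      exact hrobust (κ * r) (by positivity) (by nlinarith) L hL hnear
  rw [measureReal_map_inv_smul_closedBall hr, measureReal_map_inv_smul_closedBall hr,
    smul_zero] at hunit_r
  rw [← mul_assoc, div_mul_cancel₀ _ hs1.ne']
  exact hunit_r.trans (mul_le_mul_of_nonneg_right (le_max_left _ _) measureReal_nonneg)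

theorem exists_doubling_of_flatAt {τ : ℝ} (hτ : 0 < τ) (k : ℕ) :
    ∃ θ ε C : ℝ, 0 < θ ∧ 0 < ε ∧ 0 < C ∧
      ∀ (μ : Measure E) [IsFiniteMeasure μ] (F F' : Set E) (A : E → E →L[ℝ] E) (R : ℝ),
        (∀ r, 0 < r → r < R → AlmostSymmetricAt ε μ F F' A r) →
        (∀ r, 0 < r → r < R → ∀ L : Submodule ℝ E, Module.finrank ℝ L < k →
          ¬ NearSubspace L (τ * r) (F' ∩ Metric.closedBall 0 r)) →
        ∀ r, 0 < r → 8 * r ≤ R → FlatAt k θ F (8 * r) →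
          μ.real (Metric.closedBall 0 (2 * r)) ≤ C * μ.real (Metric.closedBall 0 (r / 2)) := by
  obtain ⟨θ, ε, β, C, hθ, hε, hβ, hβ1, hC, hstep⟩ :=
    exists_measure_ball_le_mul_of_flatAt (E := E) hτ k
  obtain ⟨p, hp⟩ := exists_pow_lt_of_lt_one (show (0 : ℝ) < 1 / 4 by norm_num) hβ1
  refine ⟨θ / 8, ε, C ^ p, by positivity, hε, by positivity,
    fun μ _ F F' A R hsymm hrobust r hr hrR hflat => ?_⟩
  exact le_pow_mul_of_forall_le_mul (g := fun t => μ.real (Metric.closedBall 0 t))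
    (fun s t hst => measureReal_mono (Metric.closedBall_subset_closedBall hst))
    (fun t => measureReal_nonneg) hC hβ1.le (by positivity) p
    (fun t htr htr' => hstep μ F F' A R hsymm hrobust t (by linarith) (by linarith)
      (hflat.of_le (by linarith) (by nlinarith))) (by nlinarith)

theorem exists_flatAt_mul_of_flatAt {τ : ℝ} (hτ : 0 < τ) (k : ℕ) :
    ∃ θ ε C q : ℝ, 0 < θ ∧ 0 < ε ∧ 0 < C ∧ 0 < q ∧ q < 1 ∧
      ∀ (μ : Measure E) [IsFiniteMeasure μ] (F F' : Set E) (A : E → E →L[ℝ] E) (R : ℝ),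
        (∀ r, 0 < r → r < R → AlmostSymmetricAt ε μ F F' A r) →
        (∀ r, 0 < r → r < R → ∀ L : Submodule ℝ E, Module.finrank ℝ L < k →
          ¬ NearSubspace L (τ * r) (F' ∩ Metric.closedBall 0 r)) →
        ∀ r, 0 < r → r ≤ R → FlatAt k θ F r →
          FlatAt k θ F (q * r) ∧
          μ.real (Metric.closedBall 0 (r / 4)) ≤ C * μ.real (Metric.closedBall 0 (r / 16)) := by
  obtain ⟨θ₁, ε₁, C, hθ₁, hε₁, hC, hdoubling⟩ := exists_doubling_of_flatAt (E := E) hτ k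
  obtain ⟨θ, hθ, hθθ₁, hθC⟩ : ∃ θ : ℝ, 0 < θ ∧ θ ≤ θ₁ ∧ 24 * (16 * C) * (8 * θ) ^ 2 ≤ 1 := by
    refine ⟨min θ₁ (min 1 (1 / (24576 * C))), by positivity, min_le_left _ _, ?_⟩
    have hle_one := (min_le_right θ₁ _).trans (min_le_left 1 (1 / (24576 * C)))
    have hle := (min_le_right θ₁ _).trans (min_le_right 1 (1 / (24576 * C)))
    have hnonneg : 0 ≤ min θ₁ (min 1 (1 / (24576 * C))) := by positivity
    rw [le_div_iff₀ (by positivity)] at hle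
    nlinarith
  obtain ⟨κ, ε₂, hκ, hκ2, hε₂, hflatten⟩ :=
    exists_nearSubspace_of_doubling (E := E) (C := 16 * C) (θ' := θ) (by positivity) hθC hθ k
  refine ⟨θ, min ε₁ ε₂, C, κ / 8, hθ, by positivity, hC, by positivity, by linarith,
    fun μ _ F F' A R hsymm hrobust r hr hrR hflat => ?_⟩
  obtain ⟨s, rfl⟩ : ∃ s, 8 * s = r := ⟨r / 8, by ring⟩
  have hs : 0 < s := by linarith
  have hdouble := hdoubling μ F F' A R (fun t h0 h1 => (hsymm t h0 h1).mono (min_le_left _ _))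
    hrobust s hs hrR (hflat.of_le le_rfl (by gcongr))
  rw [show 8 * s / 4 = 2 * s by ring, show 8 * s / 16 = s / 2 by ring,
    show κ / 8 * (8 * s) = κ * s by ring]
  refine ⟨?_, hdouble⟩
  obtain ⟨W, hW, hnear⟩ := hflat
  have hsymm_s := (hsymm s hs (by linarith)).mono (min_le_right _ _)
  have hshape : A 0 = 1 := by simpa only [smul_zero] using hsymm_s.shape_zero
  obtain ⟨W', hW', hnear'⟩ := hflatten (μ.map (s⁻¹ • ·)) _ _ _ hsymm_s W hW
    ((nearSubspace_preimage_smul_iff hs _ _ _ _).2 (hnear.mono (by linarith)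
      (Set.inter_subset_inter_right _ (Metric.closedBall_subset_closedBall (by linarith))))) (by
      have hhalf := measureReal_closedBall_le_integral_ellBump_pow (A := (1 : E →L[ℝ] E))
        (by simp) 0 (μ.map (s⁻¹ • ·)) three_ne_zero
      rw [measureReal_map_inv_smul_closedBall hs, smul_zero, one_div_mul_eq_div] at hhalf
      rw [measureReal_map_inv_smul_closedBall hs, smul_zero, hshape, mul_comm 16 C, mul_assoc]
      refine hdouble.trans (mul_le_mul_of_nonneg_left ?_ hC.le)
      linarith [measureReal_nonneg (μ := μ) (s := Metric.closedBall 0 (s / 2))])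
  rw [nearSubspace_preimage_smul_iff hs, mul_assoc] at hnear'
  exact ⟨W', hW', hnear'⟩

/-- Let `k` be the least dimension for which the centres are arbitrarily flat along some sequence
of scales; then `k`-flatness at one small scale propagates to all smaller ones. -/
theorem exists_forall_measure_closedBall_le (μ : Measure E) [IsFiniteMeasure μ] {F : ℕ → Set E}
    (hF : Antitone F) {A : E → E →L[ℝ] E}
    (hsymm : ∀ ε > 0, ∃ j₀, ∀ j ≥ j₀, ∃ ρ > 0, ∀ r, 0 < r → r < ρ →
      AlmostSymmetricAt ε μ (F j) (F (j + 1)) A r) :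
    ∃ C > 0, ∃ ρ > 0, ∀ r, 0 < r → r < ρ →
      μ.real (Metric.closedBall 0 (4 * r)) ≤ C * μ.real (Metric.closedBall 0 r) := by
  let P : ℕ → Prop := fun d => ∀ θ > 0, ∃ j, ∀ r₀ > 0, ∃ r, 0 < r ∧ r < r₀ ∧
    ∃ L : Submodule ℝ E, Module.finrank ℝ L < d ∧
      NearSubspace L (θ * r) (F j ∩ Metric.closedBall 0 r)
  have htop : P (Module.finrank ℝ E + 1) := fun θ hθ => ⟨0, fun r₀ hr₀ => ⟨r₀ / 2,
    by positivity, by linarith, ⊤, by simp, fun x _ => ?_⟩⟩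
  swap
  · rw [(distSeminorm_eq_zero_iff (W := ⊤)).2 trivial]
    positivity
  have hbot : ¬ P 0 := fun hP => by
    obtain ⟨j, hj⟩ := hP 1 one_pos
    obtain ⟨r, _, _, L, hL, _⟩ := hj 1 one_pos
    exact Nat.not_lt_zero _ hL
  obtain ⟨k, hk, hk1⟩ :=
    Nat.exists_not_and_succ_of_not_zero_of_exists hbot ⟨_, htop⟩
  simp only [P, not_forall, not_exists, not_and] at hk
  obtain ⟨τ, hτ, hrobust⟩ := hk
  obtain ⟨θ, ε, C, q, hθ, hε, hC, hq, hq1, hprop⟩ := exists_flatAt_mul_of_flatAt (E := E) hτ k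
  obtain ⟨j₀, hj₀⟩ := hsymm ε hε
  obtain ⟨j₁, hj₁⟩ := hk1 (q * θ) (by positivity)
  obtain ⟨ρ₁, hρ₁, hsymm_j⟩ := hj₀ (max j₀ j₁) (le_max_left _ _)
  obtain ⟨ρ₂, hρ₂, hrobust_j⟩ := hrobust (max j₀ j₁ + 1)
  obtain ⟨R, hR0, hR, L, hL, hnear⟩ := hj₁ (min ρ₁ ρ₂) (by positivity)
  have hprop_j := hprop μ (F (max j₀ j₁)) (F (max j₀ j₁ + 1)) A R
    (fun r hr hrR => hsymm_j r hr ((hrR.trans hR).trans_le (min_le_left _ _)))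
    (fun r hr hrR => hrobust_j r hr ((hrR.trans hR).trans_le (min_le_right _ _)))
  have hbase : FlatAt k (q * θ) (F (max j₀ j₁)) R := ⟨L, Nat.lt_succ_iff.1 hL,
    hnear.mono le_rfl (Set.inter_subset_inter_left _ (hF (le_max_right _ _)))⟩
  refine ⟨C, hC, R / 16, by positivity, fun r hr hrR => ?_⟩
  have hdouble := (hprop_j (16 * r) (by positivity) (by linarith)
    (forall_flatAt_of_flatAt_mul hθ hq hq1 hR0 hbase (fun r hr hrR hr_flat =>
      (hprop_j r hr hrR hr_flat).1) (by positivity) (by linarith))).2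
  rwa [show 16 * r / 4 = 4 * r by ring, show 16 * r / 16 = r by ring] at hdouble

end Iteration

section RadialTestFunctions

variable {n : ℕ}

theorem measurable_rieszKernel (m : ℕ) : Measurable (rieszKernel m : Euc n → Euc n) := by
  unfold rieszKernel
  fun_prop

theorem norm_pow_mul_norm_rieszKernel_le_one (m : ℕ) (v : Euc n) :
    ‖v‖ ^ m * ‖rieszKernel m v‖ ≤ 1 := by
  rw [rieszKernel, norm_smul, norm_inv, norm_pow, norm_norm]
  rcases eq_or_ne ‖v‖ 0 with hv | hv
  · simp [hv]
  · rw [pow_succ]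
    field_simp
    exact le_rfl

theorem norm_pow_smul_rieszKernel (m : ℕ) (v : Euc n) : ‖v‖ ^ (m + 1) • rieszKernel m v = v := by
  rw [rieszKernel]
  rcases eq_or_ne v 0 with rfl | hv
  · simp
  · exact smul_inv_smul₀ (by positivity) v

theorem norm_smul_rieszKernel_le {m : ℕ} {C a s : ℝ} (ha : |a| ≤ C * s ^ m) (hC : 0 ≤ C)
    (hs : 0 ≤ s) {v : Euc n} (hsv : s ≤ ‖v‖) : ‖a • rieszKernel m v‖ ≤ C :=
  calc ‖a • rieszKernel m v‖ = |a| * ‖rieszKernel m v‖ := by rw [norm_smul, Real.norm_eq_abs]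
    _ ≤ C * ‖v‖ ^ m * ‖rieszKernel m v‖ := by
        gcongr
        exact ha.trans (by gcongr)
    _ = C * (‖v‖ ^ m * ‖rieszKernel m v‖) := mul_assoc _ _ _
    _ ≤ C := mul_le_of_le_one_right hC (norm_pow_mul_norm_rieszKernel_le_one m v)

/-- The integrand `(s, v) ↦ 1_{s ≤ |v|} w'(s) K(v)`: integrating over `v` gives the truncated Riesz
integrals weighted by `w'`, integrating over `s` gives the test function `w(|v|) K(v)`. -/
noncomputable def layerKernel (m : ℕ) (w' : ℝ → ℝ) (s : ℝ) (v : Euc n) : Euc n :=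
  (Set.Iic ‖v‖).indicator w' s • rieszKernel m v

theorem integral_layerKernel (m : ℕ) (w' : ℝ → ℝ) (s : ℝ) (ν : Measure (Euc n)) :
    ∫ v, layerKernel m w' s v ∂ν = w' s • ∫ v in {v | s ≤ ‖v‖}, rieszKernel m v ∂ν := by
  rw [← integral_smul, ← integral_indicator (measurableSet_le measurable_const measurable_norm)]
  congr 1
  ext1 v
  rw [layerKernel, Set.indicator_apply, Set.indicator_apply, ite_smul, zero_smul]
  rfl

theorem setIntegral_layerKernel {m : ℕ} {w w' : ℝ → ℝ} (hw : ∀ t, HasDerivAt w (w' t) t)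
    (hw' : Continuous w') (hw0 : w 0 = 0) {R : ℝ} (hR : 0 ≤ R) (v : Euc n) :
    ∫ s in Set.Ioc 0 R, layerKernel m w' s v = w (min R ‖v‖) • rieszKernel m v := by
  simp only [layerKernel]
  rw [integral_smul_const, setIntegral_indicator measurableSet_Iic, Set.Ioc_inter_Iic,
    ← intervalIntegral.integral_of_le (le_min hR (norm_nonneg v)),
    intervalIntegral.integral_eq_sub_of_hasDerivAt (fun s _ => hw s)
      (hw'.intervalIntegrable _ _), hw0, sub_zero]

theorem integrable_layerKernel {m : ℕ} (ν : Measure (Euc n)) [IsFiniteMeasure ν] {w' : ℝ → ℝ}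
    (hw' : Continuous w') {C R : ℝ} (hC : ∀ s, 0 < s → s ≤ R → |w' s| ≤ C * s ^ m) :
    Integrable (Function.uncurry (layerKernel m w')) ((volume.restrict (Set.Ioc 0 R)).prod ν) := by
  have hmeas : Measurable (Function.uncurry (layerKernel m w') : ℝ × Euc n → Euc n) := by
    have hrestrict : Function.uncurry (layerKernel m w') =
        {p : ℝ × Euc n | p.1 ≤ ‖p.2‖}.indicator fun p => w' p.1 • rieszKernel m p.2 := by
      ext1 p
      rw [Function.uncurry, layerKernel, Set.indicator_apply, Set.indicator_apply, ite_smul,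
        zero_smul]
      rfl
    rw [hrestrict]
    exact ((hw'.measurable.comp measurable_fst).smul
      ((measurable_rieszKernel m).comp measurable_snd)).indicator
        (measurableSet_le measurable_fst measurable_snd.norm)
  refine Integrable.of_bound hmeas.aestronglyMeasurable C ?_
  have hrange : ∀ᵐ s ∂(volume.restrict (Set.Ioc (0 : ℝ) R)), s ∈ Set.Ioc 0 R :=
    ae_restrict_mem measurableSet_Ioc
  filter_upwards [Measure.quasiMeasurePreserving_fst.ae hrange] with p ⟨hp0, hpR⟩
  have hC0 : 0 ≤ C :=
    nonneg_of_mul_nonneg_left ((abs_nonneg _).trans (hC p.1 hp0 hpR)) (by positivity)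
  rw [Function.uncurry, layerKernel, Set.indicator_apply]
  split_ifs with hp
  · exact norm_smul_rieszKernel_le (hC p.1 hp0 hpR) hC0 hp0.le hp
  · simpa using hC0

theorem setIntegral_closedBall_eq_integral_smul_truncation {m : ℕ} (ν : Measure (Euc n))
    [IsFiniteMeasure ν] {w w' : ℝ → ℝ} (hw : ∀ t, HasDerivAt w (w' t) t) (hw' : Continuous w')
    (hw0 : w 0 = 0) {R : ℝ} (hR : 0 ≤ R) (hwR : w R = 0) {C : ℝ}
    (hC : ∀ s, 0 < s → s ≤ R → |w' s| ≤ C * s ^ m) :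
    ∫ v in Metric.closedBall 0 R, w ‖v‖ • rieszKernel m v ∂ν =
      ∫ s in Set.Ioc 0 R, w' s • ∫ v in {v | s ≤ ‖v‖}, rieszKernel m v ∂ν := by
  simp only [← integral_layerKernel]
  rw [integral_integral_swap (integrable_layerKernel ν hw' hC),
    ← integral_indicator measurableSet_closedBall]
  congr 1
  ext1 v
  rw [setIntegral_layerKernel hw hw' hw0 hR v]
  by_cases hv : v ∈ Metric.closedBall (0 : Euc n) R
  · rw [Set.indicator_of_mem hv, min_eq_right (mem_closedBall_zero_iff.1 hv)]
  · rw [Set.indicator_of_notMem hv, min_eq_left (not_le.1 (mem_closedBall_zero_iff.not.1 hv)).le,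
      hwR, zero_smul]

theorem norm_setIntegral_closedBall_smul_rieszKernel_le {m : ℕ} (ν : Measure (Euc n))
    [IsFiniteMeasure ν] {w w' : ℝ → ℝ} (hw : ∀ t, HasDerivAt w (w' t) t) (hw' : Continuous w')
    (hw0 : w 0 = 0) {R : ℝ} (hR : 0 < R) (hwR : w R = 0) {C : ℝ}
    (hC : ∀ s, 0 < s → s ≤ R → |w' s| ≤ C * s ^ m) {D : ℝ}
    (hD : ∀ s, 0 < s → s ≤ R →
      ‖(∫ v in {v | s ≤ ‖v‖}, rieszKernel m v ∂ν) - ∫ v in {v | R ≤ ‖v‖}, rieszKernel m v ∂ν‖ ≤ D) :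
    ‖∫ v in Metric.closedBall 0 R, w ‖v‖ • rieszKernel m v ∂ν‖ ≤ C * R ^ (m + 1) * D := by
  set T : ℝ → Euc n := fun s => ∫ v in {v | s ≤ ‖v‖}, rieszKernel m v ∂ν
  have hint_T : IntegrableOn (fun s => w' s • T s) (Set.Ioc 0 R) := by
    simpa only [Function.uncurry, integral_layerKernel, IntegrableOn] using
      (integrable_layerKernel ν hw' hC).integral_prod_left
  have hcancel : ∫ s in Set.Ioc 0 R, w' s • T R = 0 := by
    rw [integral_smul_const, ← intervalIntegral.integral_of_le hR.le,
      intervalIntegral.integral_eq_sub_of_hasDerivAt (fun s _ => hw s)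
        (hw'.intervalIntegrable _ _), hwR, hw0, sub_zero, zero_smul]
  have hC0 : 0 ≤ C :=
    nonneg_of_mul_nonneg_left ((abs_nonneg _).trans (hC R hR le_rfl)) (by positivity)
  rw [setIntegral_closedBall_eq_integral_smul_truncation ν hw hw' hw0 hR.le hwR hC,
    ← sub_zero (∫ s in Set.Ioc 0 R, w' s • T s), ← hcancel,
    ← integral_sub hint_T (hw'.integrableOn_Ioc.smul_const _)]
  refine (norm_setIntegral_le_of_norm_le_const (C := C * R ^ m * D) (by simp) ?_).trans_eq ?_
  · rintro s ⟨hs0, hsR⟩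
    rw [← smul_sub, norm_smul, Real.norm_eq_abs]
    exact mul_le_mul ((hC s hs0 hsR).trans (by gcongr)) (hD s hs0 hsR) (norm_nonneg _)
      (by positivity)
  · rw [Real.volume_real_Ioc_of_le hR.le]
    ring

theorem norm_setIntegral_closedBall_radial_le {m : ℕ} (ν : Measure (Euc n)) [IsFiniteMeasure ν]
    {h h' : ℝ → ℝ} (hh : ∀ t, HasDerivAt h (h' t) t) (hh' : Continuous h') {R : ℝ} (hR : 0 < R)
    (hhR : h R = 0) {C : ℝ} (hC : ∀ t, 0 < t → t ≤ R → |(m + 1) * h t + t * h' t| ≤ C) {D : ℝ}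
    (hD : ∀ s, 0 < s → s ≤ R →
      ‖(∫ v in {v | s ≤ ‖v‖}, rieszKernel m v ∂ν) - ∫ v in {v | R ≤ ‖v‖}, rieszKernel m v ∂ν‖ ≤ D) :
    ‖∫ v in Metric.closedBall 0 R, h ‖v‖ • v ∂ν‖ ≤ C * R ^ (m + 1) * D := by
  have hcont : Continuous h := continuous_iff_continuousAt.2 fun t => (hh t).continuousAt
  have hderiv : ∀ t, HasDerivAt (fun t => h t * t ^ (m + 1)) (t ^ m * ((m + 1) * h t + t * h' t))
      t := fun t => by
    refine ((hh t).mul (hasDerivAt_pow (m + 1) t)).congr_deriv ?_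
    simp only [Nat.cast_add, Nat.cast_one, Nat.add_sub_cancel]
    ring
  have hbound := norm_setIntegral_closedBall_smul_rieszKernel_le (m := m) ν hderiv (by fun_prop)
    (by simp) hR (by simp [hhR]) (C := C) (fun s hs0 hsR => ?_) hD
  · simpa only [mul_smul, norm_pow_smul_rieszKernel] using hbound
  · rw [abs_mul, abs_of_nonneg (by positivity), mul_comm]
    exact mul_le_mul_of_nonneg_right (hC s hs0 hsR) (by positivity)

end RadialTestFunctions

section Centers

variable {n m : ℕ} {μ : Measure (Euc n)} {F : ℕ → Set (Euc n)} {A : Euc n → Euc n →L[ℝ] Euc n}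
  {c : ℝ} {ρ : ℕ → ℝ}

/-- The integral of the Riesz kernel outside the ellipsoid of shape `A` and size `s` around `b`. -/
noncomputable def ellTrunc (m : ℕ) (μ : Measure (Euc n)) (A : Euc n →L[ℝ] Euc n) (b : Euc n)
    (s : ℝ) : Euc n :=
  ∫ z in {z | s ≤ ‖A (z - b)‖}, rieszKernel m (A (z - b)) ∂μ

/-- A nested sequence of sets of centres around the origin on which the shapes `A b` become round,
the truncated Riesz transforms oscillate less and less, the measure has a uniform lower density, and
each set is dense at the points of the next one. As in `AlmostSymmetric`, density is expressed by
the measurable sets that miss the set of centres. -/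
structure CenterSequence (m : ℕ) (μ : Measure (Euc n)) (F : ℕ → Set (Euc n))
    (A : Euc n → Euc n →L[ℝ] Euc n) (c : ℝ) (ρ : ℕ → ℝ) : Prop where
  antitone : Antitone F
  zero_mem : ∀ j, 0 ∈ F j
  shape_zero : A 0 = 1
  c_pos : 0 < c
  ρ_pos : ∀ j, 0 < ρ j
  shape : ∀ j, ∀ b ∈ F j, ‖A b - 1‖ ≤ 1 / (j + 1)
  osc : ∀ j, ∀ b ∈ F j, ∀ s t, 0 < s → s < ρ j → 0 < t → t < ρ j →
    ‖ellTrunc m μ (A b) b s - ellTrunc m μ (A b) b t‖ ≤ 1 / (j + 1)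
  low : ∀ j, ∀ b ∈ F j, ∀ r, 0 < r → r < ρ j → c * r ^ m ≤ μ.real (Metric.closedBall b r)
  dense : ∀ j, ∀ b ∈ F (j + 1), ∀ s, 0 < s → s < ρ (j + 1) → ∀ V, MeasurableSet V →
    Disjoint V (F j) → μ.real (V ∩ ellipsoid (A b) b s) ≤
      1 / (j + 1) * μ.real (ellipsoid (A b) b s)

theorem rieszKernel_inv_smul (m : ℕ) {r : ℝ} (hr : 0 < r) (v : Euc n) :
    rieszKernel m (r⁻¹ • v) = r ^ m • rieszKernel m v := by
  rw [rieszKernel, rieszKernel, norm_smul_of_nonneg (inv_nonneg.2 hr.le), smul_smul, smul_smul]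
  congr 1
  rw [mul_pow, mul_inv, inv_pow, inv_inv, pow_succ]
  field_simp

theorem ellTrunc_map_inv_smul (m : ℕ) (μ : Measure (Euc n)) (B : Euc n →L[ℝ] Euc n) (b : Euc n)
    {r : ℝ} (hr : 0 < r) (s : ℝ) :
    ellTrunc m (μ.map (r⁻¹ • ·)) B b s = r ^ m • ellTrunc m μ B (r • b) (s * r) := by
  have hkernel : ∀ z, rieszKernel m (B (r⁻¹ • z - b)) = r ^ m • rieszKernel m (B (z - r • b)) :=
    fun z => by rw [← rieszKernel_inv_smul m hr, ← map_smul, smul_sub, inv_smul_smul₀ hr.ne']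
  have hset : (r⁻¹ • ·) ⁻¹' {z | s ≤ ‖B (z - b)‖} = {z | s * r ≤ ‖B (z - r • b)‖} := by
    ext z
    simp only [Set.mem_preimage, Set.mem_ofPred_eq, norm_apply_inv_smul_sub B hr]
    rw [le_inv_mul_iff₀ hr, mul_comm]
  have hmeas : Measurable fun z => rieszKernel m (B (z - b)) :=
    (measurable_rieszKernel m).comp (by fun_prop)
  rw [ellTrunc, ellTrunc, setIntegral_map (measurableSet_le (by fun_prop) (by fun_prop))
    hmeas.aestronglyMeasurable (by fun_prop), hset, ← integral_smul]
  simp only [hkernel]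

theorem norm_setIntegral_ellipsoid_radial_le (μ : Measure (Euc n)) [IsFiniteMeasure μ]
    (B : Euc n →L[ℝ] Euc n) (b : Euc n) {f f' : ℝ → ℝ} (hf : ∀ t, HasDerivAt f (f' t) t)
    (hf' : Continuous f') {R : ℝ} (hR : 0 < R) (hfR : f R = 0) {C : ℝ}
    (hC : ∀ t, 0 < t → t ≤ R → |(m + 1) * f t + t * f' t| ≤ C) {D : ℝ}
    (hD : ∀ s, 0 < s → s ≤ R → ‖ellTrunc m μ B b s - ellTrunc m μ B b R‖ ≤ D) :
    ‖∫ z in ellipsoid B b R, f ‖B (z - b)‖ • B (z - b) ∂μ‖ ≤ C * R ^ (m + 1) * D := by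
  have hcont : Continuous f := continuous_iff_continuousAt.2 fun t => (hf t).continuousAt
  have hmeas : Measurable fun z => B (z - b) := by fun_prop
  have htrunc : ∀ s, ∫ v in {v | s ≤ ‖v‖}, rieszKernel m v ∂(μ.map fun z => B (z - b)) =
      ellTrunc m μ B b s := fun s => by
    rw [setIntegral_map (measurableSet_le measurable_const measurable_norm)
      (measurable_rieszKernel m).aestronglyMeasurable hmeas.aemeasurable]
    rfl
  have hpre : (fun z => B (z - b)) ⁻¹' Metric.closedBall 0 R = ellipsoid B b R :=
    Set.ext fun z => mem_closedBall_zero_iff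
  have hball := norm_setIntegral_closedBall_radial_le (m := m) (μ.map fun z => B (z - b))
    hf hf' hR hfR hC (D := D) (by simpa only [htrunc] using hD)
  rwa [setIntegral_map measurableSet_closedBall (by fun_prop) hmeas.aemeasurable, hpre] at hball

theorem CenterSequence.norm_setIntegral_radial_le [IsFiniteMeasure μ]
    (H : CenterSequence m μ F A c ρ) {j : ℕ} {b : Euc n} {r : ℝ} (hr : 0 < r) (hb : r • b ∈ F j)
    {f f' : ℝ → ℝ} (hf : ∀ t, HasDerivAt f (f' t) t) (hf' : Continuous f') {R : ℝ} (hR : 0 < R)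
    (hfR : f R = 0) (hRρ : R * r < ρ j) {C : ℝ}
    (hC : ∀ t, 0 < t → t ≤ R → |(m + 1) * f t + t * f' t| ≤ C) :
    ‖∫ z in ellipsoid (A (r • b)) b R,
        f ‖A (r • b) (z - b)‖ • A (r • b) (z - b) ∂(μ.map (r⁻¹ • ·))‖ ≤
      C * R ^ (m + 1) * (r ^ m * (1 / (j + 1))) := by
  refine norm_setIntegral_ellipsoid_radial_le (m := m) _ _ _ hf hf' hR hfR hC fun s hs hsR => ?_
  have hsR' : s * r ≤ R * r := by gcongr
  rw [ellTrunc_map_inv_smul m μ _ _ hr, ellTrunc_map_inv_smul m μ _ _ hr, ← smul_sub, norm_smul,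
    Real.norm_of_nonneg (by positivity)]
  gcongr
  exact H.osc j _ hb _ _ (by positivity) (by linarith) (by positivity) hRρ

theorem abs_radial_bump_profile_le (m : ℕ) {N : ℕ} (hN : N = 2 ∨ N = 3) {t : ℝ} (ht0 : 0 < t)
    (ht1 : t ≤ 1) : |((m : ℝ) + 1) * (1 - t ^ 2) ^ N + t * (N * (1 - t ^ 2) ^ (N - 1) * -(2 * t))| ≤
      (m : ℝ) + 7 := by
  have hsq : t ^ 2 ≤ 1 := pow_le_one₀ ht0.le ht1
  have hq0 : 0 ≤ 1 - t ^ 2 := by linarith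
  have hq1 : 1 - t ^ 2 ≤ 1 := by linarith [sq_nonneg t]
  have hN3 : (N : ℝ) ≤ 3 := by rcases hN with rfl | rfl <;> norm_num
  have hprofile : ((m : ℝ) + 1) * (1 - t ^ 2) ^ N ≤ (m + 1) * 1 := by
    gcongr
    exact pow_le_one₀ hq0 hq1
  have hderiv : (N : ℝ) * ((1 - t ^ 2) ^ (N - 1) * t ^ 2) ≤ 3 * 1 := by
    gcongr
    exact mul_le_one₀ (pow_le_one₀ hq0 hq1) (sq_nonneg t) hsq
  have hprofile0 : 0 ≤ ((m : ℝ) + 1) * (1 - t ^ 2) ^ N := by positivity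
  have hderiv0 : 0 ≤ (N : ℝ) * ((1 - t ^ 2) ^ (N - 1) * t ^ 2) := by positivity
  rw [show t * (N * (1 - t ^ 2) ^ (N - 1) * -(2 * t)) =
    -(2 * (N * ((1 - t ^ 2) ^ (N - 1) * t ^ 2))) by ring, abs_le]
  constructor <;> linarith

theorem setIntegral_ellipsoid_eq_integral_ellBump (ν : Measure (Euc n)) (B : Euc n →L[ℝ] Euc n)
    (b : Euc n) {N : ℕ} (hN : N ≠ 0) (g : Euc n → Euc n) :
    ∫ z in ellipsoid B b 1, (1 - ‖B (z - b)‖ ^ 2) ^ N • g z ∂ν =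
      ∫ z, ellBump B b z ^ N • g z ∂ν := by
  rw [← integral_indicator (isClosed_ellipsoid _ _ _).measurableSet]
  congr 1
  ext1 z
  rcases eq_or_ne (ellBump B b z) 0 with hz | hz
  · rw [hz, zero_pow hN, zero_smul]
    refine Set.indicator_apply_eq_zero.2 fun (hmem : ‖B (z - b)‖ ≤ 1) => ?_
    have hle : 1 - ‖B (z - b)‖ ^ 2 ≤ 0 := max_eq_left_iff.1 hz
    rw [le_antisymm hle (sub_nonneg.2 (pow_le_one₀ (norm_nonneg _) hmem)), zero_pow hN, zero_smul]
  · have hmem : z ∈ ellipsoid B b 1 := (norm_apply_lt_one_of_ellBump_ne_zero hz).le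
    rw [Set.indicator_of_mem hmem, ellBump_eq_of_ne_zero hz]

theorem CenterSequence.norm_integral_ellBump_smul_le [IsFiniteMeasure μ]
    (H : CenterSequence m μ F A c ρ) {j : ℕ} (hj : 1 / ((j : ℝ) + 1) ≤ 1 / 2) {b : Euc n} {r : ℝ}
    (hr : 0 < r) (hrρ : r < ρ j) (hb : r • b ∈ F j) {N : ℕ} (hN : N = 2 ∨ N = 3) :
    ‖∫ z, ellBump (A (r • b)) b z ^ N • (z - b) ∂(μ.map (r⁻¹ • ·))‖ ≤
      2 * (m + 7) * r ^ m * (1 / (j + 1)) := by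
  have hN0 : N ≠ 0 := by lia
  have hA : ‖A (r • b) - 1‖ ≤ 1 / 2 := (H.shape j _ hb).trans hj
  have hderiv : ∀ t : ℝ, HasDerivAt (fun t : ℝ => (1 - t ^ 2) ^ N)
      (N * (1 - t ^ 2) ^ (N - 1) * -(2 * t)) t := fun t => by
    refine (((hasDerivAt_pow 2 t).const_sub 1).pow N).congr_deriv ?_
    simp
  have hradial := H.norm_setIntegral_radial_le hr hb hderiv (by fun_prop) one_pos (by simp [hN0])
    (by rwa [one_mul]) fun t => abs_radial_bump_profile_le m hN
  rw [setIntegral_ellipsoid_eq_integral_ellBump _ _ _ hN0] at hradial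
  simp only [← map_smul] at hradial
  rw [(A (r • b)).integral_comp_comm
    (integrable_ellBump_pow_smul hA b _ hN0 (by fun_prop)), one_pow] at hradial
  linarith [norm_le_two_mul_norm_apply hA
    (∫ z, ellBump (A (r • b)) b z ^ N • (z - b) ∂(μ.map (r⁻¹ • ·)))]

theorem CenterSequence.le_integral_ellBump_pow_four [IsFiniteMeasure μ]
    (H : CenterSequence m μ F A c ρ) {j : ℕ} (hj : 1 / ((j : ℝ) + 1) ≤ 1 / 2) {b : Euc n} {r : ℝ}
    (hr : 0 < r) (hrρ : r < ρ j) (hb : r • b ∈ F j) :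
    (7 / 16) ^ 4 * (c * (r / 2) ^ m) ≤
      ∫ z, ellBump (A (r • b)) b z ^ 4 ∂(μ.map (r⁻¹ • ·)) := by
  refine le_trans ?_ (measureReal_closedBall_le_integral_ellBump_pow ((H.shape j _ hb).trans hj) b
    (μ.map (r⁻¹ • ·)) four_ne_zero)
  rw [measureReal_map_inv_smul_closedBall hr, one_div_mul_eq_div]
  gcongr
  exact H.low j _ hb _ (by positivity) (by linarith)

theorem CenterSequence.measureReal_inter_ellipsoid_map_le [IsFiniteMeasure μ]
    (H : CenterSequence m μ F A c ρ) {j : ℕ} (hj : 1 / ((j : ℝ) + 1) ≤ 1 / 2) {b : Euc n} {r : ℝ}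
    (hr : 0 < r) (hrρ : r < ρ (j + 1)) (hb : r • b ∈ F (j + 1)) {s : ℝ} (hs0 : 0 ≤ s) (hs1 : s ≤ 1)
    {V : Set (Euc n)} (hV : MeasurableSet V) (hVF : Disjoint V {b | r • b ∈ F j}) :
    (μ.map (r⁻¹ • ·)).real (V ∩ ellipsoid (A (r • b)) b s) ≤
      1 / (j + 1) * (μ.map (r⁻¹ • ·)).real (ellipsoid (A (r • b)) b s) := by
  have hbj : r • b ∈ F j := H.antitone j.le_succ hb
  rcases hs0.eq_or_lt with rfl | hs0
  · have hempty : V ∩ ellipsoid (A (r • b)) b 0 = ∅ := by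
      refine Set.eq_empty_of_forall_notMem fun z ⟨hzV, (hz : ‖A (r • b) (z - b)‖ ≤ 0)⟩ => ?_
      have hdist := norm_le_two_mul_norm_apply ((H.shape j _ hbj).trans hj) (z - b)
      obtain rfl : z = b := sub_eq_zero.1 (norm_le_zero_iff.1 (by linarith))
      exact Set.disjoint_left.1 hVF hzV hbj
    rw [hempty, measureReal_empty]
    positivity
  · have hmeas : Measurable fun z : Euc n => r⁻¹ • z := by fun_prop
    have hell := (isClosed_ellipsoid (A (r • b)) b s).measurableSet
    rw [map_measureReal_apply hmeas (hV.inter hell), map_measureReal_apply hmeas hell,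
      Set.preimage_inter, preimage_inv_smul_ellipsoid _ hr]
    refine H.dense j _ hb _ (by positivity) ((mul_le_of_le_one_left hr.le hs1).trans_lt hrρ) _
      (hmeas hV) (Set.disjoint_left.2 fun z hzV hzF => Set.disjoint_left.1 hVF hzV ?_)
    rwa [Set.mem_ofPred_eq, smul_inv_smul₀ hr.ne']

theorem CenterSequence.almostSymmetricAt [IsFiniteMeasure μ] (H : CenterSequence m μ F A c ρ)
    {j : ℕ} {ε : ℝ} (hj : 1 / ((j : ℝ) + 1) ≤ 1 / 2) (hjε : 1 / ((j : ℝ) + 1) ≤ ε)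
    (hjc : 2 * (m + 7) * (1 / ((j : ℝ) + 1)) ≤ ε * ((7 / 16) ^ 4 * (c * (1 / 2) ^ m))) {r : ℝ}
    (hr : 0 < r) (hrρ : r < min (ρ j) (ρ (j + 1))) :
    AlmostSymmetricAt ε μ (F j) (F (j + 1)) A r := by
  obtain ⟨hrρ, hrρ'⟩ := lt_min_iff.1 hrρ
  have hc := H.c_pos
  refine ⟨fun b hb => H.antitone j.le_succ hb, ?_, ?_, fun b hb _ => (H.shape j _ hb).trans hjε,
    fun b hb _ N hN => ?_, fun b hb _ => ?_, fun b hb _ s hs0 hs1 V hV hVF => ?_⟩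
  · simpa only [Set.mem_ofPred_eq, smul_zero] using H.zero_mem (j + 1)
  · simpa only [smul_zero] using H.shape_zero
  · calc _ ≤ 2 * (m + 7) * r ^ m * (1 / (j + 1)) :=
          H.norm_integral_ellBump_smul_le hj hr hrρ hb hN
      _ = 2 * (m + 7) * (1 / (j + 1)) * r ^ m := by ring
      _ ≤ ε * ((7 / 16) ^ 4 * (c * (1 / 2) ^ m)) * r ^ m := by gcongr
      _ = ε * ((7 / 16) ^ 4 * (c * (r / 2) ^ m)) := by
        rw [show r / 2 = 1 / 2 * r by ring, mul_pow]; ring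
      _ ≤ ε * ∫ z, ellBump (A (r • b)) b z ^ 4 ∂(μ.map (r⁻¹ • ·)) := by
          refine mul_le_mul_of_nonneg_left (H.le_integral_ellBump_pow_four hj hr hrρ hb) ?_
          exact le_trans (by positivity) hjε
  · exact lt_of_lt_of_le (by positivity) (H.le_integral_ellBump_pow_four hj hr hrρ hb)
  · refine (H.measureReal_inter_ellipsoid_map_le hj hr hrρ' hb hs0 hs1 hV hVF).trans ?_
    gcongr

theorem CenterSequence.exists_measure_closedBall_le [IsFiniteMeasure μ]
    (H : CenterSequence m μ F A c ρ) :
    ∃ C > 0, ∃ ρ > 0, ∀ r, 0 < r → r < ρ →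
      μ.real (Metric.closedBall 0 (4 * r)) ≤ C * μ.real (Metric.closedBall 0 r) := by
  refine exists_forall_measure_closedBall_le μ H.antitone (A := A) fun ε hε => ?_
  have hc := H.c_pos
  have hsmall : ∀ᶠ j : ℕ in atTop, 1 / ((j : ℝ) + 1) ≤ 1 / 2 ∧ 1 / ((j : ℝ) + 1) ≤ ε ∧
      2 * (m + 7) * (1 / ((j : ℝ) + 1)) ≤ ε * ((7 / 16) ^ 4 * (c * (1 / 2) ^ m)) := by
    have hlim := tendsto_one_div_add_atTop_nhds_zero_nat (𝕜 := ℝ)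
    refine (hlim.eventually_le_const (by norm_num)).and ((hlim.eventually_le_const hε).and ?_)
    refine (hlim.const_mul (2 * ((m : ℝ) + 7))).eventually_le_const ?_
    rw [mul_zero]
    positivity
  obtain ⟨j₀, hj₀⟩ := eventually_atTop.1 hsmall
  exact ⟨j₀, fun j hj => ⟨_, lt_min (H.ρ_pos j) (H.ρ_pos (j + 1)), fun r hr hrρ =>
    H.almostSymmetricAt (hj₀ j hj).1 (hj₀ j hj).2.1 (hj₀ j hj).2.2 hr hrρ⟩⟩

end Centers

section Greedy

/-- In a family of sets `U x` of sizes `r x`, the ones with `x ∈ T` could have been selected in the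
order of decreasing size, up to the factor `q`: of any two, one has at least `q` times the size of
the other and misses the centre of the other. -/
def IsGreedySelection {α : Type*} (q : ℝ) (U : α → Set α) (r : α → ℝ) (T : Set α) : Prop :=
  T.Pairwise fun x y => (q * r y ≤ r x ∧ y ∉ U x) ∨ (q * r x ≤ r y ∧ x ∉ U y)

theorem exists_subset_forall_rel_notMem {α : Type*} (R : α → α → Prop) [IsWellOrder α R]
    (Z : Set α) {U : α → Set α} (hU : ∀ x ∈ Z, x ∈ U x) :
    ∃ T ⊆ Z, (Z ⊆ ⋃ x ∈ T, U x) ∧ ∀ x ∈ T, ∀ y ∈ T, R x y → y ∉ U x := by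
  let selected : α → Prop := (IsWellFounded.wf (r := R)).fix fun x selectedBelow =>
    x ∈ Z ∧ ∀ y (h : R y x), selectedBelow y h → x ∉ U y
  have selected_iff (x : α) : selected x ↔ x ∈ Z ∧ ∀ y, R y x → selected y → x ∉ U y :=
    iff_of_eq ((IsWellFounded.wf (r := R)).fix_eq _ x)
  refine ⟨{x | selected x}, fun x hx => ((selected_iff x).1 hx).1, fun x hx => ?_,
    fun x hx y hy hxy => ((selected_iff y).1 hy).2 x hxy hx⟩
  rw [Set.mem_iUnion₂]
  by_cases hsel : selected x
  · exact ⟨x, hsel, hU x hx⟩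
  · rw [selected_iff] at hsel
    push Not at hsel
    obtain ⟨y, -, hy, hxy⟩ := hsel hx
    exact ⟨y, hy, hxy⟩

theorem exists_isGreedySelection {α : Type*} {Z : Set α} {U : α → Set α} {r : α → ℝ}
    (hr : ∀ x ∈ Z, 0 < r x ∧ r x ≤ 1) (hU : ∀ x ∈ Z, x ∈ U x) {q : ℝ} (hq : 0 < q) (hq1 : q < 1) :
    ∃ T ⊆ Z, (Z ⊆ ⋃ x ∈ T, U x) ∧ IsGreedySelection q U r T := by
  have exists_level (x : α) : ∃ k : ℕ, x ∈ Z → q ^ (k + 1) < r x ∧ r x ≤ q ^ k := by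
    by_cases hx : x ∈ Z
    · obtain ⟨k, hk⟩ := exists_nat_pow_near_of_lt_one (hr x hx).1 (hr x hx).2 hq hq1
      exact ⟨k, fun _ => hk⟩
    · exact ⟨0, fun h => absurd h hx⟩
  choose level hlevel using exists_level
  have size_le : ∀ x ∈ Z, ∀ y ∈ Z, level x ≤ level y → q * r y ≤ r x := by
    intro x hx y hy hxy
    calc q * r y ≤ q * q ^ level y := by gcongr; exact (hlevel y hy).2
      _ ≤ q * q ^ level x := by gcongr ?_ * ?_; exact pow_le_pow_of_le_one hq.le hq1.le hxy
      _ = q ^ (level x + 1) := (pow_succ' _ _).symm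
      _ ≤ r x := (hlevel x hx).1.le
  let byLevel : α ↪ ℕ × α := ⟨fun x => (level x, x), fun x y h => congrArg Prod.snd h⟩
  let R : α → α → Prop := byLevel ⁻¹'o Prod.Lex (· < ·) WellOrderingRel
  have : IsWellOrder α R := (RelEmbedding.preimage byLevel _).isWellOrder
  have level_le {x y : α} (h : R x y) : level x ≤ level y :=
    (Prod.lex_def.1 h).elim le_of_lt fun h => h.1.le
  obtain ⟨T, hTZ, hcover, hmiss⟩ := exists_subset_forall_rel_notMem R Z hU
  refine ⟨T, hTZ, hcover, fun x hx y hy hne => ?_⟩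
  rcases trichotomous_of R x y with h | h | h
  · exact Or.inl ⟨size_le x (hTZ hx) y (hTZ hy) (level_le h), hmiss x hx y hy h⟩
  · exact absurd h hne
  · exact Or.inr ⟨size_le y (hTZ hy) x (hTZ hx) (level_le h), hmiss y hy x hx h⟩

end Greedy

section BoundedOverlap

theorem sum_measure_le_mul_measure_biUnion {α ι : Type*} [MeasurableSpace α] {μ : Measure α}
    {V : ι → Set α} (hV : ∀ i, MeasurableSet (V i)) {K : ℕ} {S : Finset ι}
    (hcard : ∀ z, ∀ P ⊆ S, (∀ i ∈ P, z ∈ V i) → P.card ≤ K) :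
    ∑ i ∈ S, μ (V i) ≤ K * μ (⋃ i ∈ S, V i) := by
  classical
  have hoverlap (z : α) : ∑ i ∈ S, (V i).indicator (1 : α → ℝ≥0∞) z ≤
      (⋃ i ∈ S, V i).indicator (fun _ => (K : ℝ≥0∞)) z := by
    simp only [Set.indicator_apply, Pi.one_apply]
    rw [← Finset.sum_filter, Finset.sum_const, nsmul_one]
    split_ifs with hz
    · exact_mod_cast hcard z _ (Finset.filter_subset _ S) fun i hi => (Finset.mem_filter.1 hi).2
    · rw [Finset.filter_eq_empty_iff.2 fun i hi hzi => hz (Set.mem_biUnion hi hzi),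
        Finset.card_empty, Nat.cast_zero]
  calc ∑ i ∈ S, μ (V i) = ∑ i ∈ S, ∫⁻ z, (V i).indicator 1 z ∂μ :=
        Finset.sum_congr rfl fun i _ => (lintegral_indicator_one (hV i)).symm
    _ = ∫⁻ z, ∑ i ∈ S, (V i).indicator 1 z ∂μ :=
        (lintegral_finsetSum S fun i _ => measurable_one.indicator (hV i)).symm
    _ ≤ ∫⁻ z, (⋃ i ∈ S, V i).indicator (fun _ => (K : ℝ≥0∞)) z ∂μ := lintegral_mono hoverlap
    _ = K * μ (⋃ i ∈ S, V i) :=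
        lintegral_indicator_const (S.measurableSet_biUnion fun i _ => hV i) _

variable {E : Type*} [NormedAddCommGroup E] [InnerProductSpace ℝ E]

theorem card_le_of_pairwise_inner_lt [FiniteDimensional ℝ E] {ι : Type*} {S : Finset ι}
    {v : ι → E} (hv : ∀ i ∈ S, v i ≠ 0)
    (hinner : (S : Set ι).Pairwise fun i j => inner ℝ (v i) (v j) < 3 / 5 * (‖v i‖ * ‖v j‖)) :
    S.card ≤ 5 ^ Module.finrank ℝ E := by
  classical
  let g (i : ι) : E := (2 * ‖v i‖⁻¹) • v i
  have norm_g : ∀ i ∈ S, ‖g i‖ = 2 := by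
    intro i hi
    rw [norm_smul_of_nonneg (by positivity), mul_assoc,
      inv_mul_cancel₀ (norm_ne_zero_iff.2 (hv i hi)), mul_one]
  have one_le_norm_sub : (S : Set ι).Pairwise fun i j => 1 ≤ ‖g i - g j‖ := by
    intro i hi j hj hij
    have hvi := norm_pos_iff.2 (hv i hi)
    have hvj := norm_pos_iff.2 (hv j hj)
    have hinner_g : inner ℝ (g i) (g j) ≤ 12 / 5 := by
      calc inner ℝ (g i) (g j) = 2 * ‖v i‖⁻¹ * (2 * ‖v j‖⁻¹) * inner ℝ (v i) (v j) := by
            simp only [g, real_inner_smul_left, real_inner_smul_right]; ring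
        _ ≤ 2 * ‖v i‖⁻¹ * (2 * ‖v j‖⁻¹) * (3 / 5 * (‖v i‖ * ‖v j‖)) := by
            gcongr; exact (hinner hi hj hij).le
        _ = 12 / 5 := by field_simp; norm_num
    have hsq : ‖g i - g j‖ ^ 2 = 8 - 2 * inner ℝ (g i) (g j) := by
      rw [norm_sub_sq_real, norm_g i hi, norm_g j hj]; ring
    nlinarith [norm_nonneg (g i - g j)]
  have hinj : Set.InjOn g S := by
    intro i hi j hj hg
    by_contra hij
    have hsep : 1 ≤ ‖g i - g j‖ := one_le_norm_sub hi hj hij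
    rw [hg, sub_self, norm_zero] at hsep
    exact one_pos.not_ge hsep
  rw [← Finset.card_image_of_injOn hinj]
  refine Besicovitch.card_le_of_separated _ (Finset.forall_mem_image.2 fun i hi => (norm_g i hi).le)
    (Finset.forall_mem_image.2 fun i hi => Finset.forall_mem_image.2 fun j hj hij =>
      one_le_norm_sub hi hj fun h => hij (h ▸ rfl))

theorem convex_ellipsoid (A : E →L[ℝ] E) (b : E) (s : ℝ) : Convex ℝ (ellipsoid A b s) := by
  have hpreimage : ellipsoid A b s = A.toLinearMap ⁻¹' Metric.closedBall (A b) s := by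
    ext z; simp [ellipsoid, dist_eq_norm]
  exact hpreimage ▸ (convex_closedBall _ _).linear_preimage _

variable {A B : E →L[ℝ] E} {x y z : E} {s t : ℝ}

theorem mem_ellipsoid_of_norm_le (hA : ‖A - 1‖ ≤ 1 / 100) (h : ‖z - x‖ ≤ 99 / 100 * s) :
    z ∈ ellipsoid A x s := by
  change ‖A (z - x)‖ ≤ s
  linarith [(abs_le.1 (abs_norm_apply_sub_norm_le hA (z - x))).2, norm_nonneg (z - x)]

theorem norm_le_of_mem_ellipsoid (hA : ‖A - 1‖ ≤ 1 / 100) (h : z ∈ ellipsoid A x s) :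
    ‖z - x‖ ≤ 100 / 99 * s := by
  change ‖A (z - x)‖ ≤ s at h
  linarith [(abs_le.1 (abs_norm_apply_sub_norm_le hA (z - x))).1, norm_nonneg (z - x)]

theorem norm_sub_le_of_inner_ge {u w : E} (hu : s / 10 ≤ ‖u‖) (hu' : ‖u‖ ≤ 102 / 100 * s)
    (hw : s / 2 ≤ ‖w‖) (hw' : ‖w‖ ≤ 104 / 100 * s)
    (hinner : 3 / 5 * (‖u‖ * ‖w‖) ≤ inner ℝ u w) : ‖w - u‖ ≤ 99 / 100 * s := by
  have hs : 0 ≤ s := by linarith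
  refine abs_le_of_sq_le_sq' ?_ (by positivity) |>.2
  rw [norm_sub_sq_real, real_inner_comm]
  nlinarith [mul_nonneg (sub_nonneg.2 hu) (sub_nonneg.2 hu'),
    mul_nonneg (sub_nonneg.2 hw) (sub_nonneg.2 hw'),
    mul_nonneg (sub_nonneg.2 hu) (sub_nonneg.2 hw'),
    mul_nonneg (sub_nonneg.2 hu') (sub_nonneg.2 hw),
    mul_nonneg (sub_nonneg.2 hu) (sub_nonneg.2 hw),
    mul_nonneg (sub_nonneg.2 hu') (sub_nonneg.2 hw')]

theorem mem_ellipsoid_of_inner_ge (hA : ‖A - 1‖ ≤ 1 / 100) (hs : 0 < s)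
    (hz : z ∈ ellipsoid A x s) (hxz : s / 10 ≤ ‖x - z‖) (hyz : ‖y - z‖ ≤ 104 / 100 * s)
    (hinner : 3 / 5 * (‖x - z‖ * ‖y - z‖) ≤ inner ℝ (x - z) (y - z)) :
    y ∈ ellipsoid A x s := by
  have hxz' : ‖x - z‖ ≤ 102 / 100 * s := by
    rw [norm_sub_rev]; linarith [norm_le_of_mem_ellipsoid hA hz]
  rcases le_or_gt (s / 2) ‖y - z‖ with hfar | hnear
  · refine mem_ellipsoid_of_norm_le hA ?_
    rw [← sub_sub_sub_cancel_right y x z]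
    exact norm_sub_le_of_inner_ge hxz hxz' hfar hyz hinner
  · -- push `y` away from `z` to the distance `s / 2`, and use convexity
    rcases eq_or_ne y z with rfl | hne
    · exact hz
    have hdist : 0 < ‖y - z‖ := norm_sub_pos_iff.2 hne
    set θ := ‖y - z‖ / (s / 2) with hθ
    have hθ_pos : 0 < θ := by positivity
    have hnorm : ‖θ⁻¹ • (y - z)‖ = s / 2 := by
      rw [norm_smul_of_nonneg (by positivity), hθ, inv_div, div_mul_cancel₀ _ hdist.ne']
    have hpushed : z + θ⁻¹ • (y - z) ∈ ellipsoid A x s := by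
      refine mem_ellipsoid_of_norm_le hA ?_
      rw [← sub_sub_sub_cancel_right _ x z, add_sub_cancel_left]
      refine norm_sub_le_of_inner_ge hxz hxz' hnorm.ge (by linarith) ?_
      rw [norm_smul_of_nonneg (by positivity), real_inner_smul_right]
      linarith [mul_le_mul_of_nonneg_left hinner (inv_nonneg.2 hθ_pos.le)]
    have := (convex_ellipsoid A x s).add_smul_sub_mem hz hpushed
      ⟨hθ_pos.le, (div_le_one (by positivity)).2 hnear.le⟩
    rwa [add_sub_cancel_left, smul_inv_smul₀ hθ_pos.ne', add_sub_cancel] at this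

theorem inner_lt_of_notMem_ellipsoid (hA : ‖A - 1‖ ≤ 1 / 100) (hB : ‖B - 1‖ ≤ 1 / 100)
    (hs : 0 < s) (hst : 100 / 101 * t ≤ s) (hzx : z ∈ ellipsoid A x s) (hzy : z ∈ ellipsoid B y t)
    (hy : y ∉ ellipsoid A x s) (hxz : s / 10 ≤ ‖x - z‖) :
    inner ℝ (x - z) (y - z) < 3 / 5 * (‖x - z‖ * ‖y - z‖) := by
  contrapose! hy
  refine mem_ellipsoid_of_inner_ge hA hs hzx hxz ?_ hy
  rw [norm_sub_rev]
  linarith [norm_le_of_mem_ellipsoid hB hzy]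

variable {A : E → E →L[ℝ] E} {r : E → ℝ}

theorem card_le_one_of_norm_sub_lt {S : Finset E} (hA : ∀ x ∈ S, ‖A x - 1‖ ≤ 1 / 100)
    (hr : ∀ x ∈ S, 0 < r x) (hz : ∀ x ∈ S, ‖x - z‖ < r x / 10)
    (hS : IsGreedySelection (100 / 101) (fun x => ellipsoid (A x) x (r x)) r S) : S.card ≤ 1 := by
  refine Finset.card_le_one.2 fun x hx y hy => ?_
  by_contra hxy
  have hdist : ‖y - x‖ ≤ ‖y - z‖ + ‖x - z‖ := by
    simpa only [sub_sub_sub_cancel_right] using norm_sub_le (y - z) (x - z)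
  rcases hS hx hy hxy with ⟨hsize, hmiss⟩ | ⟨hsize, hmiss⟩
  · exact hmiss (mem_ellipsoid_of_norm_le (hA x hx) (by linarith [hr x hx, hz x hx, hz y hy]))
  · rw [norm_sub_rev] at hdist
    exact hmiss (mem_ellipsoid_of_norm_le (hA y hy) (by linarith [hr y hy, hz x hx, hz y hy]))

variable [FiniteDimensional ℝ E]

theorem card_le_of_le_norm_sub {S : Finset E} (hA : ∀ x ∈ S, ‖A x - 1‖ ≤ 1 / 100)
    (hr : ∀ x ∈ S, 0 < r x) (hz : ∀ x ∈ S, z ∈ ellipsoid (A x) x (r x))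
    (hfar : ∀ x ∈ S, r x / 10 ≤ ‖x - z‖)
    (hS : IsGreedySelection (100 / 101) (fun x => ellipsoid (A x) x (r x)) r S) :
    S.card ≤ 5 ^ Module.finrank ℝ E := by
  refine card_le_of_pairwise_inner_lt (v := fun x => x - z)
    (fun x hx => norm_pos_iff.1 (by linarith [hr x hx, hfar x hx])) fun x hx y hy hxy => ?_
  rcases hS hx hy hxy with ⟨hsize, hmiss⟩ | ⟨hsize, hmiss⟩
  · exact inner_lt_of_notMem_ellipsoid (hA x hx) (hA y hy) (hr x hx) hsize (hz x hx) (hz y hy)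
      hmiss (hfar x hx)
  · rw [real_inner_comm, mul_comm ‖x - z‖]
    exact inner_lt_of_notMem_ellipsoid (hA y hy) (hA x hx) (hr y hy) hsize (hz y hy) (hz x hx)
      hmiss (hfar y hy)

theorem card_le_of_mem_ellipsoid {S : Finset E} (hA : ∀ x ∈ S, ‖A x - 1‖ ≤ 1 / 100)
    (hr : ∀ x ∈ S, 0 < r x) (hz : ∀ x ∈ S, z ∈ ellipsoid (A x) x (r x))
    (hS : IsGreedySelection (100 / 101) (fun x => ellipsoid (A x) x (r x)) r S) :
    S.card ≤ 5 ^ Module.finrank ℝ E + 1 := by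
  classical
  rw [← Finset.card_filter_add_card_filter_not (fun x => r x / 10 ≤ ‖x - z‖)]
  have hS' (p : E → Prop) [DecidablePred p] : IsGreedySelection (100 / 101)
      (fun x => ellipsoid (A x) x (r x)) r (S.filter p : Finset E) :=
    hS.mono (Finset.coe_subset.2 (Finset.filter_subset _ _))
  refine add_le_add
    (card_le_of_le_norm_sub (fun x hx => hA x (Finset.mem_of_mem_filter x hx))
      (fun x hx => hr x (Finset.mem_of_mem_filter x hx))
      (fun x hx => hz x (Finset.mem_of_mem_filter x hx))
      (fun x hx => (Finset.mem_filter.1 hx).2) (hS' _))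
    (card_le_one_of_norm_sub_lt (fun x hx => hA x (Finset.mem_of_mem_filter x hx))
      (fun x hx => hr x (Finset.mem_of_mem_filter x hx))
      (fun x hx => not_le.1 (Finset.mem_filter.1 hx).2) (hS' _))

theorem IsGreedySelection.countable {T : Set E}
    (hT : IsGreedySelection (100 / 101) (fun x => ellipsoid (A x) x (r x)) r T)
    (hA : ∀ x ∈ T, ‖A x - 1‖ ≤ 1 / 100) (hr : ∀ x ∈ T, 0 < r x) : T.Countable := by
  have : ProperSpace E := FiniteDimensional.proper_real E
  have hcover : T ⊆ ⋃ i : ℕ, {x ∈ T | TopologicalSpace.denseSeq E i ∈ ellipsoid (A x) x (r x)} := by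
    intro x hx
    obtain ⟨i, hi⟩ := (TopologicalSpace.denseRange_denseSeq E).exists_mem_open
      (Metric.isOpen_ball (x := x) (ε := 99 / 100 * r x))
      ⟨x, Metric.mem_ball_self (by have := hr x hx; positivity)⟩
    rw [mem_ball_iff_norm] at hi
    exact Set.mem_iUnion.2 ⟨i, hx, mem_ellipsoid_of_norm_le (hA x hx) hi.le⟩
  refine (Set.countable_iUnion fun i => Set.Finite.countable ?_).mono hcover
  by_contra hinfinite
  obtain ⟨S, hS, hcard⟩ := Set.Infinite.exists_subset_card_eq hinfinite (5 ^ Module.finrank ℝ E + 2)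
  have := card_le_of_mem_ellipsoid (fun x hx => hA x (hS hx).1) (fun x hx => hr x (hS hx).1)
    (fun x hx => (hS hx).2) (hT.mono fun x hx => (hS hx).1)
  lia

end BoundedOverlap

section Density

theorem exists_seq_units_forall_norm_mul_inv_sub_one_lt (E : Type*) [NormedAddCommGroup E]
    [NormedSpace ℝ E] [FiniteDimensional ℝ E] :
    ∃ Q : ℕ → (E →L[ℝ] E)ˣ, ∀ (B : (E →L[ℝ] E)ˣ) {δ : ℝ}, 0 < δ →
      ∃ i, ‖(B * (Q i)⁻¹ : E →L[ℝ] E) - 1‖ < δ := by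
  have : ProperSpace (E →L[ℝ] E) := FiniteDimensional.proper_real _
  have : SecondCountableTopology (E →L[ℝ] E)ˣ :=
    Units.isEmbedding_embedProduct.secondCountableTopology
  refine ⟨TopologicalSpace.denseSeq _, fun B δ hδ => ?_⟩
  have hcont : Continuous fun u : (E →L[ℝ] E)ˣ => (B * (u⁻¹ : (E →L[ℝ] E)ˣ) : E →L[ℝ] E) - 1 :=
    (continuous_const.mul (Units.continuous_val.comp continuous_inv)).sub continuous_const
  exact (TopologicalSpace.denseRange_denseSeq (E →L[ℝ] E)ˣ).exists_mem_open
    (isOpen_lt hcont.norm continuous_const) ⟨B, by simpa using hδ⟩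

variable {E : Type*} [NormedAddCommGroup E] [InnerProductSpace ℝ E]

theorem preimage_ellipsoid_mul_inv (Q : (E →L[ℝ] E)ˣ) (A : E →L[ℝ] E) (x : E) (s : ℝ) :
    (Q : E →L[ℝ] E) ⁻¹' ellipsoid (A * (Q⁻¹ : (E →L[ℝ] E)ˣ)) ((Q : E →L[ℝ] E) x) s =
      ellipsoid A x s := by
  ext z
  simp only [ellipsoid, Set.mem_preimage, Set.mem_ofPred_eq, ← map_sub,
    ← mul_apply_eq_comp, mul_assoc, Units.inv_mul, mul_one]

variable [FiniteDimensional ℝ E] [MeasurableSpace E] [BorelSpace E] {μ : Measure E}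

theorem IsGreedySelection.tsum_measure_sdiff_le {A : E → E →L[ℝ] E} {r : E → ℝ} {T M O : Set E}
    (hT : IsGreedySelection (100 / 101) (fun x => ellipsoid (A x) x (r x)) r T)
    (hA : ∀ x ∈ T, ‖A x - 1‖ ≤ 1 / 100) (hr : ∀ x ∈ T, 0 < r x) (hM : MeasurableSet M)
    (hO : ∀ x ∈ T, ellipsoid (A x) x (r x) ⊆ O) :
    ∑' x : T, μ (ellipsoid (A x) x (r x) \ M) ≤
      (5 ^ Module.finrank ℝ E + 1 : ℕ) * μ (O \ M) := by
  refine ENNReal.summable.tsum_le_of_sum_le fun S => ?_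
  refine (sum_measure_le_mul_measure_biUnion
    (V := fun x : T => ellipsoid (A x) (x : E) (r x) \ M) (K := 5 ^ Module.finrank ℝ E + 1)
    (fun x => (isClosed_ellipsoid _ _ _).measurableSet.diff hM) fun z P _ hz => ?_).trans ?_
  · rw [← Finset.card_map (Function.Embedding.subtype _)]
    refine card_le_of_mem_ellipsoid (A := A) (r := r) (z := z)
      (Finset.forall_mem_map.2 fun x _ => hA x x.2) (Finset.forall_mem_map.2 fun x _ => hr x x.2)
      (Finset.forall_mem_map.2 fun x hx => (hz x hx).1) (hT.mono fun x hx => ?_)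
    obtain ⟨y, -, rfl⟩ := Finset.mem_map.1 hx
    exact y.2
  · gcongr
    exact Set.iUnion₂_subset fun x _ => Set.sdiff_subset_sdiff_left (hO x x.2)

theorem measure_le_of_frequently_ellipsoid {A : E → E →L[ℝ] E} {Z M O : Set E} {ε : ℝ≥0∞}
    (hA : ∀ x ∈ Z, ‖A x - 1‖ ≤ 1 / 100) (hM : MeasurableSet M) (hO : IsOpen O) (hZO : Z ⊆ O)
    (hε : ε ≠ 0) (hε' : ε ≠ ∞)
    (hbad : ∀ x ∈ Z, ∀ ρ > 0, ∃ s, 0 < s ∧ s < ρ ∧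
      ε * μ (ellipsoid (A x) x s) ≤ μ (ellipsoid (A x) x s \ M)) :
    μ Z ≤ ε⁻¹ * (5 ^ Module.finrank ℝ E + 1 : ℕ) * μ (O \ M) := by
  have exists_size (x : E) : ∃ s : ℝ, x ∈ Z → (0 < s ∧ s ≤ 1) ∧ ellipsoid (A x) x s ⊆ O ∧
      ε * μ (ellipsoid (A x) x s) ≤ μ (ellipsoid (A x) x s \ M) := by
    by_cases hx : x ∈ Z
    · obtain ⟨ρ, hρ, hball⟩ := Metric.isOpen_iff.1 hO x (hZO hx)
      obtain ⟨s, hs, hsmin, hsbad⟩ := hbad x hx (min 1 (ρ / 2)) (by positivity)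
      obtain ⟨hs1, hsρ⟩ := lt_min_iff.1 hsmin
      refine ⟨s, fun _ => ⟨⟨hs, hs1.le⟩, fun z hz => hball ?_, hsbad⟩⟩
      rw [mem_ball_iff_norm]
      linarith [norm_le_of_mem_ellipsoid (hA x hx) hz]
    · exact ⟨0, fun h => absurd h hx⟩
  choose r hr using exists_size
  obtain ⟨T, hTZ, hcover, hT⟩ := exists_isGreedySelection
    (U := fun x => ellipsoid (A x) x (r x)) (fun x hx => (hr x hx).1)
    (fun x hx => by simpa [ellipsoid] using (hr x hx).1.1.le) (q := 100 / 101) (by norm_num)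
    (by norm_num)
  have hTA : ∀ x ∈ T, ‖A x - 1‖ ≤ 1 / 100 := fun x hx => hA x (hTZ hx)
  have hTr : ∀ x ∈ T, 0 < r x := fun x hx => (hr x (hTZ hx)).1.1
  calc μ Z ≤ μ (⋃ x ∈ T, ellipsoid (A x) x (r x)) := measure_mono hcover
    _ ≤ ∑' x : T, μ (ellipsoid (A x) x (r x)) := measure_biUnion_le μ (hT.countable hTA hTr) _
    _ ≤ ∑' x : T, ε⁻¹ * μ (ellipsoid (A x) x (r x) \ M) := by
        refine ENNReal.tsum_le_tsum fun x => ?_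
        rw [← ENNReal.div_eq_inv_mul, ENNReal.le_div_iff_mul_le (Or.inl hε) (Or.inl hε'), mul_comm]
        exact (hr x (hTZ x.2)).2.2
    _ = ε⁻¹ * ∑' x : T, μ (ellipsoid (A x) x (r x) \ M) := ENNReal.tsum_mul_left
    _ ≤ ε⁻¹ * ((5 ^ Module.finrank ℝ E + 1 : ℕ) * μ (O \ M)) := by
        gcongr
        exact hT.tsum_measure_sdiff_le hTA hTr hM fun x hx => (hr x (hTZ hx)).2.1
    _ = _ := (mul_assoc _ _ _).symm

theorem measure_eq_zero_of_frequently_ellipsoid [IsFiniteMeasure μ] {A : E → E →L[ℝ] E}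
    {Z M : Set E} {ε : ℝ≥0∞} (hA : ∀ x ∈ Z, ‖A x - 1‖ ≤ 1 / 100) (hM : MeasurableSet M)
    (hZM : Z ⊆ M) (hε : ε ≠ 0) (hε' : ε ≠ ∞)
    (hbad : ∀ x ∈ Z, ∀ ρ > 0, ∃ s, 0 < s ∧ s < ρ ∧
      ε * μ (ellipsoid (A x) x s) ≤ μ (ellipsoid (A x) x s \ M)) : μ Z = 0 := by
  have hK : ε⁻¹ * (5 ^ Module.finrank ℝ E + 1 : ℕ) ≠ ∞ :=
    ENNReal.mul_ne_top (ENNReal.inv_ne_top.2 hε) (ENNReal.natCast_ne_top _)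
  have hlim := (ENNReal.continuous_const_mul hK).tendsto 0
  rw [mul_zero] at hlim
  refine le_antisymm (ge_of_tendsto (hlim.mono_left nhdsWithin_le_nhds)
    (eventually_mem_nhdsWithin (s := Set.Ioi 0) |>.mono fun η (hη : 0 < η) => ?_)) zero_le
  obtain ⟨O, hMO, hO, -, hη⟩ := hM.exists_isOpen_sdiff_lt (measure_ne_top μ _) hη.ne'
  exact (measure_le_of_frequently_ellipsoid hA hM hO (hZM.trans hMO) hε hε' hbad).trans (by gcongr)

theorem measure_eq_zero_of_frequently_ellipsoid_of_norm_mul_inv_sub_one_le [IsFiniteMeasure μ]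
    {A : E → E →L[ℝ] E} {Z M : Set E} {ε : ℝ≥0∞} (Q : (E →L[ℝ] E)ˣ)
    (hA : ∀ x ∈ Z, ‖A x * (Q⁻¹ : (E →L[ℝ] E)ˣ) - 1‖ ≤ 1 / 100) (hM : MeasurableSet M) (hZM : Z ⊆ M)
    (hε : ε ≠ 0) (hε' : ε ≠ ∞)
    (hbad : ∀ x ∈ Z, ∀ ρ > 0, ∃ s, 0 < s ∧ s < ρ ∧
      ε * μ (ellipsoid (A x) x s) ≤ μ (ellipsoid (A x) x s \ M)) : μ Z = 0 := by
  let e : E ≃ᵐ E := (ContinuousLinearEquiv.unitsEquiv ℝ E Q).toHomeomorph.toMeasurableEquiv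
  have preimage_ellipsoid (x : E) (s : ℝ) :
      e ⁻¹' ellipsoid (A (e.symm (e x)) * (Q⁻¹ : (E →L[ℝ] E)ˣ)) (e x) s = ellipsoid (A x) x s := by
    rw [e.symm_apply_apply]
    exact preimage_ellipsoid_mul_inv Q (A x) x s
  have himage : (μ.map e) (e '' Z) = 0 := by
    refine measure_eq_zero_of_frequently_ellipsoid
      (A := fun y => A (e.symm y) * (Q⁻¹ : (E →L[ℝ] E)ˣ)) ?_ (e.symm.measurable hM) ?_ hε hε' ?_
    · rintro _ ⟨x, hx, rfl⟩
      rw [e.symm_apply_apply]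
      exact hA x hx
    · rintro _ ⟨x, hx, rfl⟩
      rw [Set.mem_preimage, e.symm_apply_apply]
      exact hZM hx
    · rintro _ ⟨x, hx, rfl⟩ ρ hρ
      obtain ⟨s, hs, hsρ, hsbad⟩ := hbad x hx ρ hρ
      refine ⟨s, hs, hsρ, ?_⟩
      have hM_preimage : e ⁻¹' (e.symm ⁻¹' M) = M := by
        rw [← Set.preimage_comp, e.symm_comp_self, Set.preimage_id]
      rwa [e.map_apply, e.map_apply, Set.preimage_sdiff, preimage_ellipsoid, hM_preimage]
  rwa [e.map_apply, e.injective.preimage_image] at himage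

theorem ae_exists_forall_lt_measure_ellipsoid_sdiff_lt (μ : Measure E) [IsFiniteMeasure μ]
    (B : E → (E →L[ℝ] E)ˣ) {M : Set E} (hM : MeasurableSet M) {ε : ℝ≥0∞} (hε : ε ≠ 0)
    (hε' : ε ≠ ∞) :
    ∀ᵐ x ∂μ, x ∈ M → ∃ ρ > 0, ∀ s, 0 < s → s < ρ →
      μ (ellipsoid (B x : E →L[ℝ] E) x s \ M) < ε * μ (ellipsoid (B x : E →L[ℝ] E) x s) := by
  obtain ⟨Q, hQ⟩ := exists_seq_units_forall_norm_mul_inv_sub_one_lt E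
  let bad (i : ℕ) : Set E := {x | x ∈ M ∧ ‖(B x * (Q i)⁻¹ : E →L[ℝ] E) - 1‖ ≤ 1 / 100 ∧
    ∀ ρ > 0, ∃ s, 0 < s ∧ s < ρ ∧ ε * μ (ellipsoid (B x : E →L[ℝ] E) x s) ≤
      μ (ellipsoid (B x : E →L[ℝ] E) x s \ M)}
  have hbad (i : ℕ) : μ (bad i) = 0 :=
    measure_eq_zero_of_frequently_ellipsoid_of_norm_mul_inv_sub_one_le (Q i)
      (fun x hx => hx.2.1) hM (fun x hx => hx.1) hε hε' fun x hx => hx.2.2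
  filter_upwards [ae_all_iff.2 fun i => measure_eq_zero_iff_ae_notMem.1 (hbad i)] with x hx hxM
  obtain ⟨i, hi⟩ := hQ (B x) (by norm_num : (0 : ℝ) < 1 / 100)
  by_contra! hx_bad
  exact hx i ⟨hxM, hi.le, hx_bad⟩

theorem ae_exists_forall_lt_measureReal_inter_ellipsoid_le (μ : Measure E) [IsFiniteMeasure μ]
    (B : E → (E →L[ℝ] E)ˣ) (F : Set E) {ε : ℝ} (hε : 0 < ε) :
    ∀ᵐ x ∂μ, x ∈ F → ∃ ρ > 0, ∀ s, 0 < s → s < ρ → ∀ V, MeasurableSet V → Disjoint V F →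
      μ.real (V ∩ ellipsoid (B x : E →L[ℝ] E) x s) ≤
        ε * μ.real (ellipsoid (B x : E →L[ℝ] E) x s) := by
  filter_upwards [ae_exists_forall_lt_measure_ellipsoid_sdiff_lt μ B
    (measurableSet_toMeasurable μ F) (ENNReal.ofReal_pos.2 hε).ne' ENNReal.ofReal_ne_top]
    with x hx hxF
  obtain ⟨ρ, hρ, hdensity⟩ := hx (subset_toMeasurable μ F hxF)
  refine ⟨ρ, hρ, fun s hs hsρ V hV hVF => ?_⟩
  set U := ellipsoid (B x : E →L[ℝ] E) x s
  have hnull : μ (toMeasurable μ F ∩ V) = 0 := by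
    rw [Measure.measure_toMeasurable_inter hV (measure_ne_top μ F), hVF.symm.inter_eq,
      measure_empty]
  have hVU : μ (V ∩ U) ≤ μ (U \ toMeasurable μ F) := by
    refine (measure_mono fun z hz => ?_).trans ((measure_union_le _ _).trans_eq
      ((congrArg (· + μ (U \ toMeasurable μ F)) hnull).trans (zero_add _)))
    by_cases hzF : z ∈ toMeasurable μ F
    · exact Or.inl ⟨hzF, hz.1⟩
    · exact Or.inr ⟨hz.2, hzF⟩
  have := ENNReal.toReal_mono (ENNReal.mul_ne_top ENNReal.ofReal_ne_top (measure_ne_top μ U))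
    (hVU.trans (hdensity s hs hsρ).le)
  rwa [ENNReal.toReal_mul, ENNReal.toReal_ofReal hε.le] at this

end Density

section Nested

variable {α ι : Type*}

/-- The set obtained from `S` by successive refinements with the parameters in a list, the last of
which comes first; the `k`-th refinement with the parameter `i` takes `G` to `refine k i G`. -/
def iteratedRefinement (refine : ℕ → ι → Set α → Set α) (S : Set α) : List ι → Set α
  | [] => S
  | i :: σ => refine σ.length i (iteratedRefinement refine S σ)

theorem exists_seq_refinement {refine : ℕ → ι → Set α → Set α} {S : Set α} {a : α} (ha : a ∈ S)
    (h : ∀ σ, a ∈ iteratedRefinement refine S σ →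
      ∃ i, a ∈ iteratedRefinement refine S (i :: σ)) :
    ∃ (G : ℕ → Set α) (i : ℕ → ι), G 0 = S ∧ (∀ k, a ∈ G k) ∧
      ∀ k, G (k + 1) = refine k (i k) (G k) := by
  have : Nonempty ι := ⟨(h [] ha).choose⟩
  choose! next hnext using h
  let σ (k : ℕ) : List ι := Nat.rec [] (fun _ s => next s :: s) k
  have length_σ (k : ℕ) : (σ k).length = k := by
    induction k with
    | zero => rfl
    | succ k ih => exact congrArg (· + 1) ih
  refine ⟨fun k => iteratedRefinement refine S (σ k), fun k => next (σ k), rfl, fun k => ?_,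
    fun k => ?_⟩
  · induction k with
    | zero => exact ha
    | succ k ih => exact hnext _ ih
  · change refine (σ k).length _ _ = _
    rw [length_σ]

theorem ae_exists_seq_refinement [MeasurableSpace α] {μ : Measure α} [Countable ι]
    {refine : ℕ → ι → Set α → Set α} (h : ∀ k G, ∀ᵐ a ∂μ, a ∈ G → ∃ i, a ∈ refine k i G)
    (S : Set α) :
    ∀ᵐ a ∂μ, a ∈ S → ∃ (G : ℕ → Set α) (i : ℕ → ι), G 0 = S ∧ (∀ k, a ∈ G k) ∧
      ∀ k, G (k + 1) = refine k (i k) (G k) := by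
  have hrefine : ∀ᵐ a ∂μ, ∀ σ : List ι, a ∈ iteratedRefinement refine S σ →
      ∃ i, a ∈ iteratedRefinement refine S (i :: σ) := ae_all_iff.2 fun σ => h σ.length _
  filter_upwards [hrefine] with a hrefine haS
  exact exists_seq_refinement haS hrefine

end Nested

section Cells

theorem norm_mul_inv_sub_one_le {R : Type*} [NormedRing R] (u v q : Rˣ) {δ : ℝ}
    (hδ : δ ≤ 1) (hu : ‖(u * q⁻¹ : R) - 1‖ ≤ δ / 4) (hv : ‖(v * q⁻¹ : R) - 1‖ ≤ δ / 4) :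
    ‖(u * v⁻¹ : R) - 1‖ ≤ δ := by
  set w : R := (u * v⁻¹ : R) - 1 with hw
  have hcancel : (u * v⁻¹ : R) * (v * q⁻¹ : R) = u * q⁻¹ := by
    rw [mul_assoc, Units.inv_mul_cancel_left]
  have hw_eq : w = (u * q⁻¹ - 1) - (v * q⁻¹ - 1) - w * (v * q⁻¹ - 1) := by
    rw [mul_sub w, hw, sub_mul, hcancel]; noncomm_ring
  have hw_le : ‖w‖ ≤ δ / 4 + δ / 4 + ‖w‖ * (δ / 4) := by
    calc ‖w‖ = ‖((u * q⁻¹ : R) - 1) - (v * q⁻¹ - 1) - w * (v * q⁻¹ - 1)‖ := by rw [← hw_eq]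
      _ ≤ ‖(u * q⁻¹ : R) - 1‖ + ‖(v * q⁻¹ : R) - 1‖ + ‖w * (v * q⁻¹ - 1)‖ :=
          (norm_sub_le _ _).trans (add_le_add_left (norm_sub_le _ _) _)
      _ ≤ δ / 4 + δ / 4 + ‖w‖ * (δ / 4) := by
          gcongr
          exact (norm_mul_le _ _).trans (by gcongr)
  nlinarith [norm_nonneg w]

variable {n m : ℕ}

theorem mul_inv_apply_sub (B : Euc n →L[ℝ] Euc n) (D : (Euc n →L[ℝ] Euc n)ˣ) (a y z : Euc n) :
    (B * (D⁻¹ : (Euc n →L[ℝ] Euc n)ˣ))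
      ((D : Euc n →L[ℝ] Euc n) (z - a) - (D : Euc n →L[ℝ] Euc n) (y - a)) = B (z - y) := by
  rw [← map_sub, sub_sub_sub_cancel_right, ← mul_apply_eq_comp, mul_assoc, Units.inv_mul, mul_one]

theorem preimage_ellipsoid_affine (B : Euc n →L[ℝ] Euc n) (D : (Euc n →L[ℝ] Euc n)ˣ)
    (a y : Euc n) (s : ℝ) :
    (fun z => (D : Euc n →L[ℝ] Euc n) (z - a)) ⁻¹'
        ellipsoid (B * (D⁻¹ : (Euc n →L[ℝ] Euc n)ˣ)) ((D : Euc n →L[ℝ] Euc n) (y - a)) s =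
      ellipsoid B y s := by
  simp only [ellipsoid, Set.preimage_ofPred_eq, mul_inv_apply_sub]

theorem ellTrunc_map_affine (μ : Measure (Euc n)) (B : Euc n →L[ℝ] Euc n)
    (D : (Euc n →L[ℝ] Euc n)ˣ) (a y : Euc n) (s : ℝ) :
    ellTrunc m (μ.map fun z => (D : Euc n →L[ℝ] Euc n) (z - a))
        (B * (D⁻¹ : (Euc n →L[ℝ] Euc n)ˣ)) ((D : Euc n →L[ℝ] Euc n) (y - a)) s =
      ellTrunc m μ B y s := by
  have hmeas (b : Euc n) : Measurable fun z =>
      rieszKernel m ((B * (D⁻¹ : (Euc n →L[ℝ] Euc n)ˣ)) (z - b)) :=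
    (measurable_rieszKernel m).comp (by fun_prop)
  rw [ellTrunc, setIntegral_map (measurableSet_le (by fun_prop) (by fun_prop))
    (hmeas _).aestronglyMeasurable (by fun_prop)]
  simp only [Set.preimage_ofPred_eq, mul_inv_apply_sub, ellTrunc]

theorem measureReal_closedBall_le_map_affine (μ : Measure (Euc n)) [IsFiniteMeasure μ]
    (D : Euc n →L[ℝ] Euc n) (a y : Euc n) (r : ℝ) :
    μ.real (Metric.closedBall y (r / (‖D‖ + 1))) ≤
      (μ.map fun z => D (z - a)).real (Metric.closedBall (D (y - a)) r) := by
  rw [map_measureReal_apply (by fun_prop) measurableSet_closedBall]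
  refine measureReal_mono fun z hz => ?_
  rw [mem_closedBall_iff_norm] at hz
  rw [Set.mem_preimage, mem_closedBall_iff_norm, ← map_sub, sub_sub_sub_cancel_right]
  calc ‖D (z - y)‖ ≤ ‖D‖ * ‖z - y‖ := D.le_opNorm _
    _ ≤ (‖D‖ + 1) * (r / (‖D‖ + 1)) :=
        mul_le_mul (by linarith) hz (norm_nonneg _) (by positivity)
    _ = r := by field_simp

/-- The points of `G` whose shape is close to `q`, up to the tolerance `δ`, whose truncated Riesz
transforms oscillate by at most `δ` below the scale `ρ`, and at which the complement of `G` has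
density at most `δ` along ellipsoids below that scale. -/
def subcell (m : ℕ) (μ : Measure (Euc n)) (B : Euc n → (Euc n →L[ℝ] Euc n)ˣ)
    (q : (Euc n →L[ℝ] Euc n)ˣ) (δ ρ : ℝ) (G : Set (Euc n)) : Set (Euc n) :=
  {b | b ∈ G ∧ ‖(B b * q⁻¹ : Euc n →L[ℝ] Euc n) - 1‖ ≤ δ / 4 ∧
    (∀ s t : ℝ, 0 < s → s < ρ → 0 < t → t < ρ →
      ‖ellTrunc m μ (B b) b s - ellTrunc m μ (B b) b t‖ ≤ δ) ∧
    ∀ s : ℝ, 0 < s → s < ρ → ∀ V, MeasurableSet V → Disjoint V G →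
      μ.real (V ∩ ellipsoid (B b : Euc n →L[ℝ] Euc n) b s) ≤
        δ * μ.real (ellipsoid (B b : Euc n →L[ℝ] Euc n) b s)}

/-- The points at which the lower bound of the `m`-density holds with constant and scale
`1 / (l + 1)`. -/
def lowerRegularSet (m : ℕ) (μ : Measure (Euc n)) (l : ℕ) : Set (Euc n) :=
  {b | ∀ r : ℝ, 0 < r → r < 1 / (l + 1) → r ^ m ≤ (l + 1) * μ.real (Metric.closedBall b r)}

variable {μ : Measure (Euc n)} {B : Euc n → (Euc n →L[ℝ] Euc n)ˣ}

theorem mul_pow_le_map_affine_of_mem_lowerRegularSet [IsFiniteMeasure μ] {l : ℕ} {y : Euc n}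
    (hy : y ∈ lowerRegularSet m μ l) (D : Euc n →L[ℝ] Euc n) (a : Euc n) {r : ℝ} (hr : 0 < r)
    (hrl : r < 1 / (l + 1)) :
    1 / ((l + 1) * (‖D‖ + 1) ^ m) * r ^ m ≤
      (μ.map fun z => D (z - a)).real (Metric.closedBall (D (y - a)) r) := by
  have hdiv : r / (‖D‖ + 1) ≤ r := div_le_self hr.le (by linarith [norm_nonneg D])
  calc 1 / ((l + 1) * (‖D‖ + 1) ^ m) * r ^ m = (r / (‖D‖ + 1)) ^ m / (l + 1) := by
        rw [div_pow]; field_simp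
    _ ≤ μ.real (Metric.closedBall y (r / (‖D‖ + 1))) :=
        (div_le_iff₀' (by positivity)).2 (hy _ (by positivity) (hdiv.trans_lt hrl))
    _ ≤ _ := measureReal_closedBall_le_map_affine μ D a y r

theorem ae_exists_mem_subcell [IsFiniteMeasure μ] {Q : ℕ → (Euc n →L[ℝ] Euc n)ˣ}
    (hQ : ∀ (B : (Euc n →L[ℝ] Euc n)ˣ) {δ : ℝ}, 0 < δ →
      ∃ i, ‖(B * (Q i)⁻¹ : Euc n →L[ℝ] Euc n) - 1‖ < δ)
    (hosc : ∀ᵐ a ∂μ, ∀ ε > 0, ∃ ρ > 0, ∀ s t : ℝ, 0 < s → s < ρ → 0 < t → t < ρ →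
      ‖ellTrunc m μ (B a) a s - ellTrunc m μ (B a) a t‖ ≤ ε) {δ : ℝ} (hδ : 0 < δ)
    (G : Set (Euc n)) :
    ∀ᵐ a ∂μ, a ∈ G → ∃ p : ℕ × ℕ, a ∈ subcell m μ B (Q p.1) δ (1 / (p.2 + 1)) G := by
  filter_upwards [hosc, ae_exists_forall_lt_measureReal_inter_ellipsoid_le μ B G hδ]
    with a hosc hdensity haG
  obtain ⟨ρ₁, hρ₁, hosc⟩ := hosc δ hδ
  obtain ⟨ρ₂, hρ₂, hdensity⟩ := hdensity haG
  obtain ⟨i, hi⟩ := hQ (B a) (by positivity : 0 < δ / 4)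
  obtain ⟨l, hl⟩ := exists_nat_one_div_lt (lt_min hρ₁ hρ₂)
  obtain ⟨hl₁, hl₂⟩ := lt_min_iff.1 hl
  exact ⟨(i, l), haG, hi.le, fun s t hs hs' ht ht' =>
    hosc s t hs (hs'.trans hl₁) ht (ht'.trans hl₁), fun s hs hs' => hdensity s hs (hs'.trans hl₂)⟩

theorem exists_centerSequence_of_subcells [IsFiniteMeasure μ] {l₀ : ℕ} {a : Euc n}
    {G : ℕ → Set (Euc n)} {q : ℕ → (Euc n →L[ℝ] Euc n)ˣ} {ρ : ℕ → ℝ} (hρ : ∀ k, 0 < ρ k)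
    (hG0 : G 0 = lowerRegularSet m μ l₀) (ha : ∀ k, a ∈ G k)
    (hG : ∀ k, G (k + 1) = subcell m μ B (q k) (1 / (k + 1)) (ρ k) (G k)) :
    ∃ F A c ρ, CenterSequence m (μ.map fun z => (B a : Euc n →L[ℝ] Euc n) (z - a)) F A c ρ := by
  set D : Euc n →L[ℝ] Euc n := (B a : Euc n →L[ℝ] Euc n) with hD
  let φ (z : Euc n) : Euc n := D (z - a)
  let ψ (b : Euc n) : Euc n := a + ((B a)⁻¹ : (Euc n →L[ℝ] Euc n)ˣ).val b
  have hψφ (y : Euc n) : ψ (φ y) = y := by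
    simp only [ψ, φ, hD, ← mul_apply_eq_comp, Units.inv_mul, one_apply_eq_self, add_sub_cancel]
  have hφ : Measurable φ := by fun_prop
  have hφa : φ a = 0 := by simp [φ]
  let A (b : Euc n) : Euc n →L[ℝ] Euc n := B (ψ b) * (B a)⁻¹
  have hAφ (y : Euc n) : A (φ y) = (B y * (B a)⁻¹ : Euc n →L[ℝ] Euc n) := by
    simp only [A, hψφ]
  have hanti : Antitone G := antitone_nat_of_succ_le fun k => by
    rw [hG]; exact fun b hb => hb.1
  have hmem {k : ℕ} {y : Euc n} (hy : y ∈ G (k + 1)) :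
      y ∈ subcell m μ B (q k) (1 / (k + 1)) (ρ k) (G k) := hG k ▸ hy
  refine ⟨fun j => φ '' G (j + 1), A, 1 / ((l₀ + 1) * (‖D‖ + 1) ^ m),
    fun j => min (ρ j) (1 / (l₀ + 1)), ?_, ?_, ?_, ?_, ?_, ?_, ?_, ?_, ?_⟩
  · exact fun j k hjk => Set.image_mono (hanti (Nat.succ_le_succ hjk))
  · exact fun j => ⟨a, ha _, hφa⟩
  · rw [← hφa, hAφ, Units.mul_inv]
  · positivity
  · exact fun j => lt_min (hρ j) (by positivity)
  · rintro j _ ⟨y, hy, rfl⟩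
    rw [hAφ]
    exact norm_mul_inv_sub_one_le (B y) (B a) (q j) (by rw [div_le_one₀] <;> linarith)
      (hmem hy).2.1 (hmem (ha (j + 1))).2.1
  · rintro j _ ⟨y, hy, rfl⟩ s t hs hs' ht ht'
    rw [hAφ, ellTrunc_map_affine, ellTrunc_map_affine]
    exact (hmem hy).2.2.1 s t hs (lt_min_iff.1 hs').1 ht (lt_min_iff.1 ht').1
  · rintro j _ ⟨y, hy, rfl⟩ r hr hr'
    exact mul_pow_le_map_affine_of_mem_lowerRegularSet (hG0 ▸ hanti (Nat.zero_le _) hy) D a hr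
      (lt_min_iff.1 hr').2
  · rintro j _ ⟨y, hy, rfl⟩ s hs hs' V hV hVF
    have hell := (isClosed_ellipsoid (A (φ y)) (φ y) s).measurableSet
    rw [map_measureReal_apply hφ (hV.inter hell), map_measureReal_apply hφ hell,
      Set.preimage_inter, hAφ, preimage_ellipsoid_affine]
    refine ((hmem hy).2.2.2 s hs (lt_min_iff.1 hs').1 _ (hφ hV)
      (Set.disjoint_image_right.1 hVF)).trans ?_
    gcongr
    linarith

theorem ae_exists_centerSequence [IsFiniteMeasure μ]
    (hlower : ∀ᵐ a ∂μ, ∃ l, a ∈ lowerRegularSet m μ l)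
    (hosc : ∀ᵐ a ∂μ, ∀ ε > 0, ∃ ρ > 0, ∀ s t : ℝ, 0 < s → s < ρ → 0 < t → t < ρ →
      ‖ellTrunc m μ (B a) a s - ellTrunc m μ (B a) a t‖ ≤ ε) :
    ∀ᵐ a ∂μ, ∃ F A c ρ,
      CenterSequence m (μ.map fun z => (B a : Euc n →L[ℝ] Euc n) (z - a)) F A c ρ := by
  obtain ⟨Q, hQ⟩ := exists_seq_units_forall_norm_mul_inv_sub_one_lt (Euc n)
  let nextCell (k : ℕ) (p : ℕ × ℕ) : Set (Euc n) → Set (Euc n) :=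
    subcell m μ B (Q p.1) (1 / (k + 1)) (1 / (p.2 + 1))
  have hnext (k : ℕ) (G : Set (Euc n)) : ∀ᵐ a ∂μ, a ∈ G → ∃ p, a ∈ nextCell k p G :=
    ae_exists_mem_subcell hQ hosc (by positivity) G
  have hnested (l : ℕ) := ae_exists_seq_refinement hnext (lowerRegularSet m μ l)
  filter_upwards [hlower, ae_all_iff.2 hnested] with a ⟨l₀, hl₀⟩ hnested
  obtain ⟨G, p, hG0, ha, hG⟩ := hnested l₀ hl₀
  exact exists_centerSequence_of_subcells (fun k => by positivity) hG0 ha hG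

end Cells

section BlowUp

variable {n m : ℕ} {ν : Measure (Euc n)}

namespace WeakStarTendsto

variable {σ : ℕ → Measure (Euc n)} [∀ i, IsLocallyFiniteMeasure (σ i)]

theorem exists_eventually_measureReal_closedBall_le (h : WeakStarTendsto σ ν) (x : Euc n) (R : ℝ) :
    ∃ M > 0, ∀ᶠ i in atTop, (σ i).real (Metric.closedBall x R) ≤ M := by
  let f : ContDiffBump x := ⟨|R| + 1, |R| + 2, by positivity, by linarith⟩
  have hlim := h f f.continuous f.hasCompactSupport
  refine ⟨∫ y, f y ∂ν + 1, ?_, ?_⟩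
  · have hf : 0 ≤ ∫ y, f y ∂ν := integral_nonneg fun y => f.nonneg
    positivity
  · filter_upwards [hlim.eventually_le_const (lt_add_one _)] with i hi
    have hsub : Metric.closedBall x R ⊆ Metric.closedBall x f.rIn :=
      Metric.closedBall_subset_closedBall ((le_abs_self R).trans (lt_add_one _).le)
    exact (measureReal_mono hsub measure_closedBall_lt_top.ne).trans
      ((f.measure_closedBall_le_integral (σ i)).trans hi)

variable [IsLocallyFiniteMeasure ν]

theorem exists_eventually_le_measureReal_closedBall (h : WeakStarTendsto σ ν) {x : Euc n}
    {δ η : ℝ} (hδ : 0 < δ) (hδη : δ < η) (hx : ν (Metric.closedBall x δ) ≠ 0) :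
    ∃ κ > 0, ∀ᶠ i in atTop, κ ≤ (σ i).real (Metric.closedBall x η) := by
  let f : ContDiffBump x := ⟨δ, η, hδ, hδη⟩
  have hpos : 0 < ν.real (Metric.closedBall x δ) :=
    ENNReal.toReal_pos hx measure_closedBall_lt_top.ne
  have hf : 0 < ∫ y, f y ∂ν := hpos.trans_le (f.measure_closedBall_le_integral ν)
  refine ⟨(∫ y, f y ∂ν) / 2, half_pos hf, ?_⟩
  filter_upwards [(h f f.continuous f.hasCompactSupport).eventually_const_le (half_lt_self hf)]
    with i hi
  exact hi.trans (f.integral_le_measure_closedBall (σ i))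

theorem measure_closedBall_pos_of_eventually_le (h : WeakStarTendsto σ ν) {x : Euc n}
    {δ η κ : ℝ} (hδ : 0 < δ) (hδη : δ < η) (hκ : 0 < κ)
    (hx : ∀ᶠ i in atTop, κ ≤ (σ i).real (Metric.closedBall x δ)) :
    0 < ν (Metric.closedBall x η) := by
  let f : ContDiffBump x := ⟨δ, η, hδ, hδη⟩
  have hκf : κ ≤ ∫ y, f y ∂ν := by
    refine ge_of_tendsto (h f f.continuous f.hasCompactSupport) ?_
    filter_upwards [hx] with i hi
    exact hi.trans (f.measure_closedBall_le_integral (σ i))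
  have hreal : 0 < ν.real (Metric.closedBall x η) :=
    hκ.trans_le (hκf.trans (f.integral_le_measure_closedBall ν))
  exact (ENNReal.toReal_pos_iff.1 hreal).1

theorem integral_eq_zero (h : WeakStarTendsto σ ν) {g : Euc n → Euc n} (hg : Continuous g)
    (hgs : HasCompactSupport g) (hlim : Tendsto (fun i => ∫ y, g y ∂σ i) atTop (𝓝 0)) :
    ∫ y, g y ∂ν = 0 := by
  refine ext_inner_left ℝ fun e => ?_
  have hinner (τ : Measure (Euc n)) [IsLocallyFiniteMeasure τ] :
      ∫ y, inner ℝ e (g y) ∂τ = inner ℝ e (∫ y, g y ∂τ) :=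
    integral_inner (hg.integrable_of_hasCompactSupport hgs) e
  have hweak := h (fun y => inner ℝ e (g y)) (by fun_prop)
    (hgs.comp_left (g := fun v => inner ℝ e v) (inner_zero_right e))
  have hlim_inner := (tendsto_const_nhds (x := e)).inner (𝕜 := ℝ) hlim
  simp only [hinner] at hweak
  exact tendsto_nhds_unique hweak hlim_inner

end WeakStarTendsto

/-- The blow-up of `μ` at the origin by the factor `r⁻¹`, normalized by `c`. -/
noncomputable def blowUp (μ : Measure (Euc n)) (c r : ℝ) : Measure (Euc n) :=
  ENNReal.ofReal c • μ.map (r⁻¹ • ·)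

/-- `ν` is the weak-* limit of the blow-ups of `μ` at the origin by the factors `(r i)⁻¹`,
normalized by `c i`. -/
structure IsBlowUpLimit (μ ν : Measure (Euc n)) (c r : ℕ → ℝ) : Prop where
  c_pos : ∀ i, 0 < c i
  r_pos : ∀ i, 0 < r i
  r_tendsto : Tendsto r atTop (𝓝 0)
  weakStarTendsto : WeakStarTendsto (fun i => blowUp μ (c i) (r i)) ν

variable {μ : Measure (Euc n)} {c r : ℕ → ℝ}

instance [IsFiniteMeasure μ] (c r : ℝ) : IsFiniteMeasure (blowUp μ c r) :=
  Measure.smul_finite _ ENNReal.ofReal_ne_top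

theorem integral_blowUp {E : Type*} [NormedAddCommGroup E] [NormedSpace ℝ E] (μ : Measure (Euc n))
    {c : ℝ} (hc : 0 ≤ c) (r : ℝ) (g : Euc n → E) :
    ∫ z, g z ∂(blowUp μ c r) = c • ∫ z, g z ∂(μ.map (r⁻¹ • ·)) := by
  rw [blowUp, integral_smul_measure, ENNReal.toReal_ofReal hc]

theorem measureReal_blowUp_closedBall (μ : Measure (Euc n)) {c r : ℝ} (hc : 0 ≤ c) (hr : 0 < r)
    (b : Euc n) (t : ℝ) : (blowUp μ c r).real (Metric.closedBall b t) =
      c * μ.real (Metric.closedBall (r • b) (t * r)) := by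
  rw [blowUp, measureReal_ennreal_smul_apply, ENNReal.toReal_ofReal hc,
    measureReal_map_inv_smul_closedBall hr]

theorem CenterSequence.exists_measureReal_closedBall_mul_le [IsFiniteMeasure μ]
    {F : ℕ → Set (Euc n)} {A : Euc n → Euc n →L[ℝ] Euc n} {c : ℝ} {ρ : ℕ → ℝ}
    (H : CenterSequence m μ F A c ρ) {η R : ℝ} (hη : 0 < η) (hR : 0 < R) :
    ∃ C > 0, ∃ ρ > 0, ∀ r, 0 < r → R * r < ρ →
      μ.real (Metric.closedBall 0 (R * r)) ≤ C * μ.real (Metric.closedBall 0 (η * r)) := by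
  obtain ⟨C, hC, ρ, hρ, hdoubling⟩ := H.exists_measure_closedBall_le
  obtain ⟨N, hN⟩ := exists_pow_lt_of_lt_one (div_pos hη hR) (by norm_num : (1 / 4 : ℝ) < 1)
  rw [lt_div_iff₀ hR] at hN
  refine ⟨max C 1 ^ N, by positivity, ρ, hρ, fun r hr hrρ => ?_⟩
  refine le_pow_mul_of_forall_le_mul (g := fun t => μ.real (Metric.closedBall 0 t))
    (fun s t hst => measureReal_mono (Metric.closedBall_subset_closedBall hst))
    (fun t => measureReal_nonneg) (le_max_right C 1) (β := 1 / 4) (by norm_num) (by positivity) N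
    (fun t hat htb => ?_) (by rw [← mul_assoc]; gcongr)
  have ht : 0 < t := lt_of_lt_of_le (by positivity) hat
  calc μ.real (Metric.closedBall 0 t) = μ.real (Metric.closedBall 0 (4 * (1 / 4 * t))) := by
        rw [← mul_assoc]; norm_num
    _ ≤ C * μ.real (Metric.closedBall 0 (1 / 4 * t)) := hdoubling _ (by positivity) (by linarith)
    _ ≤ max C 1 * μ.real (Metric.closedBall 0 (1 / 4 * t)) := by
        gcongr; exact le_max_left C 1

theorem CenterSequence.measureReal_closedBall_le_of_disjoint [IsFiniteMeasure μ]
    {F : ℕ → Set (Euc n)} {A : Euc n → Euc n →L[ℝ] Euc n} {c₀ : ℝ} {ρ : ℕ → ℝ}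
    (H : CenterSequence m μ F A c₀ ρ) (k : ℕ) {x : Euc n} {s t : ℝ} (ht : 0 < t)
    (htρ : t < ρ (k + 1)) (hxt : ‖x‖ + s ≤ t) (hdisj : Disjoint (Metric.closedBall x s) (F k)) :
    μ.real (Metric.closedBall x s) ≤ 1 / (k + 1) * μ.real (Metric.closedBall 0 t) := by
  have hell : ellipsoid (A 0) 0 t = Metric.closedBall 0 t := by
    ext z; simp [ellipsoid, H.shape_zero]
  have hsub : Metric.closedBall x s ⊆ Metric.closedBall 0 t :=
    Metric.closedBall_subset_closedBall' (by rw [dist_zero_right]; linarith)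
  have hdense := H.dense k 0 (H.zero_mem _) t ht htρ _ measurableSet_closedBall hdisj
  rwa [hell, Set.inter_eq_left.2 hsub] at hdense

namespace IsBlowUpLimit

theorem eventually_mul_lt (h : IsBlowUpLimit μ ν c r) (R : ℝ) {ρ : ℝ} (hρ : 0 < ρ) :
    ∀ᶠ i in atTop, R * r i < ρ :=
  (h.r_tendsto.const_mul R).eventually_lt_const (by rwa [mul_zero])

variable [IsFiniteMeasure μ] {F : ℕ → Set (Euc n)} {A : Euc n → Euc n →L[ℝ] Euc n} {c₀ : ℝ}
  {ρ : ℕ → ℝ}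

theorem exists_eventually_mul_pow_le (h : IsBlowUpLimit μ ν c r)
    (H : CenterSequence m μ F A c₀ ρ) : ∃ M > 0, ∀ᶠ i in atTop, c i * r i ^ m ≤ M := by
  obtain ⟨M, hM, hup⟩ := h.weakStarTendsto.exists_eventually_measureReal_closedBall_le 0 1
  have hc₀ := H.c_pos
  refine ⟨M / c₀, by positivity, ?_⟩
  filter_upwards [hup, h.eventually_mul_lt 1 (H.ρ_pos 0)] with i hup hρ
  have hci := h.c_pos i
  rw [measureReal_blowUp_closedBall μ hci.le (h.r_pos i), smul_zero] at hup
  rw [one_mul] at hup hρ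
  rw [le_div_iff₀' hc₀, mul_left_comm]
  refine le_trans ?_ hup
  gcongr
  exact H.low 0 0 (H.zero_mem 0) (r i) (h.r_pos i) hρ

variable [IsLocallyFiniteMeasure ν]

theorem zero_mem_support (h : IsBlowUpLimit μ ν c r) (H : CenterSequence m μ F A c₀ ρ)
    (hν : ν ≠ 0) : (0 : Euc n) ∈ ν.support := by
  refine (Measure.mem_support_iff_forall _).2 fun U hU => ?_
  obtain ⟨η, hη, hball⟩ := Metric.nhds_basis_closedBall.mem_iff.1 hU
  refine lt_of_lt_of_le ?_ (measure_mono hball)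
  obtain ⟨k, hk⟩ : ∃ k : ℕ, ν (Metric.closedBall 0 k) ≠ 0 := by
    by_contra! hzero
    refine hν (Measure.measure_univ_eq_zero.1 ?_)
    rw [← Metric.iUnion_closedBall_nat (0 : Euc n)]
    exact measure_iUnion_null hzero
  obtain ⟨κ, hκ, hlow⟩ := h.weakStarTendsto.exists_eventually_le_measureReal_closedBall
    (by positivity : (0 : ℝ) < k + 1) (by linarith : (k : ℝ) + 1 < k + 2) fun hzero =>
      hk (measure_mono_null (Metric.closedBall_subset_closedBall (by linarith)) hzero)
  obtain ⟨C, hC, ρ, hρ, hdoubling⟩ := H.exists_measureReal_closedBall_mul_le (half_pos hη)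
    (by positivity : (0 : ℝ) < k + 2)
  refine h.weakStarTendsto.measure_closedBall_pos_of_eventually_le (half_pos hη) (half_lt_self hη)
    (by positivity : 0 < κ / C) ?_
  filter_upwards [hlow, h.eventually_mul_lt (k + 2) hρ] with i hi hiρ
  have hri := h.r_pos i
  have hci := h.c_pos i
  rw [measureReal_blowUp_closedBall μ hci.le hri, smul_zero] at hi ⊢
  rw [div_le_iff₀' hC, mul_left_comm]
  refine hi.trans ?_
  gcongr
  exact hdoubling _ hri hiρ

theorem eventually_exists_center (h : IsBlowUpLimit μ ν c r) (H : CenterSequence m μ F A c₀ ρ)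
    {x : Euc n} (hx : x ∈ ν.support) {η : ℝ} (hη : 0 < η) (j : ℕ) :
    ∀ᶠ i in atTop, ∃ b, r i • b ∈ F j ∧ ‖b - x‖ ≤ η := by
  obtain ⟨κ, hκ, hlow⟩ := h.weakStarTendsto.exists_eventually_le_measureReal_closedBall
    (half_pos hη) (half_lt_self hη)
    ((Measure.mem_support_iff_forall x).1 hx _ (Metric.closedBall_mem_nhds x (half_pos hη))).ne'
  set R : ℝ := ‖x‖ + η with hR
  obtain ⟨M, hM, hup⟩ := h.weakStarTendsto.exists_eventually_measureReal_closedBall_le 0 R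
  obtain ⟨J, hJ⟩ := exists_nat_one_div_lt (by positivity : 0 < κ / M)
  set K := max j J with hK
  have hKM : 1 / ((K : ℝ) + 1) * M < κ := by
    rw [lt_div_iff₀ hM] at hJ
    refine lt_of_le_of_lt ?_ hJ
    have : J ≤ K := le_max_right j J
    gcongr
  filter_upwards [hlow, hup, h.eventually_mul_lt R (H.ρ_pos (K + 1))] with i hlow hup hρ
  by_contra! hfar
  have hri := h.r_pos i
  have hci := h.c_pos i
  have hdisj : Disjoint (Metric.closedBall (r i • x) (η * r i)) (F K) := by
    rw [← preimage_inv_smul_closedBall hri, Set.disjoint_left]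
    refine fun z hz hzF => (hfar ((r i)⁻¹ • z) ?_).not_ge (mem_closedBall_iff_norm.1 hz)
    rw [smul_inv_smul₀ hri.ne']
    exact H.antitone (le_max_left j J) hzF
  have hdense := H.measureReal_closedBall_le_of_disjoint K (by positivity : 0 < R * r i) hρ
    (by rw [norm_smul_of_nonneg hri.le, hR]; linarith) hdisj
  rw [measureReal_blowUp_closedBall μ hci.le hri] at hlow hup
  rw [smul_zero] at hup
  refine hKM.not_ge (hlow.trans ?_)
  calc c i * μ.real (Metric.closedBall (r i • x) (η * r i))
    _ ≤ c i * (1 / (K + 1) * μ.real (Metric.closedBall 0 (R * r i))) := by gcongr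
    _ = 1 / (K + 1) * (c i * μ.real (Metric.closedBall 0 (R * r i))) := by ring
    _ ≤ 1 / (K + 1) * M := by gcongr

end IsBlowUpLimit

end BlowUp

section Perturbation

variable {E G : Type*} [NormedAddCommGroup E] [NormedSpace ℝ E] [FiniteDimensional ℝ E]
  [NormedAddCommGroup G]

theorem hasCompactSupport_of_forall_le_norm {g : E → G} {R : ℝ} (hgR : ∀ v, R ≤ ‖v‖ → g v = 0) :
    HasCompactSupport g :=
  have := FiniteDimensional.proper ℝ E
  HasCompactSupport.intro (isCompact_closedBall 0 R) fun v hv =>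
    hgR v (not_le.1 fun hle => hv (mem_closedBall_zero_iff.2 hle)).le

theorem exists_forall_norm_sub_comp_le {g : E → G} (hg : Continuous g) {R : ℝ} (hR : 0 ≤ R)
    (hgR : ∀ v, R ≤ ‖v‖ → g v = 0) (x : E) {ε : ℝ} (hε : 0 < ε) :
    ∃ δ > 0, ∀ (D : E →L[ℝ] E) (b : E), ‖D - 1‖ ≤ δ → ‖b - x‖ ≤ δ → ∀ z,
      ‖g (z - x) - g (D (z - b))‖ ≤
        (Metric.closedBall 0 (2 * R + ‖x‖ + 1)).indicator (fun _ => ε) z := by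
  set R' : ℝ := 2 * R + ‖x‖ + 1
  obtain ⟨δ, hδ, hgδ⟩ := Metric.uniformContinuous_iff.1
    ((hasCompactSupport_of_forall_le_norm hgR).uniformContinuous_of_continuous hg) ε hε
  have hpos : 0 < R' + ‖x‖ + 3 := by positivity
  refine ⟨min (1 / 2) (δ / (R' + ‖x‖ + 3)), by positivity, fun D b hD hb z => ?_⟩
  obtain ⟨hD₁, hD₂⟩ := le_min_iff.1 hD
  obtain ⟨hb₁, hb₂⟩ := le_min_iff.1 hb
  have hb_norm : ‖b‖ ≤ ‖x‖ + 1 := by linarith [norm_le_norm_add_norm_sub' b x]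
  by_cases hz : z ∈ Metric.closedBall 0 R'
  · rw [Set.indicator_of_mem hz, ← dist_eq_norm]
    rw [mem_closedBall_zero_iff] at hz
    have hzb : ‖z - b‖ ≤ R' + ‖x‖ + 1 := by linarith [norm_sub_le z b]
    refine (hgδ ?_).le
    calc dist (z - x) (D (z - b)) = ‖(b - x) - (D - 1) (z - b)‖ := by
          rw [dist_eq_norm, sub_apply, one_apply_eq_self]; congr 1; abel
      _ ≤ ‖b - x‖ + ‖(D - 1) (z - b)‖ := norm_sub_le _ _
      _ ≤ ‖b - x‖ + ‖D - 1‖ * ‖z - b‖ := by gcongr; exact (D - 1).le_opNorm _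
      _ ≤ δ / (R' + ‖x‖ + 3) + δ / (R' + ‖x‖ + 3) * (R' + ‖x‖ + 1) := by gcongr
      _ = δ * ((R' + ‖x‖ + 2) / (R' + ‖x‖ + 3)) := by ring
      _ < δ := mul_lt_of_lt_one_right hδ ((div_lt_one hpos).2 (by linarith))
  · rw [Set.indicator_of_notMem hz]
    rw [mem_closedBall_zero_iff, not_le] at hz
    have hzx : R ≤ ‖z - x‖ := by linarith [norm_sub_norm_le z x]
    have hzb : 2 * R ≤ ‖z - b‖ := by linarith [norm_sub_norm_le z b]
    have hDzb : R ≤ ‖D (z - b)‖ := by linarith [norm_le_two_mul_norm_apply hD₁ (z - b)]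
    rw [hgR _ hzx, hgR _ hDzb, sub_zero, norm_zero]

theorem exists_forall_norm_integral_sub_le [NormedSpace ℝ G] [MeasurableSpace E] [BorelSpace E]
    {g : E → G} (hg : Continuous g) {R : ℝ} (hR : 0 ≤ R) (hgR : ∀ v, R ≤ ‖v‖ → g v = 0) (x : E)
    {ε : ℝ} (hε : 0 < ε) :
    ∃ δ > 0, ∀ (D : E →L[ℝ] E) (b : E), ‖D - 1‖ ≤ δ → ‖b - x‖ ≤ δ →
      ∀ σ : Measure E, [IsFiniteMeasure σ] → ‖∫ z, g (z - x) ∂σ - ∫ z, g (D (z - b)) ∂σ‖ ≤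
        ε * σ.real (Metric.closedBall 0 (2 * R + ‖x‖ + 1)) := by
  obtain ⟨δ, hδ, hclose⟩ := exists_forall_norm_sub_comp_le hg hR hgR x hε
  refine ⟨δ, hδ, fun D b hD hb σ _ => ?_⟩
  obtain ⟨M, hM⟩ := hg.bounded_above_of_compact_support (hasCompactSupport_of_forall_le_norm hgR)
  have hint {φ : E → E} (hφ : Continuous φ) : Integrable (fun z => g (φ z)) σ :=
    .of_bound (hg.comp hφ).aestronglyMeasurable M
      (Eventually.of_forall fun z => hM _)
  rw [← integral_sub (hint (by fun_prop)) (hint (by fun_prop))]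
  refine (norm_integral_le_of_norm_le ((integrable_const ε).indicator measurableSet_closedBall)
    (Eventually.of_forall (hclose D b hD hb))).trans_eq ?_
  rw [integral_indicator_const _ measurableSet_closedBall, smul_eq_mul, mul_comm]

end Perturbation

section RadialCenter

variable {n m : ℕ} {μ ν : Measure (Euc n)} {x : Euc n}

/-- `x` is a radial centre of `ν`: the compactly supported radial fields `f(|z - x|) (z - x)` with
`f` of class `C¹` integrate to zero. This is the symmetry that passes directly to blow-up limits;
the characteristic functions of balls and the truncated Riesz kernels are limits of such fields. -/
def IsRadialCenter (ν : Measure (Euc n)) (x : Euc n) : Prop :=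
  ∀ f : ℝ → ℝ, ContDiff ℝ 1 f → ∀ R > 0, (∀ t ≥ R, f t = 0) →
    ∫ z, f ‖z - x‖ • (z - x) ∂ν = 0

variable {F : ℕ → Set (Euc n)} {A : Euc n → Euc n →L[ℝ] Euc n} {c₀ : ℝ} {ρ c r : ℕ → ℝ}
  [IsFiniteMeasure μ] {f : ℝ → ℝ} {R : ℝ}

theorem CenterSequence.norm_integral_radial_le (H : CenterSequence m μ F A c₀ ρ) {j : ℕ}
    {b : Euc n} {r : ℝ} (hr : 0 < r) (hb : r • b ∈ F j) (hf : ContDiff ℝ 1 f) (hR : 0 < R)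
    (hfR : ∀ t ≥ R, f t = 0) (hRρ : R * r < ρ j) {C : ℝ}
    (hC : ∀ t ∈ Set.Icc 0 R, |(m + 1) * f t + t * deriv f t| ≤ C) :
    ‖∫ z, f ‖A (r • b) (z - b)‖ • A (r • b) (z - b) ∂(μ.map (r⁻¹ • ·))‖ ≤
      C * R ^ (m + 1) * (r ^ m * (1 / (j + 1))) := by
  rw [← setIntegral_eq_integral_of_forall_compl_eq_zero (s := ellipsoid (A (r • b)) b R)
    fun z hz => by rw [hfR _ (not_le.1 hz).le, zero_smul]]
  exact H.norm_setIntegral_radial_le hr hb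
    (fun t => (hf.differentiable one_ne_zero t).hasDerivAt) (hf.continuous_deriv le_rfl) hR
    (hfR R le_rfl) hRρ fun t ht htR => hC t ⟨ht.le, htR⟩

theorem IsBlowUpLimit.tendsto_integral_radial [IsLocallyFiniteMeasure ν]
    (h : IsBlowUpLimit μ ν c r) (H : CenterSequence m μ F A c₀ ρ) (hx : x ∈ ν.support)
    (hf : ContDiff ℝ 1 f) (hR : 0 < R) (hfR : ∀ t ≥ R, f t = 0) :
    Tendsto (fun i => ∫ z, f ‖z - x‖ • (z - x) ∂(blowUp μ (c i) (r i))) atTop (𝓝 0) := by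
  have hf_cont := hf.continuous
  obtain ⟨C, hC⟩ : ∃ C, ∀ t ∈ Set.Icc 0 R, |(m + 1) * f t + t * deriv f t| ≤ C := by
    have hcont : Continuous fun t => (m + 1) * f t + t * deriv f t := by
      have := hf.continuous_deriv le_rfl
      fun_prop
    exact isCompact_Icc.exists_bound_of_continuousOn hcont.continuousOn
  have hC0 : 0 ≤ C := (abs_nonneg _).trans (hC 0 ⟨le_rfl, hR.le⟩)
  obtain ⟨M, -, hball⟩ :=
    h.weakStarTendsto.exists_eventually_measureReal_closedBall_le 0 (2 * R + ‖x‖ + 1)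
  obtain ⟨M', -, hpow⟩ := h.exists_eventually_mul_pow_le H
  set L : ℝ := M + C * R ^ (m + 1) * M' with hL
  refine NormedAddGroup.tendsto_nhds_zero.2 fun ε₀ hε₀ => ?_
  obtain ⟨ε, hε, hεL⟩ : ∃ ε > 0, ε * L < ε₀ :=
    exists_pos_mul_lt hε₀ L |>.imp fun _ h => ⟨h.1, by rw [mul_comm]; exact h.2⟩
  obtain ⟨δ, hδ, hclose⟩ := exists_forall_norm_integral_sub_le (g := fun v : Euc n => f ‖v‖ • v)
    (by fun_prop) hR.le (fun v hv => by rw [hfR _ hv, zero_smul]) x hε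
  obtain ⟨j, hj⟩ := exists_nat_one_div_lt (lt_min hε hδ)
  obtain ⟨hjε, hjδ⟩ := lt_min_iff.1 hj
  filter_upwards [hball, hpow, h.eventually_mul_lt R (H.ρ_pos j),
    h.eventually_exists_center H hx hδ j] with i hball hpow hRρ ⟨b, hbF, hbx⟩
  have hci := h.c_pos i
  have hri := h.r_pos i
  have hdiff := hclose _ b ((H.shape j _ hbF).trans hjδ.le) hbx (blowUp μ (c i) (r i))
  have hcenter : ‖∫ z, f ‖A (r i • b) (z - b)‖ • A (r i • b) (z - b) ∂(blowUp μ (c i) (r i))‖ ≤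
      ε * (C * R ^ (m + 1) * M') := by
    rw [integral_blowUp μ hci.le, norm_smul_of_nonneg hci.le]
    calc _ ≤ c i * (C * R ^ (m + 1) * (r i ^ m * (1 / (j + 1)))) := by
          gcongr
          exact H.norm_integral_radial_le hri hbF hf hR hfR hRρ hC
      _ = 1 / (j + 1) * (C * R ^ (m + 1) * (c i * r i ^ m)) := by ring
      _ ≤ ε * (C * R ^ (m + 1) * M') := by gcongr
  calc _ ≤ ε * (blowUp μ (c i) (r i)).real (Metric.closedBall 0 (2 * R + ‖x‖ + 1)) +
        ε * (C * R ^ (m + 1) * M') :=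
          (norm_le_norm_sub_add _ _).trans (add_le_add hdiff hcenter)
    _ ≤ ε * L := by rw [hL, mul_add]; gcongr
    _ < ε₀ := hεL

theorem IsBlowUpLimit.isRadialCenter [IsLocallyFiniteMeasure ν] (h : IsBlowUpLimit μ ν c r)
    (H : CenterSequence m μ F A c₀ ρ) (hx : x ∈ ν.support) : IsRadialCenter ν x := by
  intro f hf R hR hfR
  have hf_cont := hf.continuous
  refine h.weakStarTendsto.integral_eq_zero (g := fun z => f ‖z - x‖ • (z - x)) (by fun_prop) ?_
    (h.tendsto_integral_radial H hx hf hR hfR)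
  refine hasCompactSupport_of_forall_le_norm (R := R + ‖x‖) fun z hz => ?_
  rw [hfR _ (by linarith [norm_sub_norm_le z x]), zero_smul]

end RadialCenter

section Cutoffs

theorem tendsto_smoothTransition_mul_add_one {a : ℕ → ℝ} (ha : Tendsto a atTop atTop) (s : ℝ) :
    Tendsto (fun k => Real.smoothTransition (a k * s + 1)) atTop (𝓝 (if 0 ≤ s then 1 else 0)) := by
  refine tendsto_const_nhds.congr' ?_
  split_ifs with hs
  · filter_upwards [ha.eventually_ge_atTop 0] with k hk
    exact (Real.smoothTransition.one_of_one_le (by linarith [mul_nonneg hk hs])).symm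
  · filter_upwards [ha.eventually_ge_atTop (1 / -s)] with k hk
    rw [div_le_iff₀ (by linarith)] at hk
    exact (Real.smoothTransition.zero_of_nonpos (by linarith)).symm

theorem smoothTransition_mul_smoothTransition_mem_Icc (s t : ℝ) :
    Real.smoothTransition s * Real.smoothTransition t ∈ Set.Icc 0 1 :=
  ⟨mul_nonneg (Real.smoothTransition.nonneg s) (Real.smoothTransition.nonneg t),
    mul_le_one₀ (Real.smoothTransition.le_one s) (Real.smoothTransition.nonneg t)
      (Real.smoothTransition.le_one t)⟩

/-- The kernel `t⁻ᵖ` cut off smoothly, with slope of order `a`, outside the interval `[r, R]`. The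
cutoffs tend to its restriction to `[r, R]` as `a → ∞`. -/
noncomputable def annularKernel (p : ℕ) (r R a t : ℝ) : ℝ :=
  Real.smoothTransition (a * (R - t) + 1) * Real.smoothTransition (a * (t - r) + 1) * (t ^ p)⁻¹

variable {p : ℕ} {r R a t : ℝ}

theorem annularKernel_of_add_one_le (ha : 1 ≤ a) (ht : R + 1 ≤ t) :
    annularKernel p r R a t = 0 := by
  rw [annularKernel, Real.smoothTransition.zero_of_nonpos (by nlinarith), zero_mul, zero_mul]

theorem annularKernel_of_le_half (hr : 0 < r) (ha : 2 / r ≤ a) (ht : t ≤ r / 2) :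
    annularKernel p r R a t = 0 := by
  have ha_pos : 0 < a := (by positivity : 0 < 2 / r).trans_le ha
  rw [div_le_iff₀ hr] at ha
  rw [annularKernel, Real.smoothTransition.zero_of_nonpos (x := a * (t - r) + 1) (by nlinarith),
    mul_zero, zero_mul]

theorem contDiff_annularKernel (p : ℕ) (hr : 0 < r) (R : ℝ) (ha : 2 / r ≤ a) :
    ContDiff ℝ 1 (annularKernel p r R a) := by
  refine contDiff_iff_contDiffAt.2 fun t => ?_
  rcases lt_or_ge t (r / 2) with ht | ht
  · refine (contDiffAt_const (c := (0 : ℝ))).congr_of_eventuallyEq ?_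
    filter_upwards [Iio_mem_nhds ht] with s hs using annularKernel_of_le_half hr ha hs.le
  · have hpow : t ^ p ≠ 0 := (pow_pos ((half_pos hr).trans_le ht) p).ne'
    have houter : ContDiff ℝ 1 fun t => Real.smoothTransition (a * (R - t) + 1) :=
      Real.smoothTransition.contDiff.comp (by fun_prop)
    have hinner : ContDiff ℝ 1 fun t => Real.smoothTransition (a * (t - r) + 1) :=
      Real.smoothTransition.contDiff.comp (by fun_prop)
    exact (houter.mul hinner).contDiffAt.mul ((contDiffAt_id.pow p).inv hpow)

theorem abs_annularKernel_le (p : ℕ) (hr : 0 < r) (R : ℝ) (ha : 2 / r ≤ a) (t : ℝ) :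
    |annularKernel p r R a t| ≤ ((r / 2) ^ p)⁻¹ := by
  rcases lt_or_ge t (r / 2) with ht | ht
  · rw [annularKernel_of_le_half hr ha ht.le, abs_zero]
    positivity
  · have ht_pos : 0 < t := (half_pos hr).trans_le ht
    obtain ⟨hcut_nonneg, hcut_le⟩ :=
      smoothTransition_mul_smoothTransition_mem_Icc (a * (R - t) + 1) (a * (t - r) + 1)
    rw [annularKernel, abs_of_nonneg (by positivity)]
    calc _ ≤ 1 * ((r / 2) ^ p)⁻¹ := by gcongr
      _ = _ := one_mul _

theorem tendsto_annularKernel (p : ℕ) (r R : ℝ) {a : ℕ → ℝ} (ha : Tendsto a atTop atTop) (t : ℝ) :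
    Tendsto (fun k => annularKernel p r R (a k) t) atTop
      (𝓝 (if r ≤ t ∧ t ≤ R then (t ^ p)⁻¹ else 0)) := by
  have hlim := ((tendsto_smoothTransition_mul_add_one ha (R - t)).mul
    (tendsto_smoothTransition_mul_add_one ha (t - r))).mul_const (t ^ p)⁻¹
  have hval : (if r ≤ t ∧ t ≤ R then (t ^ p)⁻¹ else 0) =
      (if 0 ≤ R - t then 1 else 0) * (if 0 ≤ t - r then 1 else 0) * (t ^ p)⁻¹ := by
    by_cases hr : r ≤ t <;> by_cases hR : t ≤ R <;> simp [hr, hR]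
  rwa [hval]

end Cutoffs

section Limits

variable {n : ℕ} {ν : Measure (Euc n)} [IsLocallyFiniteMeasure ν] {x : Euc n}

namespace IsRadialCenter

theorem integral_eq_zero_of_tendsto (hx : IsRadialCenter ν x) {f : ℕ → ℝ → ℝ} {g : ℝ → ℝ}
    {R C : ℝ} (hR : 0 < R) (hf : ∀ k, ContDiff ℝ 1 (f k)) (hfR : ∀ k, ∀ t ≥ R, f k t = 0)
    (hC : ∀ k t, |f k t| ≤ C) (hfg : ∀ t, Tendsto (fun k => f k t) atTop (𝓝 (g t))) :
    ∫ z, g ‖z - x‖ • (z - x) ∂ν = 0 := by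
  have hbound (k : ℕ) (z : Euc n) : ‖f k ‖z - x‖ • (z - x)‖ ≤
      (Metric.closedBall x R).indicator (fun _ => C * R) z := by
    rcases le_or_gt ‖z - x‖ R with hz | hz
    · rw [Set.indicator_of_mem (mem_closedBall_iff_norm.2 hz), norm_smul, Real.norm_eq_abs]
      gcongr
      · exact (abs_nonneg _).trans (hC k 0)
      · exact hC k _
    · rw [hfR k _ hz.le, zero_smul, norm_zero,
        Set.indicator_of_notMem fun hmem => hz.not_ge (mem_closedBall_iff_norm.1 hmem)]
  have hlim := tendsto_integral_of_dominated_convergence (μ := ν) _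
    (fun k => by have := (hf k).continuous; exact Continuous.aestronglyMeasurable (by fun_prop))
    ((integrable_indicator_iff measurableSet_closedBall).2
      (integrableOn_const measure_closedBall_lt_top.ne))
    (fun k => Eventually.of_forall (hbound k))
    (Eventually.of_forall fun z => (hfg ‖z - x‖).smul_const (z - x))
  simp only [hx _ (hf _) R hR (hfR _)] at hlim
  exact tendsto_nhds_unique hlim tendsto_const_nhds

theorem isPointOfSymmetry (hx : IsRadialCenter ν x) : IsPointOfSymmetry ν x := by
  intro y r hr
  have hslope (k : ℕ) : (1 : ℝ) ≤ k + 1 := le_add_of_nonneg_left k.cast_nonneg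
  have hradial := hx.integral_eq_zero_of_tendsto
    (f := fun k t => Real.smoothTransition ((k + 1) * (r - t) + 1)) (R := r + 1) (C := 1)
    (by positivity) (fun k => Real.smoothTransition.contDiff.comp (by fun_prop))
    (fun k t ht => Real.smoothTransition.zero_of_nonpos (by nlinarith [hslope k]))
    (fun k t => by
      rw [abs_of_nonneg (Real.smoothTransition.nonneg _)]
      exact Real.smoothTransition.le_one _)
    fun t => tendsto_smoothTransition_mul_add_one
      (tendsto_atTop_add_const_right _ 1 tendsto_natCast_atTop_atTop) (r - t)
  have hball : ∫ z in Metric.closedBall x r, (z - x) ∂ν = 0 := by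
    rw [← integral_indicator measurableSet_closedBall, ← hradial]
    congr 1
    ext1 z
    simp only [Set.indicator, mem_closedBall_iff_norm, sub_nonneg, ite_smul, one_smul, zero_smul]
  have hint : IntegrableOn (fun z => z - x) (Metric.closedBall x r) ν :=
    ContinuousOn.integrableOn_compact (isCompact_closedBall x r) (by fun_prop)
  simp only [real_inner_comm y]
  rw [integral_inner hint, hball, inner_zero_right]

theorem setIntegral_rieszKernel_annulus_eq_zero (hx : IsRadialCenter ν x) (m : ℕ) {r R : ℝ}
    (hr : 0 < r) (hrR : r < R) :
    ∫ y in {y : Euc n | r ≤ ‖y - x‖ ∧ ‖y - x‖ ≤ R}, rieszKernel m (y - x) ∂ν = 0 := by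
  let a (k : ℕ) : ℝ := k + (1 + 2 / r)
  have ha_one (k : ℕ) : 1 ≤ a k := by
    have : 0 ≤ 2 / r := by positivity
    linarith [k.cast_nonneg (α := ℝ)]
  have ha_div (k : ℕ) : 2 / r ≤ a k := by linarith [k.cast_nonneg (α := ℝ)]
  have hradial := hx.integral_eq_zero_of_tendsto (f := fun k => annularKernel (m + 1) r R (a k))
    (R := R + 1) (by linarith) (fun k => contDiff_annularKernel (m + 1) hr R (ha_div k))
    (fun k t ht => annularKernel_of_add_one_le (ha_one k) ht)
    (fun k => abs_annularKernel_le (m + 1) hr R (ha_div k))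
    (tendsto_annularKernel (m + 1) r R
      (tendsto_atTop_add_const_right _ _ tendsto_natCast_atTop_atTop))
  have hmeas : MeasurableSet {y : Euc n | r ≤ ‖y - x‖ ∧ ‖y - x‖ ≤ R} :=
    (by fun_prop : Measurable fun y : Euc n => ‖y - x‖) measurableSet_Icc
  rw [← integral_indicator hmeas, ← hradial]
  congr 1
  ext1 z
  simp only [Set.indicator, Set.mem_ofPred_eq, rieszKernel, ite_smul, zero_smul]
  congr

end IsRadialCenter

end Limits

section Tangents

variable {n : ℕ}

/-- The matrix `(Λ a)⁻¹` as an invertible operator, the shape of the `Λ`-ellipsoids around `a`. -/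
noncomputable def shapeUnit (Λ : Euc n → Matrix.GeneralLinearGroup (Fin n) ℝ) (a : Euc n) :
    (Euc n →L[ℝ] Euc n)ˣ :=
  Units.map (Matrix.toEuclideanCLM (𝕜 := ℝ) (n := Fin n) : Matrix (Fin n) (Fin n) ℝ →* _) (Λ a)⁻¹

theorem rescale_eq_comp (Λ : Euc n → Matrix.GeneralLinearGroup (Fin n) ℝ) (a : Euc n) (r : ℝ) :
    rescale Λ a r = (r⁻¹ • ·) ∘ fun z => (shapeUnit Λ a : Euc n →L[ℝ] Euc n) (z - a) :=
  funext fun z => map_smul (shapeUnit Λ a : Euc n →L[ℝ] Euc n) r⁻¹ (z - a)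

theorem exists_mem_lowerRegularSet {m : ℕ} {μ : Measure (Euc n)} [IsFiniteMeasure μ] {a : Euc n}
    (h : 0 < lowerDensity m μ a) : ∃ l, a ∈ lowerRegularSet m μ l := by
  obtain ⟨δ, hδ_pos, hδ⟩ := exists_between h
  obtain ⟨ρ, hρ, hlower⟩ := mem_nhdsGT_iff_exists_Ioo_subset.1 (eventually_lt_of_lt_liminf hδ)
  have hδ_real : 0 < δ.toReal := ENNReal.toReal_pos hδ_pos.ne' hδ.ne_top
  obtain ⟨l, hl⟩ := exists_nat_one_div_lt (lt_min hρ hδ_real)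
  obtain ⟨hlρ, hlδ⟩ := lt_min_iff.1 hl
  rw [div_lt_iff₀ (by positivity)] at hlδ
  refine ⟨l, fun r hr hrl => ?_⟩
  have hball : δ.toReal * r ^ m ≤ μ.real (Metric.closedBall a r) := by
    have hle := ENNReal.mul_le_of_le_div (hlower ⟨hr, hrl.trans hlρ⟩ : δ < _).le
    rw [← ENNReal.toReal_ofReal (by positivity : 0 ≤ r ^ m), ← ENNReal.toReal_mul]
    exact ENNReal.toReal_mono (measure_ne_top μ _) hle
  calc r ^ m ≤ (δ.toReal * (l + 1)) * r ^ m := le_mul_of_one_le_left (by positivity) hlδ.le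
    _ = (l + 1) * (δ.toReal * r ^ m) := by ring
    _ ≤ (l + 1) * μ.real (Metric.closedBall a r) := by gcongr

theorem exists_norm_sub_le_of_tendsto {E : Type*} [NormedAddCommGroup E] {T : ℝ → E} {v : E}
    (h : Tendsto T (𝓝[>] 0) (𝓝 v)) {ε : ℝ} (hε : 0 < ε) :
    ∃ ρ > 0, ∀ s t : ℝ, 0 < s → s < ρ → 0 < t → t < ρ → ‖T s - T t‖ ≤ ε := by
  obtain ⟨ρ, hρ, hclose⟩ := mem_nhdsGT_iff_exists_Ioo_subset.1
    (h.eventually (Metric.ball_mem_nhds v (half_pos hε)))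
  refine ⟨ρ, hρ, fun s t hs hsρ ht htρ => ?_⟩
  have hs_close : dist (T s) v < ε / 2 := hclose ⟨hs, hsρ⟩
  have ht_close : dist (T t) v < ε / 2 := hclose ⟨ht, htρ⟩
  rw [← dist_eq_norm]
  linarith [dist_triangle_right (T s) (T t) v]

theorem exists_isBlowUpLimit_of_mem_lambdaTangents
    {Λ : Euc n → Matrix.GeneralLinearGroup (Fin n) ℝ} {μ ν : Measure (Euc n)} {a : Euc n}
    (hν : ν ∈ lambdaTangents Λ μ a) : ∃ c r, IsBlowUpLimit
      (μ.map fun z => (shapeUnit Λ a : Euc n →L[ℝ] Euc n) (z - a)) ν c r := by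
  obtain ⟨-, -, c, r, hc, hr, hr_lim, hlim⟩ := hν
  refine ⟨c, r, hc, hr, hr_lim, ?_⟩
  convert hlim using 2 with i
  rw [blowUp, rescale_eq_comp, Measure.map_map (by fun_prop) (by fun_prop)]

end Tangents

theorem propositionp_general (n m : ℕ)
    (Λ : Euc n → Matrix.GeneralLinearGroup (Fin n) ℝ)
    (μ : Measure (Euc n)) [IsFiniteMeasure μ]
    (hdens : ∀ᵐ a ∂μ, 0 < lowerDensity m μ a)
    (hpv : ∀ᵐ a ∂μ, PrincipalValueExists m Λ μ a) :
    (∀ᵐ a ∂μ, ∀ ν ∈ lambdaTangents Λ μ a, ∀ x ∈ ν.support, ∀ r R : ℝ, 0 < r → r < R →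
      ∫ y in {y : Euc n | r ≤ ‖y - x‖ ∧ ‖y - x‖ ≤ R}, rieszKernel m (y - x) ∂ν = 0) ∧
    (∀ᵐ a ∂μ, lambdaTangents Λ μ a ⊆ symmetricMeasures n) := by
  have hcenters : ∀ᵐ a ∂μ, ∀ ν ∈ lambdaTangents Λ μ a,
      0 ∈ ν.support ∧ ∀ x ∈ ν.support, IsRadialCenter ν x := by
    filter_upwards [ae_exists_centerSequence (m := m) (B := shapeUnit Λ)
      (hdens.mono fun a ha => exists_mem_lowerRegularSet ha)
      (hpv.mono fun a ⟨v, hv⟩ ε hε => exists_norm_sub_le_of_tendsto hv hε)]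
      with a ⟨F, A, c₀, ρ, H⟩ ν hν
    have := hν.1
    obtain ⟨c, r, hblow⟩ := exists_isBlowUpLimit_of_mem_lambdaTangents hν
    exact ⟨hblow.zero_mem_support H hν.2.1, fun x hx => hblow.isRadialCenter H hx⟩
  refine ⟨?_, ?_⟩
  · filter_upwards [hcenters] with a ha ν hν x hx r R hr hrR
    have := hν.1
    exact ((ha ν hν).2 x hx).setIntegral_rieszKernel_annulus_eq_zero m hr hrR
  · filter_upwards [hcenters] with a ha ν hν
    have := hν.1
    exact ⟨⟨hν.1, hν.2.1, fun x hx => ((ha ν hν).2 x hx).isPointOfSymmetry⟩, (ha ν hν).1⟩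

theorem propositionp (n m : ℕ) (hm : 1 ≤ m) (hmn : m < n)
    (Λ : Euc n → Matrix.GeneralLinearGroup (Fin n) ℝ)
    (μ : Measure (Euc n)) [IsFiniteMeasure μ]
    (hdens : ∀ᵐ a ∂μ, 0 < lowerDensity m μ a)
    (hpv : ∀ᵐ a ∂μ, PrincipalValueExists m Λ μ a) :
    (∀ᵐ a ∂μ, ∀ ν ∈ lambdaTangents Λ μ a, ∀ x ∈ ν.support, ∀ r R : ℝ, 0 < r → r < R →
      ∫ y in {y : Euc n | r ≤ ‖y - x‖ ∧ ‖y - x‖ ≤ R}, rieszKernel m (y - x) ∂ν = 0) ∧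
    (∀ᵐ a ∂μ, lambdaTangents Λ μ a ⊆ symmetricMeasures n) :=
  propositionp_general n m Λ μ hdens hpv
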